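/- Identify the circle at infinity of the upper half-plane $\mathbb H$ with $\hat{\mathbb R}=\mathbb R\cup\{\infty\}$, and let $\hat{\mathbb Q}=\mathbb Q\cup\{\infty\}\subset\hat{\mathbb R}$, where $\infty=\frac10$. An ideal triangulation is given by its set of edges, which are complete geodesics of $\mathbb H$, each given by its pair of endpoints in $\hat{\mathbb R}$. The Farey triangulation $\mathcal F$ has as edges the pairs $\{\frac ab,\frac cd\}$ with $a,b,c,d\in\mathbb Z$ and $|ad-bc|=1$. A (simultaneous) flip of an ideal triangulation $\mathcal T$ chooses a finite or infinite set of quadrilaterals with pairwise disjoint interiors (they may share sides), each of which is the union of two triangles of $\mathcal T$ that share an edge, and replaces in each of them this edge, a diagonal of the quadrilateral, by the other diagonal. A developing map of an ideal triangulation $\mathcal T$ is a map $h:\hat{\mathbb Q}\to\hat{\mathbb R}$ that carries the set of edges of $\mathcal F$ onto the set of edges of $\mathcal T$ and sends the vertices of each triangle of $\mathcal F$, listed counterclockwise, to three distinct points in counterclockwise order. An orientation preserving homeomorphism $f:\hat{\mathbb R}\to\hat{\mathbb R}$ is quasisymmetric if there is $M>0$ such that $\frac1M\le\frac{|f(I)|}{|f(J)|}\le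 M$ for any two adjacent non-degenerate arcs $I,J$ (arcs that share an endpoint and have disjoint interiors) with $|I|=|J|$, where $|\cdot|$ is the arc length on the unit circle, with which $\hat{\mathbb R}$ is identified through $x\mapsto\frac{1+ix}{1-ix}$, $\infty\mapsto-1$. Corollary. Let $\mathcal T$ be an ideal triangulation obtained from the Farey triangulation $\mathcal F$ by finitely many (simultaneous) flips. Then $\mathcal T$ has a developing map, and every developing map $h:\hat{\mathbb Q}\to\hat{\mathbb R}$ of $\mathcal T$ is quasisymmetric, that is, $h$ is the restriction to $\hat{\mathbb Q}$ of a quasisymmetric homeomorphism of $\hat{\mathbb R}$. -/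

import Mathlib

noncomputable section

namespace FareyFlips

/-- The circle at infinity of the upper half-plane, the extended real line. -/
abbrev RHat : Type := OnePoint ℝ

/-- The extended rational numbers, the vertices of the Farey triangulation. -/
abbrev QHat : Type := OnePoint ℚ

/-- The inclusion of the extended rationals in the extended reals. -/
def incl : QHat → RHat := OnePoint.map (fun q : ℚ => (q : ℝ))

/-- The angle in `(-π, π]` of a point of the extended real line, seen on the unit circle through
the Cayley transform `x ↦ (1 + i x) / (1 - i x) = exp (2 i arctan x)`, `∞ ↦ -1 = exp (i π)`. -/
def angle (x : RHat) : ℝ := x.elim Real.pi (fun t : ℝ => 2 * Real.arctan t)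

/-- `x, y, z` are pairwise distinct and occur in this order when the circle is traversed
counterclockwise (the direction in which the real line increases). -/
def Positive (x y z : RHat) : Prop :=
  (angle x < angle y ∧ angle y < angle z) ∨
  (angle y < angle z ∧ angle z < angle x) ∨
  (angle z < angle x ∧ angle x < angle y)

/-- The length, on the unit circle, of the arc that runs counterclockwise from `x` to `y`
(`0` if `x = y`). -/
def arcLength (x y : RHat) : ℝ :=
  if angle x ≤ angle y then angle y - angle x else angle y - angle x + 2 * Real.pi

/-- Orientation preserving self-homeomorphisms of the circle. -/
def OrientationPreserving (f : RHat ≃ₜ RHat) : Prop :=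
  ∀ x y z : RHat, Positive x y z → Positive (f x) (f y) (f z)

/-- Quasisymmetric maps: `I` is the counterclockwise arc from `x` to `y` and `J` the one from `y` to
`z`; two arcs of equal length that follow one another do not overlap exactly if their common
length is at most `π`. As `f` preserves the orientation, `f(I)` is the counterclockwise arc
from `f x` to `f y`, and `f(J)` the one from `f y` to `f z`. -/
def Quasisymmetric (f : RHat ≃ₜ RHat) : Prop :=
  OrientationPreserving f ∧
  ∃ M : ℝ, 0 < M ∧ ∀ x y z : RHat, x ≠ y →
    arcLength x y = arcLength y z → arcLength x y ≤ Real.pi →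
    1 / M ≤ arcLength (f x) (f y) / arcLength (f y) (f z) ∧
    arcLength (f x) (f y) / arcLength (f y) (f z) ≤ M

/-- The point `a / b` of the extended rationals, with `a / 0 = ∞`. -/
def ratio (a b : ℤ) : QHat :=
  if b = 0 then OnePoint.infty else (((a : ℚ) / (b : ℚ) : ℚ) : QHat)

/-- The Farey edges as pairs of extended rationals: `a/b` and `c/d` are joined if and only if
`|ad - bc| = 1`. -/
def fareyEdges : Set (Sym2 QHat) :=
  {e | ∃ a b c d : ℤ, |a * d - b * c| = 1 ∧ e = s(ratio a b, ratio c d)}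

/-- The Farey triangulation of the hyperbolic plane. An ideal triangulation is given by the set
of its edges, and an edge, being a complete geodesic, by its two endpoints on the circle. -/
def farey : Set (Sym2 RHat) := Sym2.map incl '' fareyEdges

/-- The edges `ab`, `bc`, `ca` all belong to `T`. (In an ideal triangulation such edges always bound
a complementary triangle, since an ideal triangle contains no geodesic in its interior.) -/
def IsTriangle {V : Type*} (T : Set (Sym2 V)) (a b c : V) : Prop :=
  s(a, b) ∈ T ∧ s(b, c) ∈ T ∧ s(c, a) ∈ T

/-- There is an ideal quadrilateral with vertices `a, b, c, d` in counterclockwise order, made of the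
two triangles `abc` and `acd` of `T`, such that `e` is its diagonal `ac` (an edge of `T`)
and `e'` is its other diagonal `bd`. -/
def SwitchesDiagonal (T : Set (Sym2 RHat)) (e e' : Sym2 RHat) : Prop :=
  ∃ a b c d : RHat, Positive a b c ∧ Positive a c d ∧
    IsTriangle T a b c ∧ IsTriangle T a c d ∧ e = s(a, c) ∧ e' = s(b, d)

/-- `T'` is obtained from `T` by one (simultaneous) flip: a possibly infinite set `D` of edges,
each the diagonal of a quadrilateral of `T`, is replaced by the set of the opposite diagonals.
The quadrilaterals have disjoint interiors, that is, no triangle of `T` belongs to two of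
them, that is, no triangle of `T` has two sides in `D`. -/
def IsFlip (T T' : Set (Sym2 RHat)) : Prop :=
  ∃ D : Set (Sym2 RHat),
    (∀ e ∈ D, ∃ e', SwitchesDiagonal T e e') ∧
    (∀ a b c : RHat, a ≠ b → b ≠ c → c ≠ a → IsTriangle T a b c →
      ¬ (s(a, b) ∈ D ∧ s(b, c) ∈ D)) ∧
    T' = (T \ D) ∪ {e' | ∃ e ∈ D, SwitchesDiagonal T e e'}

/-- `T` is obtained from the Farey triangulation by finitely many (possibly no) flips. -/
def FlipReachable (T : Set (Sym2 RHat)) : Prop :=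
  Relation.ReflTransGen IsFlip farey T

/-- `h` is a developing map of the ideal triangulation `T`: it carries the set of edges of the Farey
triangulation onto the set of edges of `T`, and it carries counterclockwise triangles to
counterclockwise ones. (Two Farey triangles that share an edge hence go to the two triangles
of `T` on the two sides of the image edge, so that `h` is determined by the image of one
triangle.) No continuity or global monotonicity is required. -/
def IsDevelopingMap (T : Set (Sym2 RHat)) (h : QHat → RHat) : Prop :=
  Sym2.map h '' fareyEdges = T ∧
  ∀ x y z : QHat, IsTriangle fareyEdges x y z →
    Positive (incl x) (incl y) (incl z) → Positive (h x) (h y) (h z)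

end FareyFlips

end

/-! Everything is done in the class `QuasiMoebius` of circle homeomorphisms that distort bounded
cross ratios of cyclic quadruples boundedly. For orientation preserving maps this class is visibly
closed under composition, and its members are quasisymmetric (`QuasiMoebius.quasisymmetric`).

This reduces the corollary to one flip of the Farey triangulation. If T = f(farey), then a flip of T
is f of a flip of farey; if a developing map of the latter extends to a quasi-Möbius g, the new
triangulation is the image of farey under f ∘ g (`FlipReachable.exists_homeomorph`). For an
arbitrary developing map h of T = f(farey), the map f⁻¹ ∘ h develops farey itself, which is the case
of the empty flip.

For one flip, the combinatorial half shows that the flipped triangulation has no crossings, a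
triangle on each side of every edge, and is connected; a recursion along the Stern-Brocot tree then
builds a developing map (`exists_isDevelopingMap`). Any developing map is cyclically monotone
(`MapsTriangles.positive_of_lt`) and hits every rational point, so it extends to a homeomorphism
(`Flippable.exists_extension`). Kept Farey edges have determinant 1 in modulus and new diagonals at
most 2, so the extension is `FareyBounded`.

The analytic half is `FareyBounded.quasiMoebius`. A quadruple of bounded cross ratio has no short
side when seen from a suitable point of the upper half-plane. Integral matrices on either side of f
preserve `FareyBounded` and cross ratios, so this point may be put in the modular fundamental
domain, and the map may be assumed to fix ∞ and to send 0 into [0, 1]. Such a map sends p/q to a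
fraction of denominator at most 4^q and consecutive integers to points at distance between 1/4 and
2. Hence points that are not close stay apart, with constants independent of the map, and the image
quadruple again has bounded cross ratio. -/

noncomputable section

namespace FareyFlips

open OnePoint Filter Topology

/-! ### Homogeneous coordinates on the circle -/

/-- The first homogeneous coordinate of a point of the extended real line. -/
def nu (x : RHat) : ℝ := x.elim 1 id

/-- The second homogeneous coordinate of a point of the extended real line. -/
def de (x : RHat) : ℝ := x.elim 0 (fun _ => 1)

@[simp] lemma nu_infty : nu ∞ = 1 := rfl
@[simp] lemma nu_coe (t : ℝ) : nu (t : RHat) = t := rfl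
@[simp] lemma de_infty : de ∞ = 0 := rfl
@[simp] lemma de_coe (t : ℝ) : de (t : RHat) = 1 := rfl
@[simp] lemma angle_infty : angle ∞ = Real.pi := rfl
@[simp] lemma angle_coe (t : ℝ) : angle (t : RHat) = 2 * Real.arctan t := rfl

/-- The determinant of the homogeneous coordinates of two points. -/
def wedge (x y : RHat) : ℝ := nu x * de y - de x * nu y

lemma wedge_comm (x y : RHat) : wedge y x = -wedge x y := by unfold wedge; ring

lemma wedge_eq_zero {x y : RHat} : wedge x y = 0 ↔ x = y := by
  induction x using OnePoint.rec <;> induction y using OnePoint.rec <;>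
    simp [wedge, sub_eq_zero]

lemma wedge_ne_zero {x y : RHat} : wedge x y ≠ 0 ↔ x ≠ y := wedge_eq_zero.not

lemma norm_sq_pos (x : RHat) : 0 < nu x ^ 2 + de x ^ 2 := by
  induction x using OnePoint.rec <;> simp; positivity

lemma angle_coe_lt_pi (t : ℝ) : 2 * Real.arctan t < Real.pi := by
  linarith [Real.arctan_lt_pi_div_two t]

lemma neg_pi_lt_angle (x : RHat) : -Real.pi < angle x := by
  induction x using OnePoint.rec with
  | infty => simp [Real.pi_pos]
  | coe t => simp; linarith [Real.neg_pi_div_two_lt_arctan t]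

lemma angle_le_pi (x : RHat) : angle x ≤ Real.pi := by
  induction x using OnePoint.rec with
  | infty => simp
  | coe t => simp; linarith [angle_coe_lt_pi t]

lemma angle_coe_lt_coe {s t : ℝ} : 2 * Real.arctan s < 2 * Real.arctan t ↔ s < t := by
  rw [mul_lt_mul_iff_right₀ two_pos, Real.arctan_lt_arctan_iff]

lemma angle_injective : Function.Injective angle := by
  intro x y h
  induction x using OnePoint.rec with
  | infty =>
    induction y using OnePoint.rec with
    | infty => rfl
    | coe t => simp at h; linarith [angle_coe_lt_pi t]
  | coe s =>
    induction y using OnePoint.rec with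
    | infty => simp at h; linarith [angle_coe_lt_pi s]
    | coe t => simp at h; rw [h]

lemma cyclic_sign {a b c : ℝ} :
    ((a < b ∧ b < c) ∨ (b < c ∧ c < a) ∨ (c < a ∧ a < b)) ↔
      0 < (a - b) * (b - c) * (c - a) := by
  constructor
  · rintro (⟨h, h'⟩ | ⟨h, h'⟩ | ⟨h, h'⟩)
    · exact mul_pos (mul_pos_of_neg_of_neg (by linarith) (by linarith)) (by linarith)
    · rw [mul_assoc]
      exact mul_pos (by linarith) (mul_pos_of_neg_of_neg (by linarith) (by linarith))
    · have := mul_pos_of_neg_of_neg (sub_neg.2 h) (sub_neg.2 h')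
      nlinarith [mul_pos this (show 0 < b - c by linarith)]
  · intro h
    rcases lt_trichotomy a b with h1 | rfl | h1
    · rcases lt_trichotomy b c with h2 | rfl | h2
      · exact Or.inl ⟨h1, h2⟩
      · simp at h
      · have : c < a := by
          by_contra h3
          push Not at h3
          have := mul_nonpos_of_nonpos_of_nonneg
            (mul_nonpos_of_nonpos_of_nonneg (sub_nonpos.2 h1.le) (sub_nonneg.2 h2.le))
            (sub_nonneg.2 h3)
          linarith
        exact Or.inr (Or.inr ⟨this, h1⟩)
    · simp at h
    · rcases lt_trichotomy b c with h2 | rfl | h2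
      · have : c < a := by
          by_contra h3
          push Not at h3
          have := mul_nonpos_of_nonpos_of_nonneg
            (mul_nonpos_of_nonneg_of_nonpos (sub_nonneg.2 h1.le) (sub_nonpos.2 h2.le))
            (sub_nonneg.2 h3)
          linarith
        exact Or.inr (Or.inl ⟨h2, this⟩)
      · simp at h
      · have := mul_nonpos_of_nonneg_of_nonpos
          (mul_nonneg (sub_nonneg.2 h1.le) (sub_nonneg.2 h2.le))
          (show c - a ≤ 0 by linarith)
        linarith

lemma positive_coe {a b c : ℝ} : Positive (a : RHat) b c ↔
    ((a < b ∧ b < c) ∨ (b < c ∧ c < a) ∨ (c < a ∧ a < b)) := by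
  simp only [Positive, angle_coe, angle_coe_lt_coe]

lemma Positive.rotate {x y z : RHat} (h : Positive x y z) : Positive y z x := by
  unfold Positive at *; tauto

lemma positive_coe_coe_infty {a b : ℝ} : Positive (a : RHat) b ∞ ↔ a < b := by
  have := angle_coe_lt_pi a
  have := angle_coe_lt_pi b
  simp only [Positive, angle_coe, angle_coe_lt_coe, angle_infty]
  constructor
  · rintro (h | h | h)
    · exact h.1
    · linarith
    · linarith
  · intro h; exact Or.inl ⟨h, by linarith⟩

lemma Positive.ne {x y z : RHat} (h : Positive x y z) : x ≠ y := by
  rintro rfl; unfold Positive at h; grind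

lemma Positive.ne' {x y z : RHat} (h : Positive x y z) : z ≠ x := h.rotate.rotate.ne

/-- The product is quadratic in each coordinate vector, so its sign survives rescaling of the
representatives; this makes orientation computable from arbitrary homogeneous coordinates and
invariant under matrices of determinant one. -/
lemma positive_iff {x y z : RHat} :
    Positive x y z ↔ 0 < wedge x y * wedge y z * wedge z x := by
  have key : ∀ a b : RHat, ¬ Positive a a b := fun a b h => h.ne rfl
  have rot : ∀ a b c : RHat, Positive a b c ↔ Positive b c a :=
    fun a b c => ⟨fun h => h.rotate, fun h => h.rotate.rotate⟩
  induction x using OnePoint.rec with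
  | infty =>
    induction y using OnePoint.rec with
    | infty => simp [key, wedge]
    | coe b =>
      induction z using OnePoint.rec with
      | infty => rw [rot, rot]; simp [key, wedge]
      | coe c => rw [rot, positive_coe_coe_infty]; simp [wedge]
  | coe a =>
    induction y using OnePoint.rec with
    | infty =>
      induction z using OnePoint.rec with
      | infty => rw [rot]; simp [key, wedge]
      | coe c => rw [rot, rot, positive_coe_coe_infty]; simp [wedge]
    | coe b =>
      induction z using OnePoint.rec with
      | infty => rw [positive_coe_coe_infty]; simp [wedge]
      | coe c => rw [positive_coe, cyclic_sign]; simp [wedge]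

/-- Any three distinct points are in one of the two cyclic orders. -/
lemma positive_or_positive {x y z : RHat} (h1 : x ≠ y) (h2 : y ≠ z) (h3 : z ≠ x) :
    Positive x y z ∨ Positive y x z := by
  have h1 := angle_injective.ne h1
  have h2 := angle_injective.ne h2
  have h3 := angle_injective.ne h3
  unfold Positive; grind

lemma Positive.not_swap {x y z : RHat} (h : Positive x y z) : ¬ Positive y x z := by
  unfold Positive at *; grind

/-- Transitivity of the cyclic order. -/
lemma Positive.trans {a b c d : RHat} (h : Positive a b c) (h' : Positive a c d) :
    Positive a b d ∧ Positive b c d := by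
  unfold Positive at *; grind

/-- The point with homogeneous coordinates `a, b`. -/
def pt (a b : ℝ) : RHat := if b = 0 then ∞ else ((a / b : ℝ) : RHat)

@[simp] lemma pt_zero_right (a : ℝ) : pt a 0 = ∞ := by simp [pt]

@[simp] lemma pt_one (a : ℝ) : pt a 1 = (a : RHat) := by simp [pt]

lemma pt_spec {a b : ℝ} (h : a ≠ 0 ∨ b ≠ 0) :
    ∃ j : ℝ, j ≠ 0 ∧ a = j * nu (pt a b) ∧ b = j * de (pt a b) := by
  by_cases hb : b = 0
  · subst hb; exact ⟨a, by simpa using h, by simp, by simp⟩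
  · refine ⟨b, hb, ?_, ?_⟩ <;> simp [pt, hb]
    field_simp

lemma pt_nu_de (x : RHat) : pt (nu x) (de x) = x := by
  induction x using OnePoint.rec <;> simp

lemma pt_mul_left {j : ℝ} (hj : j ≠ 0) (a b : ℝ) : pt (j * a) (j * b) = pt a b := by
  by_cases hb : b = 0
  · simp [hb]
  · simp [pt, hb, hj]; rw [mul_div_mul_left _ _ hj]

lemma pt_neg (a b : ℝ) : pt (-a) (-b) = pt a b := by
  simpa using pt_mul_left (neg_ne_zero.2 one_ne_zero) a b

lemma nu_ne_or_de_ne (x : RHat) : nu x ≠ 0 ∨ de x ≠ 0 := by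
  induction x using OnePoint.rec <;> simp

lemma ne_of_det {a b c d : ℝ} (h : a * d - b * c ≠ 0) : a ≠ 0 ∨ b ≠ 0 := by
  by_contra hh; push Not at hh; simp [hh.1, hh.2] at h

lemma positive_pt {a b c d e f : ℝ}
    (h : 0 < (a * d - b * c) * (c * f - d * e) * (e * b - f * a)) :
    Positive (pt a b) (pt c d) (pt e f) := by
  have h1 : a * d - b * c ≠ 0 := by rintro h0; simp [h0] at h
  have h2 : c * f - d * e ≠ 0 := by rintro h0; simp [h0] at h
  have h3 : e * b - f * a ≠ 0 := by rintro h0; simp [h0] at h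
  obtain ⟨i, hi, hi1, hi2⟩ := pt_spec (ne_of_det h1)
  obtain ⟨j, hj, hj1, hj2⟩ := pt_spec (ne_of_det h2)
  obtain ⟨k, hk, hk1, hk2⟩ := pt_spec (ne_of_det h3)
  rw [positive_iff]
  generalize pt a b = x at *
  generalize pt c d = y at *
  generalize pt e f = z at *
  subst hi1 hi2 hj1 hj2 hk1 hk2
  have h0 : 0 < (i * j * k) ^ 2 := by positivity
  have h' : 0 < (i * j * k) ^ 2 * (wedge x y * wedge y z * wedge z x) :=
    h.trans_eq (by unfold wedge; ring)
  exact (mul_pos_iff_of_pos_left h0).1 h'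

lemma positive_pt_iff {a b c d e f : ℝ} (h1 : a ≠ 0 ∨ b ≠ 0) (h2 : c ≠ 0 ∨ d ≠ 0)
    (h3 : e ≠ 0 ∨ f ≠ 0) : Positive (pt a b) (pt c d) (pt e f) ↔
    0 < (a * d - b * c) * (c * f - d * e) * (e * b - f * a) := by
  refine ⟨fun h => ?_, positive_pt⟩
  obtain ⟨i, hi, hi1, hi2⟩ := pt_spec h1
  obtain ⟨j, hj, hj1, hj2⟩ := pt_spec h2
  obtain ⟨k, hk, hk1, hk2⟩ := pt_spec h3
  rw [positive_iff] at h
  generalize pt a b = x at *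
  generalize pt c d = y at *
  generalize pt e f = z at *
  subst hi1 hi2 hj1 hj2 hk1 hk2
  have : 0 < (i * j * k) ^ 2 * (wedge x y * wedge y z * wedge z x) :=
    mul_pos (by positivity) h
  convert this using 1
  unfold wedge; ring

lemma pt_eq_pt_iff {a b c d : ℝ} (h1 : a ≠ 0 ∨ b ≠ 0) (h2 : c ≠ 0 ∨ d ≠ 0) :
    pt a b = pt c d ↔ a * d - b * c = 0 := by
  obtain ⟨i, hi, hi1, hi2⟩ := pt_spec h1
  obtain ⟨j, hj, hj1, hj2⟩ := pt_spec h2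
  rw [← wedge_eq_zero]
  generalize pt a b = x at *
  generalize pt c d = y at *
  subst hi1 hi2 hj1 hj2
  rw [show i * nu x * (j * de y) - i * de x * (j * nu y) = i * j * wedge x y by
    unfold wedge; ring]
  simp [hi, hj]

/-! ### The circle in the plane -/

/-- The cosine of the angle of a point of the circle. -/
def cosAngle (x : RHat) : ℝ := (de x ^ 2 - nu x ^ 2) / (nu x ^ 2 + de x ^ 2)

/-- The sine of the angle of a point of the circle. -/
def sinAngle (x : RHat) : ℝ := 2 * (nu x * de x) / (nu x ^ 2 + de x ^ 2)

lemma continuous_cosAngle : Continuous cosAngle := by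
  rw [OnePoint.continuous_iff]
  simp only [cosAngle, nu_infty, de_infty, nu_coe, de_coe]
  constructor
  · have : Tendsto (fun t : ℝ => 2 / (t ^ 2 + 1) - 1) (coclosedCompact ℝ) (𝓝 (0 - 1)) := by
      refine Tendsto.sub_const (Tendsto.const_div_atTop ?_ _) _
      rw [coclosedCompact_eq_cocompact]
      refine tendsto_atTop_add_const_right _ _ ?_
      have := (tendsto_pow_atTop (α := ℝ) two_ne_zero).comp (tendsto_norm_cocompact_atTop (E := ℝ))
      simpa [Function.comp_def] using this
    convert this using 2
    · field_simp; ring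
    · norm_num
  · have : ∀ t : ℝ, t ^ 2 + 1 ^ 2 ≠ 0 := fun t => by positivity
    fun_prop (disch := exact this _)

lemma continuous_sinAngle : Continuous sinAngle := by
  rw [OnePoint.continuous_iff]
  simp only [sinAngle, nu_infty, de_infty, nu_coe, de_coe]
  constructor
  · have h0 : Tendsto (fun t : ℝ => 2 / |t|) (coclosedCompact ℝ) (𝓝 0) := by
      refine Tendsto.const_div_atTop ?_ _
      rw [coclosedCompact_eq_cocompact]
      exact tendsto_norm_cocompact_atTop (E := ℝ)
    rw [show 2 * ((1 : ℝ) * 0) / (1 ^ 2 + 0 ^ 2) = 0 by norm_num]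
    refine squeeze_zero_norm (fun t => ?_) h0
    rcases eq_or_ne t 0 with rfl | ht
    · simp
    · have := abs_pos.2 ht
      rw [Real.norm_eq_abs, abs_div, mul_one, abs_mul, abs_two,
        abs_of_pos (show 0 < t ^ 2 + 1 ^ 2 by positivity), div_le_div_iff₀ (by positivity) this]
      nlinarith [sq_abs t]
  · have : ∀ t : ℝ, t ^ 2 + 1 ^ 2 ≠ 0 := fun t => by positivity
    fun_prop (disch := exact this _)

lemma circle_injective : Function.Injective (fun x => (cosAngle x, sinAngle x)) := by
  intro x y h
  have hx := norm_sq_pos x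
  have hy := norm_sq_pos y
  simp only [Prod.mk.injEq, cosAngle, sinAngle] at h
  obtain ⟨h1, h2⟩ := h
  rw [div_eq_div_iff hx.ne' hy.ne'] at h1 h2
  rw [← wedge_eq_zero]
  -- Two equal unit vectors have inner product 1; with denominators cleared, one minus the inner
  -- product becomes twice `wedge x y ^ 2`.
  have : 2 * (nu x ^ 2 + de x ^ 2) * wedge x y ^ 2 = 0 := by
    unfold wedge
    linear_combination (de x ^ 2 - nu x ^ 2) * h1 + 2 * (nu x * de x) * h2
  simpa [hx.ne'] using this

/-- An injective continuous map from a compact space to the plane is an embedding, so continuity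
into the circle can be tested on two real functions. -/
lemma continuous_iff_circle {X : Type*} [TopologicalSpace X] {f : X → RHat} :
    Continuous f ↔ Continuous (fun x => cosAngle (f x)) ∧ Continuous (fun x => sinAngle (f x)) := by
  have : IsEmbedding (fun x => (cosAngle x, sinAngle x)) :=
    ((continuous_cosAngle.prodMk continuous_sinAngle).isClosedEmbedding circle_injective).isEmbedding
  rw [this.continuous_iff, continuous_prodMk]
  rfl

/-! ### Möbius transformations -/

/-- The Möbius transformation `x ↦ (a x + b) / (c x + d)`. -/
def mobFun (a b c d : ℝ) (x : RHat) : RHat := pt (a * nu x + b * de x) (c * nu x + d * de x)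

lemma mob_ne {a b c d : ℝ} (h : a * d - b * c = 1) {p q : ℝ} (hp : p ≠ 0 ∨ q ≠ 0) :
    a * p + b * q ≠ 0 ∨ c * p + d * q ≠ 0 := by
  by_contra hh
  push Not at hh
  have h1 : p = 0 := by linear_combination d * hh.1 - b * hh.2 - p * h
  have h2 : q = 0 := by linear_combination a * hh.2 - c * hh.1 - q * h
  simp [h1, h2] at hp

lemma mobFun_pt {a b c d : ℝ} {p q : ℝ} (hp : p ≠ 0 ∨ q ≠ 0) :
    mobFun a b c d (pt p q) = pt (a * p + b * q) (c * p + d * q) := by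
  obtain ⟨j, hj, h1, h2⟩ := pt_spec hp
  unfold mobFun
  generalize pt p q = x at *
  subst h1 h2
  rw [← pt_mul_left hj]
  congr 1 <;> ring

lemma mobFun_mobFun {a b c d : ℝ} (h : a * d - b * c = 1) (x : RHat) :
    mobFun d (-b) (-c) a (mobFun a b c d x) = x := by
  conv_lhs => rw [mobFun.eq_1 a, mobFun_pt (mob_ne h (nu_ne_or_de_ne x))]
  conv_rhs => rw [← pt_nu_de x]
  congr 1
  · linear_combination nu x * h
  · linear_combination de x * h

/-- The cosine and sine of the image are quotients of quadratic forms in the homogeneous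
coordinates. Divided by the squared norm, each form is an affine function of the cosine and sine of
x, and the denominator never vanishes; the pole needs no separate treatment. -/
lemma continuous_mobFun {a b c d : ℝ} (h : a * d - b * c = 1) : Continuous (mobFun a b c d) := by
  have pos : ∀ x : RHat, 0 < (a * nu x + b * de x) ^ 2 + (c * nu x + d * de x) ^ 2 := fun x => by
    rcases mob_ne h (nu_ne_or_de_ne x) with h | h <;> positivity
  have cx : ∀ x : RHat, nu x ^ 2 / (nu x ^ 2 + de x ^ 2) = (1 - cosAngle x) / 2 := fun x => by
    have := (norm_sq_pos x).ne'
    unfold cosAngle; field_simp; ring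
  have cy : ∀ x : RHat, de x ^ 2 / (nu x ^ 2 + de x ^ 2) = (1 + cosAngle x) / 2 := fun x => by
    have := (norm_sq_pos x).ne'
    unfold cosAngle; field_simp; ring
  have quad : ∀ p q r : ℝ, Continuous (fun x : RHat =>
      (p * nu x ^ 2 + q * (nu x * de x) + r * de x ^ 2) / (nu x ^ 2 + de x ^ 2)) := fun p q r => by
    have : (fun x : RHat => (p * nu x ^ 2 + q * (nu x * de x) + r * de x ^ 2) /
        (nu x ^ 2 + de x ^ 2)) =
        fun x => p * ((1 - cosAngle x) / 2) + q * (sinAngle x / 2) + r * ((1 + cosAngle x) / 2) := by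
      ext x
      rw [← cx, ← cy, sinAngle]
      have := (norm_sq_pos x).ne'
      field_simp
    rw [this]
    have := continuous_cosAngle
    have := continuous_sinAngle
    fun_prop
  have ratio : ∀ p q r : ℝ, Continuous (fun x : RHat =>
      (p * nu x ^ 2 + q * (nu x * de x) + r * de x ^ 2) /
        ((a * nu x + b * de x) ^ 2 + (c * nu x + d * de x) ^ 2)) := fun p q r => by
    have h2 := quad (a ^ 2 + c ^ 2) (2 * (a * b + c * d)) (b ^ 2 + d ^ 2)
    have e : ∀ x : RHat, (a ^ 2 + c ^ 2) * nu x ^ 2 + 2 * (a * b + c * d) * (nu x * de x) +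
        (b ^ 2 + d ^ 2) * de x ^ 2 = (a * nu x + b * de x) ^ 2 + (c * nu x + d * de x) ^ 2 :=
      fun x => by ring
    simp only [e] at h2
    refine ((quad p q r).div h2 fun x => ?_).congr fun x => ?_
    · exact (div_pos (pos x) (norm_sq_pos x)).ne'
    · simp only [Pi.div_apply]
      exact div_div_div_cancel_right₀ (norm_sq_pos x).ne' _ _
  rw [continuous_iff_circle]
  constructor
  · refine (ratio (c ^ 2 - a ^ 2) (2 * (c * d - a * b)) (d ^ 2 - b ^ 2)).congr fun x => ?_
    obtain ⟨j, hj, h1, h2⟩ := pt_spec (mob_ne h (nu_ne_or_de_ne x))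
    have hn := (norm_sq_pos (mobFun a b c d x)).ne'
    change _ = j * nu (mobFun a b c d x) at h1
    change _ = j * de (mobFun a b c d x) at h2
    rw [h1, h2, cosAngle, show (c ^ 2 - a ^ 2) * nu x ^ 2 + 2 * (c * d - a * b) * (nu x * de x) +
      (d ^ 2 - b ^ 2) * de x ^ 2 = (c * nu x + d * de x) ^ 2 - (a * nu x + b * de x) ^ 2 by ring,
      h1, h2]
    field_simp
  · refine (ratio (2 * (a * c)) (2 * (a * d + b * c)) (2 * (b * d))).congr fun x => ?_
    obtain ⟨j, hj, h1, h2⟩ := pt_spec (mob_ne h (nu_ne_or_de_ne x))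
    have hn := (norm_sq_pos (mobFun a b c d x)).ne'
    change _ = j * nu (mobFun a b c d x) at h1
    change _ = j * de (mobFun a b c d x) at h2
    rw [h1, h2, sinAngle, show 2 * (a * c) * nu x ^ 2 + 2 * (a * d + b * c) * (nu x * de x) +
      2 * (b * d) * de x ^ 2 = 2 * ((a * nu x + b * de x) * (c * nu x + d * de x)) by ring,
      h1, h2]
    field_simp

/-- The Möbius transformation of a matrix of determinant one, as a homeomorphism. -/
def mob (a b c d : ℝ) (h : a * d - b * c = 1) : RHat ≃ₜ RHat where
  toFun := mobFun a b c d
  invFun := mobFun d (-b) (-c) a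
  left_inv := mobFun_mobFun h
  right_inv x := by
    simpa using mobFun_mobFun (a := d) (b := -b) (c := -c) (d := a) (by linarith) x
  continuous_toFun := continuous_mobFun h
  continuous_invFun := continuous_mobFun (by linarith)

lemma mob_pt {a b c d : ℝ} (h : a * d - b * c = 1) {p q : ℝ} (hp : p ≠ 0 ∨ q ≠ 0) :
    mob a b c d h (pt p q) = pt (a * p + b * q) (c * p + d * q) := mobFun_pt hp

lemma mob_symm_pt {a b c d : ℝ} (h : a * d - b * c = 1) {p q : ℝ} (hp : p ≠ 0 ∨ q ≠ 0) :
    (mob a b c d h).symm (pt p q) = pt (d * p + -b * q) (-c * p + a * q) := mobFun_pt hp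

lemma mob_spec {a b c d : ℝ} (h : a * d - b * c = 1) (x : RHat) :
    ∃ j : ℝ, j ≠ 0 ∧ a * nu x + b * de x = j * nu (mob a b c d h x) ∧
      c * nu x + d * de x = j * de (mob a b c d h x) :=
  pt_spec (mob_ne h (nu_ne_or_de_ne x))

/-- The matrix preserves determinants of vectors, and returning to the normalized coordinates costs
one factor per point. These factors cancel in every cross ratio and enter `positive_iff` only as
squares. -/
lemma exists_wedge_mob {a b c d : ℝ} (h : a * d - b * c = 1) :
    ∃ j : RHat → ℝ, (∀ x, j x ≠ 0) ∧
      ∀ x y, wedge x y = j x * j y * wedge (mob a b c d h x) (mob a b c d h y) := by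
  choose j hj h1 h2 using mob_spec h
  refine ⟨j, hj, fun x y => ?_⟩
  calc wedge x y = (a * nu x + b * de x) * (c * nu y + d * de y)
        - (c * nu x + d * de x) * (a * nu y + b * de y) := by
        unfold wedge; linear_combination (-(nu x * de y) + de x * nu y) * h
    _ = _ := by rw [h1, h1, h2, h2]; unfold wedge; ring

lemma orientationPreserving_mob {a b c d : ℝ} (h : a * d - b * c = 1) :
    OrientationPreserving (mob a b c d h) := by
  intro x y z hp
  obtain ⟨j, hj, hw⟩ := exists_wedge_mob h
  rw [positive_iff] at *
  rw [hw, hw y, hw z] at hp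
  have h0 : 0 < (j x * j y * j z) ^ 2 := by
    have := hj x; have := hj y; have := hj z; positivity
  have h' : 0 < (j x * j y * j z) ^ 2 * (wedge (mob a b c d h x) (mob a b c d h y) *
      wedge (mob a b c d h y) (mob a b c d h z) * wedge (mob a b c d h z) (mob a b c d h x)) :=
    hp.trans_eq (by ring)
  exact (mul_pos_iff_of_pos_left h0).1 h'

lemma OrientationPreserving.iff {f : RHat ≃ₜ RHat} (hf : OrientationPreserving f) {x y z : RHat} :
    Positive (f x) (f y) (f z) ↔ Positive x y z := by
  refine ⟨fun h => ?_, hf x y z⟩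
  rcases positive_or_positive (x := x) (y := y) (z := z) (fun e => h.ne (by rw [e]))
    (fun e => h.rotate.ne (by rw [e])) (fun e => h.ne' (by rw [e])) with h' | h'
  · exact h'
  · exact absurd h (hf _ _ _ h').not_swap

lemma OrientationPreserving.symm {f : RHat ≃ₜ RHat} (hf : OrientationPreserving f) :
    OrientationPreserving f.symm := fun _ _ _ h => by
  rw [← hf.iff]; simpa using h

lemma OrientationPreserving.trans {f g : RHat ≃ₜ RHat} (hf : OrientationPreserving f)
    (hg : OrientationPreserving g) : OrientationPreserving (f.trans g) :=
  fun _ _ _ h => hg _ _ _ (hf _ _ _ h)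

/-! ### Cross ratios and quasi-Möbius maps -/

/-- The modulus of the cross ratio of `a, b, c, d` lies between `1 / K` and `K`. -/
def Balanced (K : ℝ) (a b c d : RHat) : Prop :=
  |wedge a b * wedge c d| ≤ K * |wedge b c * wedge d a| ∧
  |wedge b c * wedge d a| ≤ K * |wedge a b * wedge c d|

/-- Homeomorphisms that distort bounded cross ratios of cyclically ordered quadruples in a
bounded way. -/
def QuasiMoebius (f : RHat ≃ₜ RHat) : Prop :=
  ∀ K : ℝ, ∃ L : ℝ, ∀ a b c d : RHat, Positive a b c → Positive a c d → Balanced K a b c d →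
    Balanced L (f a) (f b) (f c) (f d)

lemma QuasiMoebius.trans {f g : RHat ≃ₜ RHat} (hf : QuasiMoebius f)
    (of : OrientationPreserving f) (hg : QuasiMoebius g) : QuasiMoebius (f.trans g) := fun K => by
  obtain ⟨L, hL⟩ := hf K
  obtain ⟨L', hL'⟩ := hg L
  exact ⟨L', fun a b c d h h' hb => hL' _ _ _ _ (of _ _ _ h) (of _ _ _ h') (hL a b c d h h' hb)⟩

lemma quasiMoebius_refl : QuasiMoebius (Homeomorph.refl RHat) :=
  fun K => ⟨K, fun _ _ _ _ _ _ h => h⟩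

lemma balanced_mob_iff {a b c d : ℝ} (h : a * d - b * c = 1) {K : ℝ} {x y z w : RHat} :
    Balanced K (mob a b c d h x) (mob a b c d h y) (mob a b c d h z) (mob a b c d h w) ↔
      Balanced K x y z w := by
  obtain ⟨j, hj, hw⟩ := exists_wedge_mob h
  have hpos : 0 < |j x * j y * j z * j w| := by
    have := hj x; have := hj y; have := hj z; have := hj w; positivity
  unfold Balanced
  generalize mob a b c d h = m at *
  rw [hw x y, hw z w, hw y z, hw w x,
    show j x * j y * wedge (m x) (m y) * (j z * j w * wedge (m z) (m w)) =
      (j x * j y * j z * j w) * (wedge (m x) (m y) * wedge (m z) (m w)) by ring,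
    show j y * j z * wedge (m y) (m z) * (j w * j x * wedge (m w) (m x)) =
      (j x * j y * j z * j w) * (wedge (m y) (m z) * wedge (m w) (m x)) by ring,
    abs_mul (j x * j y * j z * j w), abs_mul (j x * j y * j z * j w),
    mul_left_comm K, mul_left_comm K, mul_le_mul_iff_right₀ hpos, mul_le_mul_iff_right₀ hpos]

/-! ### Chords and arcs -/

/-- Half the distance in the plane of two points of the unit circle. -/
def chord (x y : RHat) : ℝ := Real.sin (arcLength x y / 2)

lemma rad_pos (x : RHat) : 0 < √(nu x ^ 2 + de x ^ 2) := Real.sqrt_pos.2 (norm_sq_pos x)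

lemma nu_eq (x : RHat) : nu x = √(nu x ^ 2 + de x ^ 2) * Real.sin (angle x / 2) := by
  induction x using OnePoint.rec with
  | infty => simp
  | coe t =>
    have : √(t ^ 2 + 1) ≠ 0 := (Real.sqrt_pos.2 (by positivity)).ne'
    simp [Real.sin_arctan]
    rw [add_comm 1]
    field_simp

lemma de_eq (x : RHat) : de x = √(nu x ^ 2 + de x ^ 2) * Real.cos (angle x / 2) := by
  induction x using OnePoint.rec with
  | infty => simp
  | coe t =>
    have : √(t ^ 2 + 1) ≠ 0 := (Real.sqrt_pos.2 (by positivity)).ne'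
    simp [Real.cos_arctan]
    rw [add_comm 1]
    field_simp

lemma wedge_eq (x y : RHat) : wedge x y =
    √(nu x ^ 2 + de x ^ 2) * √(nu y ^ 2 + de y ^ 2) * Real.sin ((angle x - angle y) / 2) := by
  rw [sub_div, Real.sin_sub]
  unfold wedge
  linear_combination de y * nu_eq x + (√(nu x ^ 2 + de x ^ 2) * Real.sin (angle x / 2)) * de_eq y
    - nu y * de_eq x - (√(nu x ^ 2 + de x ^ 2) * Real.cos (angle x / 2)) * nu_eq y

lemma arcLength_nonneg (x y : RHat) : 0 ≤ arcLength x y := by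
  have := neg_pi_lt_angle y
  have := angle_le_pi x
  unfold arcLength; split_ifs <;> linarith

lemma arcLength_lt (x y : RHat) : arcLength x y < 2 * Real.pi := by
  have := neg_pi_lt_angle x
  have := angle_le_pi y
  have := Real.pi_pos
  unfold arcLength; split_ifs <;> linarith

lemma arcLength_pos {x y : RHat} (h : x ≠ y) : 0 < arcLength x y := by
  have h := angle_injective.ne h
  have := neg_pi_lt_angle y
  have := angle_le_pi x
  unfold arcLength
  split_ifs with h'
  · linarith [lt_of_le_of_ne h' h]
  · linarith

lemma chord_nonneg (x y : RHat) : 0 ≤ chord x y :=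
  Real.sin_nonneg_of_nonneg_of_le_pi (by linarith [arcLength_nonneg x y])
    (by linarith [arcLength_lt x y])

lemma chord_eq_abs (x y : RHat) : chord x y = |Real.sin ((angle x - angle y) / 2)| := by
  rw [← abs_of_nonneg (chord_nonneg x y)]
  unfold chord arcLength
  split_ifs
  · rw [← abs_neg, ← Real.sin_neg]; congr 2; ring
  · rw [add_div, mul_div_cancel_left₀ _ (two_ne_zero' ℝ), Real.sin_add_pi, ← Real.sin_neg]
    congr 2; ring

/-- The bridge between the algebra and arc lengths: in cross ratios the norms cancel, so
determinants may be replaced by chords. -/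
lemma abs_wedge (x y : RHat) : |wedge x y| =
    √(nu x ^ 2 + de x ^ 2) * √(nu y ^ 2 + de y ^ 2) * chord x y := by
  rw [wedge_eq, abs_mul, chord_eq_abs, abs_of_nonneg]
  positivity

lemma balanced_iff_chord {K : ℝ} {a b c d : RHat} : Balanced K a b c d ↔
    chord a b * chord c d ≤ K * (chord b c * chord d a) ∧
    chord b c * chord d a ≤ K * (chord a b * chord c d) := by
  unfold Balanced
  simp only [abs_mul, abs_wedge]
  have ha := rad_pos a
  have hb := rad_pos b
  have hc := rad_pos c
  have hd := rad_pos d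
  generalize √(nu a ^ 2 + de a ^ 2) = p at *
  generalize √(nu b ^ 2 + de b ^ 2) = q at *
  generalize √(nu c ^ 2 + de c ^ 2) = r at *
  generalize √(nu d ^ 2 + de d ^ 2) = s at *
  have hpos : 0 < p * q * r * s := by positivity
  rw [show p * q * chord a b * (r * s * chord c d) =
      (p * q * r * s) * (chord a b * chord c d) by ring,
    show q * r * chord b c * (s * p * chord d a) =
      (p * q * r * s) * (chord b c * chord d a) by ring,
    mul_left_comm K (p * q * r * s), mul_left_comm K (p * q * r * s),
    mul_le_mul_iff_right₀ hpos, mul_le_mul_iff_right₀ hpos]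

lemma chord_sq (x y : RHat) :
    chord x y ^ 2 = (1 - (cosAngle x * cosAngle y + sinAngle x * sinAngle y)) / 2 := by
  have hx := (norm_sq_pos x).ne'
  have hy := (norm_sq_pos y).ne'
  have h : wedge x y ^ 2 = (nu x ^ 2 + de x ^ 2) * (nu y ^ 2 + de y ^ 2) * chord x y ^ 2 := by
    rw [← sq_abs, abs_wedge, mul_pow, mul_pow, Real.sq_sqrt (norm_sq_pos x).le,
      Real.sq_sqrt (norm_sq_pos y).le]
  have h2 : chord x y ^ 2 = wedge x y ^ 2 / ((nu x ^ 2 + de x ^ 2) * (nu y ^ 2 + de y ^ 2)) := by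
    rw [h]; field_simp
  rw [h2, cosAngle, sinAngle, cosAngle, sinAngle, wedge]
  field_simp
  ring

/-- `arcLength` jumps between 0 and 2π at the diagonal, but its half-sine does not; the compactness
argument below therefore uses chords. -/
lemma continuous_chord : Continuous (fun p : RHat × RHat => chord p.1 p.2) := by
  have : (fun p : RHat × RHat => chord p.1 p.2) = fun p => √((1 - (cosAngle p.1 * cosAngle p.2 +
      sinAngle p.1 * sinAngle p.2)) / 2) := by
    ext p; rw [← chord_sq, Real.sqrt_sq (chord_nonneg _ _)]
  rw [this]
  have := continuous_cosAngle
  have := continuous_sinAngle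
  fun_prop

lemma chord_pos {x y : RHat} (h : x ≠ y) : 0 < chord x y :=
  Real.sin_pos_of_pos_of_lt_pi (by linarith [arcLength_pos h]) (by linarith [arcLength_lt x y])

lemma exists_chord_lower_bound (f : RHat ≃ₜ RHat) {c : ℝ} (hc : 0 < c) :
    ∃ δ : ℝ, 0 < δ ∧ ∀ x y : RHat, c ≤ chord x y → δ ≤ chord (f x) (f y) := by
  have hK : IsCompact {p : RHat × RHat | c ≤ chord p.1 p.2} :=
    (isClosed_le continuous_const continuous_chord).isCompact
  have hcont : Continuous fun p : RHat × RHat => chord (f p.1) (f p.2) :=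
    continuous_chord.comp (f := fun p : RHat × RHat => (f p.1, f p.2)) (by fun_prop)
  rcases Set.eq_empty_or_nonempty {p : RHat × RHat | c ≤ chord p.1 p.2} with h | h
  · exact ⟨1, one_pos, fun x y hxy => (Set.eq_empty_iff_forall_notMem.1 h (x, y) hxy).elim⟩
  · obtain ⟨p, hp, hmin⟩ := hK.exists_isMinOn h hcont.continuousOn
    refine ⟨_, chord_pos (f.injective.ne (fun e => ?_)), fun x y hxy => hmin (a := (x, y)) hxy⟩
    have : c ≤ chord p.1 p.2 := hp
    rw [e] at this
    simp [chord, arcLength] at this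
    linarith

lemma exists_angle_eq {α : ℝ} (h1 : -Real.pi < α) (h2 : α ≤ Real.pi) :
    ∃ x : RHat, angle x = α := by
  rcases h2.eq_or_lt with rfl | h2
  · exact ⟨∞, rfl⟩
  · refine ⟨(Real.tan (α / 2) : ℝ), ?_⟩
    rw [angle_coe, Real.arctan_tan] <;> linarith

lemma arcLength_add_arcLength {a b c d : RHat} (h : Positive a b c) (h' : Positive a c d) :
    arcLength a b + arcLength b c + arcLength c d + arcLength d a = 2 * Real.pi := by
  unfold Positive at *
  unfold arcLength
  rcases h with h | h | h <;> rcases h' with h' | h' | h' <;> split_ifs <;> linarith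

/-- The point w is the antipode of y, which gives a kite: adjacent sides agree in pairs, so the two
products of opposite chords are equal. -/
lemma exists_opposite {x y z : RHat} (hxy : x ≠ y) (h : arcLength x y = arcLength y z)
    (hlt : arcLength x y < Real.pi) :
    ∃ w, Positive x y z ∧ Positive x z w ∧ arcLength z w = Real.pi - arcLength x y ∧
      arcLength w x = Real.pi - arcLength x y := by
  have hne := angle_injective.ne hxy
  have := Real.pi_pos
  have := neg_pi_lt_angle x
  have := angle_le_pi x
  have := neg_pi_lt_angle y
  have := angle_le_pi y
  have := neg_pi_lt_angle z
  have := angle_le_pi z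
  obtain ⟨w, hw⟩ : ∃ w : RHat, angle w = if angle y ≤ 0 then angle y + Real.pi
      else angle y - Real.pi := by
    apply exists_angle_eq <;> split_ifs <;> linarith
  refine ⟨w, ?_⟩
  unfold arcLength Positive at *
  rcases lt_or_gt_of_ne hne with h0 | h0
  · rw [if_pos h0.le] at *
    split_ifs at h hw
    all_goals
      refine ⟨?_, ?_, ?_, ?_⟩
      · grind
      · grind
      · split_ifs <;> linarith
      · split_ifs <;> linarith
  · rw [if_neg h0.not_ge] at *
    split_ifs at h hw
    all_goals
      refine ⟨?_, ?_, ?_, ?_⟩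
      · grind
      · grind
      · split_ifs <;> linarith
      · split_ifs <;> linarith

/-- A lower bound for the chord of an arc whose complement is not too short. -/
lemma mul_le_sin_half {δ A : ℝ} (h0 : 0 ≤ A) (hδ : 0 ≤ δ)
    (hA : A ≤ 2 * Real.pi - 2 * δ) : δ / Real.pi ^ 2 * A ≤ Real.sin (A / 2) := by
  have hpi := Real.pi_pos
  rcases le_total A Real.pi with h | h
  · have h1 := Real.mul_le_sin (x := A / 2) (by linarith) (by linarith)
    refine le_trans ?_ h1
    rw [show 2 / Real.pi * (A / 2) = (Real.pi / Real.pi ^ 2) * A by field_simp]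
    have : δ ≤ Real.pi := by linarith [Real.pi_gt_three]
    gcongr
  · have h1 := Real.mul_le_sin (x := Real.pi - A / 2) (by linarith) (by linarith)
    rw [Real.sin_pi_sub] at h1
    refine le_trans ?_ h1
    calc δ / Real.pi ^ 2 * A ≤ δ / Real.pi ^ 2 * (2 * Real.pi) := by gcongr; linarith
      _ = 2 / Real.pi * δ := by field_simp
      _ ≤ _ := by gcongr; linarith

lemma ratio_bounds {A B M : ℝ} (hB : 0 < B) (hM : 0 < M) (h1 : A ≤ M * B)
    (h2 : B ≤ M * A) : 1 / M ≤ A / B ∧ A / B ≤ M := by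
  constructor
  · rw [div_le_div_iff₀ hM hB]; linarith
  · rwa [div_le_iff₀ hB]

/-- Since C/2 ≥ sin(C/2) ≥ δ, the arc A leaves a gap of at least 2δ, and its chord is then
comparable to A. The chord of B is at most B, and that of E at most 1. -/
lemma arc_le_of_chord {δ L A B C E : ℝ} (hδ : 0 < δ) (hA : 0 ≤ A) (hB : 0 ≤ B)
    (hC : 0 ≤ C) (hAC : A + C ≤ 2 * Real.pi) (hCδ : δ ≤ Real.sin (C / 2))
    (hB' : 0 ≤ Real.sin (B / 2)) (hE : 0 ≤ Real.sin (E / 2))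
    (h : Real.sin (A / 2) * Real.sin (C / 2) ≤ L * (Real.sin (B / 2) * Real.sin (E / 2))) :
    A ≤ |L| * Real.pi ^ 2 / δ ^ 2 * B := by
  have h1 : Real.sin (C / 2) ≤ C / 2 := Real.sin_le (by linarith)
  have h2 := mul_le_sin_half hA hδ.le (by linarith)
  have h3 : Real.sin (B / 2) ≤ B := (Real.sin_le (by linarith)).trans (by linarith)
  have hpi := Real.pi_pos
  have h5 : δ / Real.pi ^ 2 * A * δ ≤ |L| * B := calc
    δ / Real.pi ^ 2 * A * δ ≤ Real.sin (A / 2) * Real.sin (C / 2) :=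
      mul_le_mul h2 hCδ hδ.le (le_trans (by positivity) h2)
    _ ≤ L * (Real.sin (B / 2) * Real.sin (E / 2)) := h
    _ ≤ |L| * (B * 1) := by
      gcongr
      · exact le_abs_self L
      · exact Real.sin_le_one _
    _ = |L| * B := by ring
  rw [div_mul_eq_mul_div, le_div_iff₀ (by positivity)]
  have h6 : Real.pi ^ 2 * (δ / Real.pi ^ 2 * A * δ) ≤ Real.pi ^ 2 * (|L| * B) := by gcongr
  have h7 : Real.pi ^ 2 * (δ / Real.pi ^ 2 * A * δ) = A * δ ^ 2 := by field_simp
  linarith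

/-- Quasi-Möbius homeomorphisms of the circle are quasisymmetric. -/
theorem QuasiMoebius.quasisymmetric {f : RHat ≃ₜ RHat} (hf : QuasiMoebius f)
    (of : OrientationPreserving f) : Quasisymmetric f := by
  have hpi := Real.pi_pos
  have hs : 0 < Real.sin (Real.pi / 4) :=
    Real.sin_pos_of_pos_of_lt_pi (by linarith) (by linarith)
  obtain ⟨L, hL⟩ := hf 1
  obtain ⟨δ, hδ, hfδ⟩ := exists_chord_lower_bound f hs
  -- The first summand serves arcs shorter than π/2, the second the longer ones.
  have hM : 0 < |L| * Real.pi ^ 2 / δ ^ 2 + Real.pi / δ := by positivity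
  refine ⟨of, _, hM, fun x y z hxy heq hle => ?_⟩
  have hyz : y ≠ z := by
    rintro rfl
    have := arcLength_pos hxy
    rw [heq] at this
    simp [arcLength] at this
  have hA := arcLength_pos (f.injective.ne hxy)
  have hB := arcLength_pos (f.injective.ne hyz)
  rcases le_or_gt (Real.pi / 2) (arcLength x y) with hbig | hsmall
  -- Long arcs need only compactness: their chords are at least sin(π/4), so both image arcs have
  -- length at least 2δ, and any arc is shorter than 2π.
  · have key : ∀ p q, Real.pi / 2 ≤ arcLength p q → arcLength p q ≤ Real.pi →
        2 * δ ≤ arcLength (f p) (f q) := fun p q h1 h2 => by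
      have h3 := hfδ p q
        (Real.sin_le_sin_of_le_of_le_pi_div_two (by linarith) (by linarith) (by linarith))
      have h4 : chord (f p) (f q) ≤ arcLength (f p) (f q) / 2 :=
        Real.sin_le (by linarith [arcLength_nonneg (f p) (f q)])
      linarith
    have key2 : ∀ A B : ℝ, A < 2 * Real.pi → 2 * δ ≤ B →
        A ≤ (|L| * Real.pi ^ 2 / δ ^ 2 + Real.pi / δ) * B := fun A B h1 h2 => by
      calc A ≤ Real.pi / δ * (2 * δ) := by
            rw [show Real.pi / δ * (2 * δ) = 2 * Real.pi by field_simp]; exact h1.le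
        _ ≤ _ := by
          have : 0 ≤ |L| * Real.pi ^ 2 / δ ^ 2 := by positivity
          gcongr
          linarith
    exact ratio_bounds hB hM
      (key2 _ _ (arcLength_lt _ _) (key _ _ (heq ▸ hbig) (heq ▸ hle)))
      (key2 _ _ (arcLength_lt _ _) (key _ _ hbig hle))
  -- For short arcs the kite has cross ratio of modulus 1, and its two sides at w are longer than
  -- π/2, so their images have chords at least δ.
  · obtain ⟨w, hp, hp', hzw, hwx⟩ := exists_opposite hxy heq (by linarith)
    have hbal : Balanced 1 x y z w := by
      rw [balanced_iff_chord]
      simp only [chord, hzw, hwx, ← heq]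
      constructor <;> linarith
    have hbal' := balanced_iff_chord.1 (hL x y z w hp hp' hbal)
    have h0 := arcLength_pos hxy
    have hC : δ ≤ chord (f z) (f w) := hfδ z w
      (Real.sin_le_sin_of_le_of_le_pi_div_two (by linarith) (by linarith) (by linarith))
    have hE : δ ≤ chord (f w) (f x) := hfδ w x
      (Real.sin_le_sin_of_le_of_le_pi_div_two (by linarith) (by linarith) (by linarith))
    have hsum := arcLength_add_arcLength (of _ _ _ hp) (of _ _ _ hp')
    have hC0 := arcLength_nonneg (f z) (f w)
    have hE0 := arcLength_nonneg (f w) (f x)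
    have mono : ∀ B : ℝ, 0 ≤ B → |L| * Real.pi ^ 2 / δ ^ 2 * B ≤
        (|L| * Real.pi ^ 2 / δ ^ 2 + Real.pi / δ) * B := fun B hB => by
      have : 0 ≤ Real.pi / δ := by positivity
      gcongr
      linarith
    refine ratio_bounds hB hM ((arc_le_of_chord hδ hA.le hB.le hC0 (by linarith) hC
      (chord_nonneg _ _) (chord_nonneg _ _) hbal'.1).trans (mono _ hB.le))
      ((arc_le_of_chord hδ hB.le hA.le hE0 (by linarith) hE
      (chord_nonneg _ _) (chord_nonneg _ _) hbal'.2).trans (mono _ hA.le))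

/-! ### Positive definite forms and reduction -/

/-- The positive definite quadratic form of determinant one with root `u + T i`, evaluated at the
homogeneous coordinates of a point. -/
def heightForm (u T : ℝ) (x : RHat) : ℝ := ((nu x - u * de x) ^ 2 + T ^ 2 * de x ^ 2) / T

/-- Lagrange's identity for a form of determinant one: the difference of the two sides is the square
of the associated bilinear form. -/
lemma wedge_sq_le {u T : ℝ} (hT : 0 < T) (x y : RHat) :
    wedge x y ^ 2 ≤ heightForm u T x * heightForm u T y := by
  unfold heightForm wedge
  rw [div_mul_div_comm, le_div_iff₀ (by positivity)]
  nlinarith [sq_nonneg ((nu x - u * de x) * (nu y - u * de y) + T ^ 2 * (de x * de y))]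

/-- The four sides of the quadrilateral `a b c d` are not short when seen from the root of the
form. -/
def SeparatedFrom (ε u T : ℝ) (a b c d : RHat) : Prop :=
  ε * (heightForm u T a * heightForm u T b) ≤ wedge a b ^ 2 ∧
  ε * (heightForm u T b * heightForm u T c) ≤ wedge b c ^ 2 ∧
  ε * (heightForm u T c * heightForm u T d) ≤ wedge c d ^ 2 ∧
  ε * (heightForm u T d * heightForm u T a) ≤ wedge d a ^ 2

/-- One pair of opposite sides is bounded above by `wedge_sq_le`, the other below by separation;
each vertex enters both bounds once, so the heights cancel. -/
lemma SeparatedFrom.balanced {ε u T : ℝ} (hε : 0 < ε) (hT : 0 < T) {a b c d : RHat}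
    (h : SeparatedFrom ε u T a b c d) : Balanced (1 / ε) a b c d := by
  obtain ⟨h1, h2, h3, h4⟩ := h
  have nn : ∀ x, 0 ≤ heightForm u T x := fun x => by unfold heightForm; positivity
  have key : ∀ p q r s : RHat,
      ε * (heightForm u T q * heightForm u T r) ≤ wedge q r ^ 2 →
      ε * (heightForm u T s * heightForm u T p) ≤ wedge s p ^ 2 →
      |wedge p q * wedge r s| ≤ 1 / ε * |wedge q r * wedge s p| := fun p q r s h h' => by
    rw [one_div_mul_eq_div, le_div_iff₀ hε]
    refine abs_le_of_sq_le_sq' ?_ (abs_nonneg _) |>.2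
    rw [sq_abs, mul_pow, sq_abs, mul_pow, mul_pow]
    calc wedge p q ^ 2 * wedge r s ^ 2 * ε ^ 2
        ≤ (heightForm u T p * heightForm u T q) * (heightForm u T r * heightForm u T s) * ε ^ 2 := by
          gcongr <;> first | exact wedge_sq_le hT _ _ | exact mul_nonneg (nn _) (nn _)
      _ = (ε * (heightForm u T q * heightForm u T r)) *
          (ε * (heightForm u T s * heightForm u T p)) := by ring
      _ ≤ _ := by
          have := nn p; have := nn q; have := nn r; have := nn s
          gcongr
  refine ⟨key a b c d h2 h4, ?_⟩
  have := key b c d a h3 h1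
  rwa [mul_comm (wedge c d)] at this

/-- The point is the foot of the perpendicular from a to the geodesic bd. From there ab and da are
seen with ratio exactly 1/2, while balance bounds the ratios of bc and cd below by 1/(1 + K²); the
constant 1/(2 + K²) covers all four. -/
lemma exists_separatedFrom {K : ℝ} {a b c d : RHat} (hab : a ≠ b) (hbc : b ≠ c) (hcd : c ≠ d)
    (hda : d ≠ a) (hbd : b ≠ d) (h : Balanced K a b c d) :
    ∃ u T : ℝ, 0 < T ∧ SeparatedFrom (1 / (2 + K ^ 2)) u T a b c d := by
  have hP := abs_pos.2 (wedge_ne_zero.2 hab)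
  have hR := abs_pos.2 (wedge_ne_zero.2 hbc)
  have hS := abs_pos.2 (wedge_ne_zero.2 hcd)
  have hU := abs_pos.2 (wedge_ne_zero.2 hda)
  have hV := abs_pos.2 (wedge_ne_zero.2 hbd)
  unfold Balanced at h
  rw [abs_mul, abs_mul] at h
  set P := |wedge a b| with hPdef
  set R := |wedge b c| with hRdef
  set S := |wedge c d| with hSdef
  set U := |wedge d a| with hUdef
  set V := |wedge b d| with hVdef
  have eP : wedge a b ^ 2 = P ^ 2 := (sq_abs _).symm
  have eR : wedge b c ^ 2 = R ^ 2 := (sq_abs _).symm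
  have eS : wedge c d ^ 2 = S ^ 2 := (sq_abs _).symm
  have eU : wedge d a ^ 2 = U ^ 2 := (sq_abs _).symm
  have eV : wedge b d ^ 2 = V ^ 2 := (sq_abs _).symm
  -- The form α n² + 2β nd + γ d² is the weighted sum of the squares of the determinants with b and
  -- d. The weights make its two terms equal at a, and V normalizes its determinant to one; its root
  -- is -β/α + i/α.
  set α := (U / P * de b ^ 2 + P / U * de d ^ 2) / V with hα
  set β := -(U / P * (de b * nu b) + P / U * (de d * nu d)) / V with hβ
  set γ := (U / P * nu b ^ 2 + P / U * nu d ^ 2) / V with hγ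
  have hdet : α * γ = 1 + β ^ 2 := by
    have : 1 = (nu b * de d - de b * nu d) ^ 2 / V ^ 2 := by
      rw [← eV]; unfold wedge; rw [div_self]
      have := wedge_ne_zero.2 hbd
      exact pow_ne_zero _ this
    rw [this, hα, hβ, hγ]
    field_simp
    ring
  have hα0 : 0 < α := by
    have h1 : 0 ≤ α := by positivity
    have h2 : 0 ≤ γ := by positivity
    rcases h1.eq_or_lt with h1 | h1
    · rw [← h1] at hdet; nlinarith [sq_nonneg β]
    · exact h1
  have hQ : ∀ x, heightForm (-β / α) (1 / α) x =
      (U / P * wedge x b ^ 2 + P / U * wedge x d ^ 2) / V := fun x => by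
    have e1 : heightForm (-β / α) (1 / α) x =
        α * nu x ^ 2 + 2 * β * (nu x * de x) + γ * de x ^ 2 := by
      have : γ = (1 + β ^ 2) / α := by rw [← hdet]; field_simp
      rw [this]; unfold heightForm; field_simp; ring
    rw [e1, hα, hβ, hγ]; unfold wedge; field_simp; ring
  have w0 : ∀ x, wedge x x = 0 := fun x => by unfold wedge; ring
  have qa : heightForm (-β / α) (1 / α) a = 2 * P * U / V := by
    rw [hQ, eP, wedge_comm d a, neg_sq, eU]; field_simp; ring
  have qb : heightForm (-β / α) (1 / α) b = P / U * V := by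
    rw [hQ, w0, eV]; field_simp; ring
  have qc : heightForm (-β / α) (1 / α) c = (U / P * R ^ 2 + P / U * S ^ 2) / V := by
    rw [hQ, wedge_comm b c, neg_sq, eR, eS]
  have qd : heightForm (-β / α) (1 / α) d = U / P * V := by
    rw [hQ, w0, wedge_comm b d, neg_sq, eV]; field_simp; ring
  have hK : 0 < 2 + K ^ 2 := by positivity
  refine ⟨-β / α, 1 / α, by positivity, ?_⟩
  unfold SeparatedFrom
  rw [qa, qb, qc, qd, eP, eR, eS, eU]
  simp only [one_div_mul_eq_div]
  refine ⟨?_, ?_, ?_, ?_⟩ <;> rw [div_le_iff₀ hK]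
  · rw [show 2 * P * U / V * (P / U * V) = 2 * P ^ 2 by field_simp]
    linarith [mul_pow P K 2 ▸ sq_nonneg (P * K)]
  · rw [show P / U * V * ((U / P * R ^ 2 + P / U * S ^ 2) / V) = R ^ 2 + (P * S / U) ^ 2 by
      field_simp]
    have : P * S / U ≤ K * R := by rw [div_le_iff₀ hU]; linarith [h.1]
    have h2 := pow_le_pow_left₀ (by positivity) this 2
    rw [mul_pow] at h2
    linarith [sq_nonneg R]
  · rw [show (U / P * R ^ 2 + P / U * S ^ 2) / V * (U / P * V) = S ^ 2 + (U * R / P) ^ 2 by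
      field_simp; ring]
    have : U * R / P ≤ K * S := by rw [div_le_iff₀ hP]; linarith [h.2]
    have h2 := pow_le_pow_left₀ (by positivity) this 2
    rw [mul_pow] at h2
    linarith [sq_nonneg S]
  · rw [show U / P * V * (2 * P * U / V) = 2 * U ^ 2 by field_simp]
    linarith [mul_pow U K 2 ▸ sq_nonneg (U * K)]

/-- Reduction of a form by an integral matrix. -/
lemma exists_reduction (u T : ℝ) (hT : 0 < T) :
    ∃ (p q r s : ℤ) (_ : p * s - q * r = 1) (u' T' : ℝ), 0 < T' ∧ 3 ≤ 4 * T' ^ 2 ∧ |u'| ≤ 1 / 2 ∧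
      ∀ v w : ℝ, ((p * v + q * w - u' * (r * v + s * w)) ^ 2 + T' ^ 2 * (r * v + s * w) ^ 2) / T' =
        ((v - u * w) ^ 2 + T ^ 2 * w ^ 2) / T := by
  let τ : UpperHalfPlane := ⟨⟨u, T⟩, hT⟩
  obtain ⟨g, hg⟩ := ModularGroup.exists_smul_mem_fd τ
  have hdet := g.det_coe
  rw [Matrix.det_fin_two] at hdet
  refine ⟨g 0 0, g 0 1, g 1 0, g 1 1, hdet, (g • τ).re, (g • τ).im, (g • τ).im_pos,
    ModularGroup.three_le_four_mul_im_sq_of_mem_fd hg, hg.2, fun v w => ?_⟩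
  have him : (g • τ).im = T / Complex.normSq ((g 1 0 : ℂ) * τ + g 1 1) := by
    rw [ModularGroup.im_smul_eq_div_normSq, ModularGroup.denom_apply]; rfl
  have hcoe : ((g • τ : UpperHalfPlane) : ℂ) =
      ((g 0 0 : ℂ) * τ + g 0 1) / ((g 1 0 : ℂ) * τ + g 1 1) := by
    rw [UpperHalfPlane.coe_specialLinearGroup_apply]; simp
  have hD : ((g 1 0 : ℂ) * τ + g 1 1) ≠ 0 := by
    intro h0
    have := (g • τ).im_pos
    rw [him, h0] at this
    simp at this
  have hns : ∀ (z : UpperHalfPlane) (x y : ℝ), (x - z.re * y) ^ 2 + z.im ^ 2 * y ^ 2 =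
      Complex.normSq ((x : ℂ) - y * z) := fun z x y => by
    rw [Complex.normSq_apply]
    simp [UpperHalfPlane.coe_re, UpperHalfPlane.coe_im]
    ring
  have e2 := hns τ v w
  have hτ1 : τ.re = u := rfl
  have hτ2 : τ.im = T := rfl
  rw [hτ1, hτ2] at e2
  rw [hns, e2, him, hcoe]
  -- The form is |v - wτ|² / Im τ, and the numerator and Im τ acquire the same factor |rτ + s|⁻²
  -- under g.
  have e3 : ((((g 0 0 : ℤ) : ℝ) * v + ((g 0 1 : ℤ) : ℝ) * w : ℝ) : ℂ) -
      ((((g 1 0 : ℤ) : ℝ) * v + ((g 1 1 : ℤ) : ℝ) * w : ℝ) : ℂ) *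
      (((g 0 0 : ℂ) * τ + g 0 1) / ((g 1 0 : ℂ) * τ + g 1 1)) =
      ((v : ℂ) - w * τ) / ((g 1 0 : ℂ) * τ + g 1 1) := by
    have hc : (g 0 0 : ℂ) * g 1 1 - g 0 1 * g 1 0 = 1 := by exact_mod_cast hdet
    rw [eq_div_iff hD, sub_mul, mul_assoc, div_mul_cancel₀ _ hD]
    push_cast
    linear_combination ((v : ℂ) - w * τ) * hc
  rw [e3, map_div₀, div_div_div_cancel_right₀]
  exact (Complex.normSq_pos.2 hD).ne'

/-- The identity `e` is exact on vectors; normalizing the image vectors by factors i and j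
multiplies both sides of the inequality by i²j². -/
lemma heightForm_mob {p q r s u T u' T' : ℝ} (h : p * s - q * r = 1) (hT' : 0 < T')
    (e : ∀ v w : ℝ, ((p * v + q * w - u' * (r * v + s * w)) ^ 2 + T' ^ 2 * (r * v + s * w) ^ 2) / T'
      = ((v - u * w) ^ 2 + T ^ 2 * w ^ 2) / T) (ε : ℝ) (x y : RHat) :
    ε * (heightForm u' T' (mob p q r s h x) * heightForm u' T' (mob p q r s h y)) ≤
      wedge (mob p q r s h x) (mob p q r s h y) ^ 2 ↔
    ε * (heightForm u T x * heightForm u T y) ≤ wedge x y ^ 2 := by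
  obtain ⟨i, hi, hi1, hi2⟩ := mob_spec h x
  obtain ⟨j, hj, hj1, hj2⟩ := mob_spec h y
  have hx : heightForm u T x = i ^ 2 * heightForm u' T' (mob p q r s h x) := by
    unfold heightForm; rw [← e, hi1, hi2]; field_simp
  have hy : heightForm u T y = j ^ 2 * heightForm u' T' (mob p q r s h y) := by
    unfold heightForm; rw [← e, hj1, hj2]; field_simp
  have hw : wedge x y = i * j * wedge (mob p q r s h x) (mob p q r s h y) := by
    calc wedge x y = (p * nu x + q * de x) * (r * nu y + s * de y)
          - (r * nu x + s * de x) * (p * nu y + q * de y) := by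
          unfold wedge; linear_combination (-(nu x * de y) + de x * nu y) * h
      _ = _ := by rw [hi1, hi2, hj1, hj2]; unfold wedge; ring
  have hpos : 0 < i ^ 2 * j ^ 2 := by positivity
  generalize mob p q r s h x = x' at *
  generalize mob p q r s h y = y' at *
  rw [hx, hy, hw, show ε * (i ^ 2 * heightForm u' T' x' * (j ^ 2 * heightForm u' T' y')) =
    i ^ 2 * j ^ 2 * (ε * (heightForm u' T' x' * heightForm u' T' y')) by ring,
    show (i * j * wedge x' y') ^ 2 = i ^ 2 * j ^ 2 * wedge x' y' ^ 2 by ring,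
    mul_le_mul_iff_right₀ hpos]

/-- A balanced quadruple is carried by an integral matrix to one that is separated when seen from
a point of the modular fundamental domain. -/
lemma exists_mob_separatedFrom {K : ℝ} {a b c d : RHat} (hp : Positive a b c) (hp' : Positive a c d)
    (h : Balanced K a b c d) : ∃ (p q r s : ℤ) (hdet : (p : ℝ) * s - q * r = 1) (u T : ℝ),
      0 < T ∧ 3 ≤ 4 * T ^ 2 ∧ |u| ≤ 1 / 2 ∧
      SeparatedFrom (1 / (2 + K ^ 2)) u T (mob p q r s hdet a) (mob p q r s hdet b)
        (mob p q r s hdet c) (mob p q r s hdet d) := by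
  obtain ⟨u, T, hT, hsep⟩ := exists_separatedFrom hp.ne hp.rotate.ne hp'.rotate.ne hp'.ne'
    (hp.trans hp').2.ne'.symm h
  obtain ⟨p, q, r, s, hdet, u', T', hT', h3, hu, e⟩ := exists_reduction u T hT
  have hdet' : (p : ℝ) * s - q * r = 1 := by exact_mod_cast hdet
  refine ⟨p, q, r, s, hdet', u', T', hT', h3, hu, ?_⟩
  have key := heightForm_mob hdet' hT' e
  exact ⟨(key _ _ _).2 hsep.1, (key _ _ _).2 hsep.2.1, (key _ _ _).2 hsep.2.2.1,
    (key _ _ _).2 hsep.2.2.2⟩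

/-! ### Integral points and maps of bounded Farey distortion -/

/-- The point `a / b` of the circle. -/
def ipt (a b : ℤ) : RHat := pt a b

lemma IsCoprime.cast_ne {a b : ℤ} (h : IsCoprime a b) : (a : ℝ) ≠ 0 ∨ (b : ℝ) ≠ 0 := by
  rcases h.ne_zero_or_ne_zero with h | h
  · exact Or.inl (by exact_mod_cast h)
  · exact Or.inr (by exact_mod_cast h)

lemma isCoprime_of_det {a b c d : ℤ} (h : a * d - b * c = 1) : IsCoprime a b :=
  ⟨d, -c, by linarith⟩

lemma isCoprime_of_det' {a b c d : ℤ} (h : a * d - b * c = 1) : IsCoprime c d :=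
  ⟨-b, a, by linarith⟩

lemma ipt_eq_ipt_iff {a b c d : ℤ} (h1 : IsCoprime a b) (h2 : IsCoprime c d) :
    ipt a b = ipt c d ↔ a * d - b * c = 0 := by
  unfold ipt
  rw [pt_eq_pt_iff (IsCoprime.cast_ne h1) (IsCoprime.cast_ne h2)]
  exact_mod_cast Iff.rfl

/-- Consequently the modulus of the determinant of reduced representatives depends only on the two
points. -/
lemma eq_or_neg_of_ipt_eq {a b c d : ℤ} (h1 : IsCoprime a b) (h2 : IsCoprime c d)
    (h : ipt a b = ipt c d) : (c = a ∧ d = b) ∨ (c = -a ∧ d = -b) := by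
  rw [ipt_eq_ipt_iff h1 h2] at h
  have hbd : b ∣ d := (h1.symm).dvd_of_dvd_mul_left (show b ∣ a * d from ⟨c, by linarith⟩)
  have hdb : d ∣ b := (h2.symm).dvd_of_dvd_mul_right (show d ∣ b * c from ⟨a, by linarith⟩)
  have hac : a ∣ c := h1.dvd_of_dvd_mul_left (show a ∣ b * c from ⟨d, by linarith⟩)
  have hca : c ∣ a := h2.dvd_of_dvd_mul_right (show c ∣ a * d from ⟨b, by linarith⟩)
  have e1 := Int.natAbs_eq_natAbs_iff.1 (Nat.dvd_antisymm (Int.natAbs_dvd_natAbs.2 hbd)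
    (Int.natAbs_dvd_natAbs.2 hdb))
  have e2 := Int.natAbs_eq_natAbs_iff.1 (Nat.dvd_antisymm (Int.natAbs_dvd_natAbs.2 hac)
    (Int.natAbs_dvd_natAbs.2 hca))
  rcases e1 with rfl | rfl <;> rcases e2 with rfl | rfl
  · simp
  · have : c = 0 ∨ b = 0 := by
      have : c * b = 0 := by linarith
      exact mul_eq_zero.1 this
    rcases this with rfl | rfl <;> simp
  · have : a = 0 ∨ d = 0 := by
      have : a * d = 0 := by linarith
      exact mul_eq_zero.1 this
    rcases this with rfl | rfl <;> simp
  · simp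

/-- Neighbours in the Farey triangulation are mapped to points whose reduced representatives have
determinant at most two in modulus. -/
def FareyBounded (f : RHat → RHat) : Prop :=
  ∀ a b c d : ℤ, a * d - b * c = 1 → ∃ a' b' c' d' : ℤ, IsCoprime a' b' ∧ IsCoprime c' d' ∧
    f (ipt a b) = ipt a' b' ∧ f (ipt c d) = ipt c' d' ∧ |a' * d' - b' * c'| ≤ 2

lemma FareyBounded.exists_rep {f : RHat → RHat} (hf : FareyBounded f) {a b : ℤ}
    (h : IsCoprime a b) : ∃ a' b' : ℤ, IsCoprime a' b' ∧ f (ipt a b) = ipt a' b' := by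
  obtain ⟨u, v, h⟩ := h
  obtain ⟨a', b', -, -, h1, -, h2, -⟩ := hf a b (-v) u (by linarith)
  exact ⟨a', b', h1, h2⟩

lemma FareyBounded.det_le {f : RHat → RHat} (hf : FareyBounded f) {a b c d x y z w : ℤ}
    (h : a * d - b * c = 1) (h1 : IsCoprime x y) (h2 : IsCoprime z w) (e1 : f (ipt a b) = ipt x y)
    (e2 : f (ipt c d) = ipt z w) : |x * w - y * z| ≤ 2 := by
  obtain ⟨a', b', c', d', k1, k2, f1, f2, hle⟩ := hf a b c d h
  rcases eq_or_neg_of_ipt_eq k1 h1 (f1.symm.trans e1) with ⟨rfl, rfl⟩ | ⟨rfl, rfl⟩ <;>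
  rcases eq_or_neg_of_ipt_eq k2 h2 (f2.symm.trans e2) with ⟨rfl, rfl⟩ | ⟨rfl, rfl⟩
  · exact hle
  · rw [← abs_neg]; convert hle using 2; ring
  · rw [← abs_neg]; convert hle using 2; ring
  · convert hle using 2; ring

lemma mob_ipt {p q r s : ℤ} (h : (p : ℝ) * s - q * r = 1) {a b : ℤ} (hab : IsCoprime a b) :
    mob p q r s h (ipt a b) = ipt (p * a + q * b) (r * a + s * b) := by
  unfold ipt; rw [mob_pt h (IsCoprime.cast_ne hab)]; push_cast; rfl

lemma mob_symm_ipt {p q r s : ℤ} (h : (p : ℝ) * s - q * r = 1) {a b : ℤ} (hab : IsCoprime a b) :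
    (mob p q r s h).symm (ipt a b) = ipt (s * a + -q * b) (-r * a + p * b) := by
  unfold ipt; rw [mob_symm_pt h (IsCoprime.cast_ne hab)]; push_cast; rfl

lemma isCoprime_mob {p q r s : ℤ} (h : p * s - q * r = 1) {a b : ℤ} (hab : IsCoprime a b) :
    IsCoprime (p * a + q * b) (r * a + s * b) := by
  obtain ⟨u, v, e⟩ := hab
  exact ⟨u * s - v * r, v * p - u * q, by linear_combination (u * a + v * b) * h + e⟩

/-- Integral matrices of determinant one preserve determinants and coprimality. With `comp_mob_symm`
this permits normalizing source and target independently without losing the bound 2. -/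
lemma FareyBounded.mob_comp {f : RHat → RHat} (hf : FareyBounded f) {p q r s : ℤ}
    (h : (p : ℝ) * s - q * r = 1) : FareyBounded (fun x => mob p q r s h (f x)) := by
  have h' : p * s - q * r = 1 := by exact_mod_cast h
  intro a b c d hdet
  obtain ⟨a', b', c', d', k1, k2, f1, f2, hle⟩ := hf a b c d hdet
  refine ⟨_, _, _, _, isCoprime_mob h' k1, isCoprime_mob h' k2, ?_, ?_, ?_⟩
  · simp only [f1, mob_ipt h k1]
  · simp only [f2, mob_ipt h k2]
  · convert hle using 2
    linear_combination (a' * d' - b' * c') * h'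

lemma FareyBounded.comp_mob_symm {f : RHat → RHat} (hf : FareyBounded f) {p q r s : ℤ}
    (h : (p : ℝ) * s - q * r = 1) : FareyBounded (fun x => f ((mob p q r s h).symm x)) := by
  have h' : p * s - q * r = 1 := by exact_mod_cast h
  intro a b c d hdet
  simp only [mob_symm_ipt h (isCoprime_of_det hdet), mob_symm_ipt h (isCoprime_of_det' hdet)]
  exact hf _ _ _ _ (by linear_combination (a * d - b * c) * h' + hdet)

/-- A reduced fraction that is not an integer has a left neighbour of smaller denominator. -/
lemma exists_left_neighbor {p q : ℤ} (h : IsCoprime p q) (hq : 2 ≤ q) :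
    ∃ r s : ℤ, 1 ≤ s ∧ s < q ∧ p * s - q * r = 1 := by
  obtain ⟨u, v, e⟩ := h
  have h1 := Int.emod_nonneg u (show q ≠ 0 by omega)
  have h2 := Int.emod_lt_of_pos u (show 0 < q by omega)
  have h3 := Int.emod_add_mul_ediv u q
  -- The denominator is the inverse of p modulo q; it is nonzero because q does not divide 1.
  refine ⟨-(v + p * (u / q)), u % q, ?_, h2, by linear_combination e + p * h3⟩
  by_contra hlt
  have h0 : u % q = 0 := by omega
  have hd : q ∣ 1 := ⟨u / q * p + v, by rw [h0] at h3; linear_combination -e - p * h3⟩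
  have := Int.le_of_dvd one_pos hd
  omega

/-! ### Maps that fix infinity -/

section Normalized

variable {f : RHat ≃ₜ RHat} {φ : ℝ → ℝ}

lemma strictMono_of_orientationPreserving (of : OrientationPreserving f) (hinf : f ∞ = ∞)
    (hφ : ∀ t : ℝ, f t = (φ t : ℝ)) : StrictMono φ := fun s t hst => by
  have := of _ _ _ (positive_coe_coe_infty.2 hst)
  rwa [hφ, hφ, hinf, positive_coe_coe_infty] at this

lemma ipt_den_ne_zero {c d : ℤ} {t : ℝ} (h : (t : RHat) = ipt c d) : d ≠ 0 := by
  rintro rfl; simp [ipt] at h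

lemma eq_div_of_coe_eq_ipt {c d : ℤ} {t : ℝ} (h : (t : RHat) = ipt c d) : t = c / d := by
  have hd : (d : ℝ) ≠ 0 := by exact_mod_cast ipt_den_ne_zero h
  simpa [ipt, pt, hd] using h

lemma coe_int_eq_ipt (n : ℤ) : ((n : ℝ) : RHat) = ipt n 1 := by simp [ipt]

/-- An integer is a neighbour of ∞, and the determinant of 1/0 with c/d is d. -/
lemma exists_rep_int (hf : FareyBounded f) (hinf : f ∞ = ∞) (n : ℤ) :
    ∃ c d : ℤ, IsCoprime c d ∧ |d| ≤ 2 ∧ f (ipt n 1) = ipt c d := by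
  obtain ⟨c, d, h, e⟩ := hf.exists_rep (a := n) (b := 1) isCoprime_one_right
  refine ⟨c, d, h, ?_, e⟩
  have := hf.det_le (a := 1) (b := 0) (c := n) (d := 1) (by ring) (x := 1) (y := 0)
    isCoprime_one_left h (by simpa [ipt] using hinf) e
  simpa using this

/-- A non-integer p/q is the mediant of its Farey parents r/s and (p - r)/t. The image has
determinant at most 2 with the images of both parents, and Cramer's rule bounds its denominator by
theirs. The bound does not depend on f. -/
lemma exists_rep_den (hf : FareyBounded f) (hinf : f ∞ = ∞) (q : ℕ) :
    ∀ p : ℤ, 1 ≤ q → IsCoprime p (q : ℤ) →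
      ∃ c d : ℤ, IsCoprime c d ∧ |d| ≤ 4 ^ q ∧ f (ipt p q) = ipt c d := by
  induction q using Nat.strong_induction_on with
  | _ q ih =>
    intro p hq hp
    rcases hq.eq_or_lt with rfl | hq
    · obtain ⟨c, d, h1, h2, h3⟩ := exists_rep_int hf hinf p
      exact ⟨c, d, h1, by linarith, h3⟩
    · obtain ⟨r, s, hs1, hs2, hdet⟩ := exists_left_neighbor hp (by exact_mod_cast hq)
      lift s to ℕ using by omega
      obtain ⟨t, rfl⟩ : ∃ t : ℕ, q = s + t := Nat.exists_eq_add_of_le (by omega)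
      have hdet2 : (p - r) * s - t * r = 1 := by push_cast at hdet; linarith
      have hdet3 : (p - r) * ((s + t : ℕ) : ℤ) - t * p = 1 := by
        push_cast at hdet ⊢; linarith
      obtain ⟨y1, y2, hy, ly, ey⟩ := ih s (by omega) r (by omega) (isCoprime_of_det' hdet)
      obtain ⟨z1, z2, hz, lz, ez⟩ := ih t (by omega) (p - r) (by omega) (isCoprime_of_det hdet2)
      obtain ⟨x1, x2, hx, ex⟩ := hf.exists_rep hp
      refine ⟨x1, x2, hx, ?_, ex⟩
      have d1 := hf.det_le hdet hx hy ex ey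
      have d2 := hf.det_le hdet3 hz hx ez ex
      -- Injectivity keeps the images of the parents distinct, so their integral determinant is
      -- nonzero.
      have d3 : 1 ≤ |z1 * y2 - z2 * y1| := by
        refine Int.one_le_abs fun h0 => ?_
        rw [← ipt_eq_ipt_iff hz hy, ← ez, ← ey] at h0
        have := f.injective h0
        rw [ipt_eq_ipt_iff (isCoprime_of_det hdet2) (isCoprime_of_det' hdet)] at this
        omega
      have hid : (z1 * y2 - z2 * y1) * x2 =
          (x1 * y2 - x2 * y1) * z2 + (z1 * x2 - z2 * x1) * y2 := by ring
      have e1 : (4 : ℤ) ^ s ≥ 4 := by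
        calc (4 : ℤ) = 4 ^ 1 := by norm_num
          _ ≤ 4 ^ s := pow_le_pow_right₀ (by norm_num) (by omega)
      have e2 : (4 : ℤ) ^ t ≥ 4 := by
        calc (4 : ℤ) = 4 ^ 1 := by norm_num
          _ ≤ 4 ^ t := pow_le_pow_right₀ (by norm_num) (by omega)
      calc |x2| ≤ |z1 * y2 - z2 * y1| * |x2| := le_mul_of_one_le_left (abs_nonneg _) d3
        _ = |(x1 * y2 - x2 * y1) * z2 + (z1 * x2 - z2 * x1) * y2| := by rw [← abs_mul, hid]
        _ ≤ |x1 * y2 - x2 * y1| * |z2| + |z1 * x2 - z2 * x1| * |y2| := by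
          rw [← abs_mul, ← abs_mul]; exact abs_add_le _ _
        _ ≤ 2 * 4 ^ t + 2 * 4 ^ s := by gcongr
        -- 2A + 2B ≤ AB once A, B ≥ 4, which is the reason for the base 4.
        _ ≤ 4 ^ (s + t) := by rw [pow_add]; nlinarith

lemma rep_sub_lower {c d c' d' : ℤ} {m : ℝ} (hd : d ≠ 0) (hd' : d' ≠ 0) (h : (|d| : ℝ) ≤ m)
    (h' : (|d'| : ℝ) ≤ m) (hlt : (c / d : ℝ) < c' / d') : 1 / m ^ 2 ≤ (c' / d' - c / d : ℝ) := by
  have hdr : (d : ℝ) ≠ 0 := by exact_mod_cast hd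
  have hdr' : (d' : ℝ) ≠ 0 := by exact_mod_cast hd'
  have h1 : (1 : ℝ) ≤ |(d : ℝ)| := by exact_mod_cast Int.one_le_abs hd
  have h2 : (1 : ℝ) ≤ |(d' : ℝ)| := by exact_mod_cast Int.one_le_abs hd'
  have hm : |(d : ℝ)| * |(d' : ℝ)| ≤ m ^ 2 := by
    rw [sq]; exact mul_le_mul h h' (abs_nonneg _) (by linarith)
  have e : (c' / d' - c / d : ℝ) = (c' * d - d' * c) / (d' * d) := by field_simp
  rw [← abs_of_pos (sub_pos.2 hlt), e, abs_div, abs_mul, mul_comm |(d' : ℝ)|]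
  have hn : c' * d - d' * c ≠ 0 := by
    intro h0
    have : (c' * d - d' * c : ℝ) = 0 := by exact_mod_cast h0
    rw [this] at e
    simp at e
    linarith
  have h3 : (1 : ℝ) ≤ |(c' * d - d' * c : ℝ)| := by exact_mod_cast Int.one_le_abs hn
  gcongr

/-- Both images have denominators at most 2, being images of neighbours of ∞, and their mutual
determinant is a nonzero integer of modulus at most 2. -/
lemma int_step (of : OrientationPreserving f) (hf : FareyBounded f) (hinf : f ∞ = ∞)
    (hφ : ∀ t : ℝ, f t = (φ t : ℝ)) (n : ℤ) :
    1 / 4 ≤ φ (n + 1) - φ n ∧ φ (n + 1) - φ n ≤ 2 := by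
  have hmono := strictMono_of_orientationPreserving of hinf hφ
  obtain ⟨c, d, h, hd, e⟩ := exists_rep_int hf hinf n
  obtain ⟨c', d', h', hd', e'⟩ := exists_rep_int hf hinf (n + 1)
  have hdet := hf.det_le (a := n + 1) (b := 1) (c := n) (d := 1) (by ring) h' h e' e
  rw [← coe_int_eq_ipt, hφ] at e e'
  have e1 := eq_div_of_coe_eq_ipt e
  have e1' := eq_div_of_coe_eq_ipt e'
  push_cast at e1'
  have hlt : φ n < φ (n + 1) := hmono (by linarith)
  have nd := ipt_den_ne_zero e
  have nd' := ipt_den_ne_zero e'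
  have hdr : (d : ℝ) ≠ 0 := by exact_mod_cast nd
  have hdr' : (d' : ℝ) ≠ 0 := by exact_mod_cast nd'
  have kd : (|d| : ℝ) ≤ 2 := by exact_mod_cast hd
  have kd' : (|d'| : ℝ) ≤ 2 := by exact_mod_cast hd'
  have kdet : (|c' * d - d' * c| : ℝ) ≤ 2 := by exact_mod_cast hdet
  constructor
  · have := rep_sub_lower nd nd' kd kd' (by rwa [← e1, ← e1'])
    rw [← e1, ← e1'] at this
    linarith
  · have h1 : (1 : ℝ) ≤ |(d : ℝ)| := by exact_mod_cast Int.one_le_abs nd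
    have h2 : (1 : ℝ) ≤ |(d' : ℝ)| := by exact_mod_cast Int.one_le_abs nd'
    have e : (c' / d' - c / d : ℝ) = (c' * d - d' * c) / (d' * d) := by field_simp
    rw [e1, e1', e]
    refine (le_abs_self _).trans ?_
    rw [abs_div, abs_mul, div_le_iff₀ (by positivity)]
    nlinarith

lemma nat_steps (of : OrientationPreserving f) (hf : FareyBounded f) (hinf : f ∞ = ∞)
    (hφ : ∀ t : ℝ, f t = (φ t : ℝ)) (m : ℤ) (k : ℕ) :
    k / 4 ≤ φ (m + k) - φ m ∧ φ (m + k) - φ m ≤ 2 * k := by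
  induction k with
  | zero => simp
  | succ k ih =>
    have := int_step of hf hinf hφ (m + k)
    push_cast at this ⊢
    rw [← add_assoc]
    constructor <;> linarith [ih.1, ih.2, this.1, this.2]

lemma abs_le_linear (of : OrientationPreserving f) (hf : FareyBounded f) (hinf : f ∞ = ∞)
    (hφ : ∀ t : ℝ, f t = (φ t : ℝ)) (h0 : 0 ≤ φ 0) (h1 : φ 0 ≤ 1) (x : ℝ) :
    |φ x| ≤ 2 * |x| + 3 := by
  have hmono := (strictMono_of_orientationPreserving of hinf hφ).monotone
  have hx : |x| ≤ ⌈|x|⌉₊ := Nat.le_ceil _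
  have hx' : (⌈|x|⌉₊ : ℝ) < |x| + 1 := Nat.ceil_lt_add_one (abs_nonneg _)
  have k1 := nat_steps of hf hinf hφ 0 ⌈|x|⌉₊
  have k2 := nat_steps of hf hinf hφ (-⌈|x|⌉₊) ⌈|x|⌉₊
  push_cast at k1 k2
  rw [neg_add_cancel] at k2
  rw [zero_add] at k1
  have m1 : φ x ≤ φ ⌈|x|⌉₊ := hmono ((le_abs_self x).trans hx)
  have m2 : φ (-⌈|x|⌉₊) ≤ φ x := hmono (by linarith [neg_abs_le x])
  rw [abs_le]
  constructor <;> linarith [k1.2, k2.2]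

lemma exists_rep_rat (hf : FareyBounded f) (hinf : f ∞ = ∞)
    (hφ : ∀ t : ℝ, f t = (φ t : ℝ)) (q : ℚ) :
    ∃ c d : ℤ, d ≠ 0 ∧ (|d| : ℝ) ≤ 4 ^ q.den ∧ φ q = c / d := by
  obtain ⟨c, d, -, h2, h3⟩ := exists_rep_den hf hinf q.den q.num q.den_pos
    q.isCoprime_num_den
  have e : ipt q.num q.den = ((q : ℝ) : RHat) := by
    have : (q.den : ℝ) ≠ 0 := by exact_mod_cast q.den_ne_zero
    simp only [ipt, pt, Int.cast_natCast, this, if_false]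
    rw [← Rat.cast_def]
  rw [e, hφ] at h3
  exact ⟨c, d, ipt_den_ne_zero h3, by exact_mod_cast h2, eq_div_of_coe_eq_ipt h3⟩

/-- An interval of length 2/N contains two consecutive multiples of 1/N; their images are distinct
fractions with denominators at most 4^N. -/
lemma sub_lower_of_small (of : OrientationPreserving f) (hf : FareyBounded f) (hinf : f ∞ = ∞)
    (hφ : ∀ t : ℝ, f t = (φ t : ℝ)) {N : ℕ} (hN : 1 ≤ N) {x y : ℝ} (h : 2 / N ≤ y - x) :
    1 / (4 ^ N) ^ 2 ≤ φ y - φ x := by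
  have hmono := strictMono_of_orientationPreserving of hinf hφ
  have hN0 : (0 : ℝ) < N := by exact_mod_cast hN
  rw [div_le_iff₀ hN0] at h
  have key : ∀ k : ℤ, ∃ c d : ℤ, d ≠ 0 ∧ (|d| : ℝ) ≤ 4 ^ N ∧ φ (k / N) = c / d := fun k => by
    obtain ⟨c, d, h1, h2, h3⟩ := exists_rep_rat hf hinf hφ (k / N)
    refine ⟨c, d, h1, h2.trans ?_, by simpa using h3⟩
    have hdvd := Rat.den_dvd k N
    rw [← Rat.intCast_div_eq_divInt, Int.natCast_dvd_natCast] at hdvd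
    exact pow_le_pow_right₀ (by norm_num) (Nat.le_of_dvd hN (by simpa using hdvd))
  set k := ⌈x * N⌉
  have k1 : x * N ≤ k := Int.le_ceil _
  have k2 : (k : ℝ) < x * N + 1 := Int.ceil_lt_add_one _
  obtain ⟨c, d, h1, h2, h3⟩ := key k
  obtain ⟨c', d', h1', h2', h3'⟩ := key (k + 1)
  have l1 : φ x ≤ φ (k / N) := hmono.monotone ((le_div_iff₀ hN0).2 k1)
  have l2 : φ ((k + 1 : ℤ) / N) ≤ φ y := by
    refine hmono.monotone ((div_le_iff₀ hN0).2 ?_)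
    push_cast
    linarith
  have l3 : φ (k / N) < φ ((k + 1 : ℤ) / N) := by
    refine hmono ((div_lt_div_iff_of_pos_right hN0).2 ?_)
    push_cast
    linarith
  have := rep_sub_lower h1 h1' h2 h2' (by rwa [← h3, ← h3'])
  rw [← h3, ← h3'] at this
  linarith

lemma sub_lower (of : OrientationPreserving f) (hf : FareyBounded f) (hinf : f ∞ = ∞)
    (hφ : ∀ t : ℝ, f t = (φ t : ℝ)) {N : ℕ} (hN : 1 ≤ N) {x y : ℝ} (h : 2 / N ≤ y - x) :
    1 / (12 * (4 ^ N) ^ 2) * (y - x) ≤ φ y - φ x := by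
  have hpow : (1 : ℝ) ≤ (4 ^ N) ^ 2 := one_le_pow₀ (one_le_pow₀ (by norm_num))
  have hpos : 0 < y - x := lt_of_lt_of_le (by positivity) h
  rw [one_div_mul_eq_div, div_le_iff₀ (by positivity)]
  have hmono := strictMono_of_orientationPreserving of hinf hφ
  rcases le_or_gt 3 (y - x) with h3 | h3
  -- A long interval contains at least (y - x)/3 unit steps between integers, each mapped to length
  -- at least 1/4. For y - x < 3 the fixed bound of `sub_lower_of_small` suffices with the same
  -- factor 12.
  · have k1 : x ≤ ⌈x⌉ := Int.le_ceil _
    have k2 : (⌈x⌉ : ℝ) < x + 1 := Int.ceil_lt_add_one _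
    have k3 : (⌊y⌋ : ℝ) ≤ y := Int.floor_le _
    have k4 : y < ⌊y⌋ + 1 := Int.lt_floor_add_one _
    obtain ⟨k, hk⟩ : ∃ k : ℕ, ⌊y⌋ = ⌈x⌉ + k := by
      refine Int.eq_ofNat_of_zero_le (a := ⌊y⌋ - ⌈x⌉) ?_ |>.imp fun k hk => by omega
      have : (⌈x⌉ : ℝ) < ⌊y⌋ := by linarith
      have : ⌈x⌉ < ⌊y⌋ := by exact_mod_cast this
      omega
    have hs := (nat_steps of hf hinf hφ ⌈x⌉ k).1
    have hk' : (⌊y⌋ : ℝ) = ⌈x⌉ + k := by rw [hk]; push_cast; rfl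
    rw [← hk'] at hs
    have m1 := hmono.monotone k1
    have m2 := hmono.monotone k3
    have : (y - x) / 12 ≤ φ y - φ x := by linarith
    nlinarith
  · have := sub_lower_of_small of hf hinf hφ hN h
    rw [div_le_iff₀ (by positivity)] at this
    nlinarith

end Normalized

/-! ### Normalizing by modular matrices, and images of separated points. -/

lemma ipt_one_zero : ipt 1 0 = ∞ := by simp [ipt]

lemma exists_normalizing_mob {g : RHat ≃ₜ RHat} (hg : FareyBounded g) :
    ∃ (p q r s : ℤ) (h : (p : ℝ) * s - q * r = 1), mob p q r s h (g ∞) = ∞ ∧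
      ∃ t : ℝ, 0 ≤ t ∧ t ≤ 1 ∧ mob p q r s h (g ((0 : ℝ) : RHat)) = t := by
  obtain ⟨a, b, hab, e⟩ := hg.exists_rep (isCoprime_one_left : IsCoprime 1 (0 : ℤ))
  rw [ipt_one_zero] at e
  obtain ⟨u, v, huv⟩ := id hab
  have huv' : (u : ℝ) * a + v * b = 1 := by exact_mod_cast huv
  set x := g ((0 : ℝ) : RHat) with hx
  have hne : -(b : ℝ) * nu x + a * de x ≠ 0 := by
    intro h0
    have h1 : x = ipt a b := by
      rw [← pt_nu_de x, ipt, pt_eq_pt_iff (nu_ne_or_de_ne x) (IsCoprime.cast_ne hab)]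
      linarith
    rw [hx, ← e] at h1
    exact coe_ne_infty _ (g.injective h1)
  -- The matrix with rows (u, v) and (-b, a) sends a/b = g(∞) to ∞; translation by -n then brings
  -- the image of 0 into [0, 1).
  set n := ⌊(u * nu x + v * de x) / (-(b : ℝ) * nu x + a * de x)⌋ with hn
  have hdet : ((u + n * b : ℤ) : ℝ) * (a : ℤ) - (v - n * a : ℤ) * (-b : ℤ) = 1 := by
    push_cast; linear_combination huv'
  refine ⟨u + n * b, v - n * a, -b, a, hdet, ?_,
    Int.fract ((u * nu x + v * de x) / (-(b : ℝ) * nu x + a * de x)),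
    Int.fract_nonneg _, (Int.fract_lt_one _).le, ?_⟩
  · rw [e, mob_ipt hdet hab, ← ipt_one_zero,
      ipt_eq_ipt_iff (isCoprime_mob (by exact_mod_cast hdet) hab) isCoprime_one_left]
    ring
  · change mobFun _ _ _ _ x = _
    unfold mobFun pt
    push_cast
    rw [if_neg hne]
    congr 1
    rw [Int.fract, ← hn, div_sub' hne]
    congr 1
    ring

section Normalized

variable {f : RHat ≃ₜ RHat} {φ : ℝ → ℝ}

lemma heightForm_coe (u T t : ℝ) : heightForm u T (t : RHat) = ((t - u) ^ 2 + T ^ 2) / T := by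
  simp [heightForm]

lemma heightForm_infty (u T : ℝ) : heightForm u T ∞ = 1 / T := by
  simp [heightForm]

/-- With s = |x - u| one has |y| ≤ 2s + 4, hence y² ≤ 8s² + 32, and 32 ≤ 48T² because T² ≥ 3/4; this
gives 49. The base point of the image is moved to iT. -/
lemma heightForm_image_le {u T x y : ℝ} (hT : 0 < T) (h3 : 3 ≤ 4 * T ^ 2) (hu : |u| ≤ 1 / 2)
    (h : |y| ≤ 2 * |x| + 3) : heightForm 0 T (y : RHat) ≤ 49 * heightForm u T (x : RHat) := by
  rw [heightForm_coe, heightForm_coe, mul_div_assoc']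
  have h1 : |x| ≤ |x - u| + 1 / 2 := by
    have := abs_add_le (x - u) u
    rw [sub_add_cancel] at this
    linarith
  have h2 : |y| ≤ 2 * |x - u| + 4 := by linarith
  have h4 : y ^ 2 ≤ (2 * |x - u| + 4) ^ 2 := by
    rw [← sq_abs y]; exact pow_le_pow_left₀ (abs_nonneg _) h2 2
  have h5 : (x - u) ^ 2 = |x - u| ^ 2 := (sq_abs _).symm
  rw [div_le_div_iff_of_pos_right hT, h5]
  nlinarith [sq_nonneg (|x - u| - 2)]

lemma heightForm_pos {u T : ℝ} (hT : 0 < T) (x : RHat) : 0 < heightForm u T x := by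
  induction x using OnePoint.rec with
  | infty => rw [heightForm_infty]; positivity
  | coe t => rw [heightForm_coe]; positivity

lemma separated_image_lt (of : OrientationPreserving f) (hf : FareyBounded f) (hinf : f ∞ = ∞)
    (hφ : ∀ t : ℝ, f t = (φ t : ℝ)) (h0 : 0 ≤ φ 0) (h1 : φ 0 ≤ 1) {ε u T : ℝ} (hε : 0 < ε)
    (hε1 : ε ≤ 1 / 2) (hT : 0 < T) (h3 : 3 ≤ 4 * T ^ 2) (hu : |u| ≤ 1 / 2) {N : ℕ} (hN : 1 ≤ N)
    (hNε : 4 / ε ≤ N) {x y : ℝ} (hxy : x < y)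
    (h : ε * (heightForm u T (x : RHat) * heightForm u T (y : RHat)) ≤ wedge (x : RHat) y ^ 2) :
    ((1 / (12 * (4 ^ N) ^ 2)) ^ 2 * ε / 49 ^ 2) *
      (heightForm 0 T (f x) * heightForm 0 T (f y)) ≤ wedge (f x) (f y) ^ 2 := by
  have hN0 : (0 : ℝ) < N := by exact_mod_cast hN
  have hw : ∀ s t : ℝ, wedge (s : RHat) t ^ 2 = (t - s) ^ 2 := fun s t => by
    simp [wedge]; ring
  rw [hw] at h
  have bx := heightForm_image_le hT h3 hu (abs_le_linear of hf hinf hφ h0 h1 x)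
  have bY := heightForm_image_le hT h3 hu (abs_le_linear of hf hinf hφ h0 h1 y)
  have px := heightForm_pos (u := 0) hT (φ x : RHat)
  have py := heightForm_pos (u := 0) hT (φ y : RHat)
  have px' := heightForm_pos (u := u) hT (x : RHat)
  have py' := heightForm_pos (u := u) hT (y : RHat)
  have lower : ∀ t : ℝ, T ≤ heightForm u T (t : RHat) := fun t => by
    rw [heightForm_coe, le_div_iff₀ hT]; nlinarith [sq_nonneg (t - u)]
  have hdist : 2 / N ≤ y - x := by
    -- Heights of real points are at least T and T² ≥ 3/4, so separation forces y - x ≥ ε/2 ≥ 2/N,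
    -- and `sub_lower` applies.
    rw [div_le_iff₀ hε] at hNε
    have h4 : ε * (T * T) ≤ (y - x) ^ 2 := le_trans (by
      have := lower x; have := lower y; gcongr) h
    have h5 : (ε / 2) ^ 2 ≤ (y - x) ^ 2 := by nlinarith
    have h6 : ε / 2 ≤ y - x := abs_le_of_sq_le_sq' h5 (by linarith) |>.2
    rw [div_le_iff₀ hN0]
    nlinarith
  have hlow := sub_lower of hf hinf hφ hN hdist
  set κ : ℝ := 1 / (12 * (4 ^ N) ^ 2) with hκ
  have hκ0 : 0 < κ := by positivity
  rw [hφ, hφ, hw]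
  calc κ ^ 2 * ε / 49 ^ 2 * (heightForm 0 T (φ x : RHat) * heightForm 0 T (φ y : RHat))
      ≤ κ ^ 2 * ε / 49 ^ 2 * ((49 * heightForm u T (x : RHat)) * (49 * heightForm u T (y : RHat))) := by
        gcongr
    _ = κ ^ 2 * (ε * (heightForm u T (x : RHat) * heightForm u T (y : RHat))) := by ring
    _ ≤ κ ^ 2 * (y - x) ^ 2 := by gcongr
    _ = (κ * (y - x)) ^ 2 := by ring
    _ ≤ _ := by
      have : 0 < κ * (y - x) := mul_pos hκ0 (by linarith)
      gcongr

lemma separated_image_infty (of : OrientationPreserving f) (hf : FareyBounded f) (hinf : f ∞ = ∞)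
    (hφ : ∀ t : ℝ, f t = (φ t : ℝ)) (h0 : 0 ≤ φ 0) (h1 : φ 0 ≤ 1) {ε u T κ : ℝ} (hε : 0 < ε)
    (hκ0 : 0 ≤ κ) (hκ : κ ≤ 1) (hT : 0 < T) (h3 : 3 ≤ 4 * T ^ 2) (hu : |u| ≤ 1 / 2) {x : ℝ}
    (h : ε * (heightForm u T (x : RHat) * heightForm u T ∞) ≤ wedge (x : RHat) ∞ ^ 2) :
    (κ ^ 2 * ε / 49 ^ 2) *
      (heightForm 0 T (f x) * heightForm 0 T (f ∞)) ≤ wedge (f x) (f ∞) ^ 2 := by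
  have bx := heightForm_image_le hT h3 hu (abs_le_linear of hf hinf hφ h0 h1 x)
  have px' := heightForm_pos (u := u) hT (x : RHat)
  have hw : ∀ s : ℝ, wedge (s : RHat) ∞ ^ 2 = 1 := fun s => by simp [wedge]
  rw [hφ, hinf, hw]
  rw [hw] at h
  rw [heightForm_infty] at *
  calc κ ^ 2 * ε / 49 ^ 2 * (heightForm 0 T (φ x : RHat) * (1 / T))
      ≤ κ ^ 2 * ε / 49 ^ 2 * (49 * heightForm u T (x : RHat) * (1 / T)) := by gcongr
    _ = κ ^ 2 / 49 * (ε * (heightForm u T (x : RHat) * (1 / T))) := by ring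
    _ ≤ κ ^ 2 / 49 * 1 := by gcongr
    _ ≤ 1 := by nlinarith

lemma separated_image (of : OrientationPreserving f) (hf : FareyBounded f) (hinf : f ∞ = ∞)
    (hφ : ∀ t : ℝ, f t = (φ t : ℝ)) (h0 : 0 ≤ φ 0) (h1 : φ 0 ≤ 1) {ε u T : ℝ} (hε : 0 < ε)
    (hε1 : ε ≤ 1 / 2) (hT : 0 < T) (h3 : 3 ≤ 4 * T ^ 2) (hu : |u| ≤ 1 / 2) {N : ℕ} (hN : 1 ≤ N)
    (hNε : 4 / ε ≤ N) (x y : RHat)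
    (h : ε * (heightForm u T x * heightForm u T y) ≤ wedge x y ^ 2) :
    ((1 / (12 * (4 ^ N) ^ 2)) ^ 2 * ε / 49 ^ 2) *
      (heightForm 0 T (f x) * heightForm 0 T (f y)) ≤ wedge (f x) (f y) ^ 2 := by
  have hκ : (1 / (12 * (4 ^ N) ^ 2) : ℝ) ≤ 1 := by
    have hpow : (1 : ℝ) ≤ (4 ^ N) ^ 2 := one_le_pow₀ (one_le_pow₀ (by norm_num))
    rw [div_le_iff₀ (by positivity)]; linarith
  have hκ0 : 0 ≤ (1 / (12 * (4 ^ N) ^ 2) : ℝ) := by positivity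
  have hxy : x ≠ y := by
    rintro rfl
    have := heightForm_pos (u := u) hT x
    rw [wedge_eq_zero.2 rfl] at h
    have h5 : 0 < ε * (heightForm u T x * heightForm u T x) := by positivity
    linarith
  induction x using OnePoint.rec with
  | infty =>
    induction y using OnePoint.rec with
    | infty => exact absurd rfl hxy
    | coe y =>
      rw [mul_comm (heightForm _ _ _), wedge_comm, neg_sq] at h ⊢
      exact separated_image_infty of hf hinf hφ h0 h1 hε hκ0 hκ hT h3 hu h
  | coe x =>
    induction y using OnePoint.rec with
    | infty => exact separated_image_infty of hf hinf hφ h0 h1 hε hκ0 hκ hT h3 hu h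
    | coe y =>
      rcases lt_or_gt_of_ne (show x ≠ y from fun e => hxy (by rw [e])) with hlt | hlt
      · exact separated_image_lt of hf hinf hφ h0 h1 hε hε1 hT h3 hu hN hNε hlt h
      · rw [mul_comm (heightForm _ _ _), wedge_comm, neg_sq] at h ⊢
        exact separated_image_lt of hf hinf hφ h0 h1 hε hε1 hT h3 hu hN hNε hlt h

end Normalized

/-- Homeomorphisms of bounded Farey distortion are quasi-Möbius. -/
theorem FareyBounded.quasiMoebius {f : RHat ≃ₜ RHat} (of : OrientationPreserving f)
    (hf : FareyBounded f) : QuasiMoebius f := by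
  intro K
  set ε : ℝ := 1 / (2 + K ^ 2) with hεdef
  have hε : 0 < ε := by positivity
  have hε1 : ε ≤ 1 / 2 := by
    rw [hεdef]; gcongr; nlinarith [sq_nonneg K]
  set N : ℕ := ⌈4 / ε⌉₊ with hNdef
  have hNε : 4 / ε ≤ N := Nat.le_ceil _
  have hN : 1 ≤ N := Nat.ceil_pos.2 (by positivity)
  -- The constant depends on K alone. The matrices A and B chosen below depend on the quadruple,
  -- which is harmless because neither changes cross ratios.
  refine ⟨1 / ((1 / (12 * (4 ^ N) ^ 2)) ^ 2 * ε / 49 ^ 2), fun a b c d hp hp' hbal => ?_⟩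
  obtain ⟨p, q, r, s, hdet, u, T, hT, h3, hu, hsep⟩ := exists_mob_separatedFrom hp hp' hbal
  set A := mob p q r s hdet with hA
  have hg : FareyBounded (A.symm.trans f) := hf.comp_mob_symm hdet
  obtain ⟨p', q', r', s', hdet', hinf, t, ht0, ht1, ht⟩ := exists_normalizing_mob hg
  set B := mob p' q' r' s' hdet' with hB
  set g : RHat ≃ₜ RHat := (A.symm.trans f).trans B with hgdef
  have og : OrientationPreserving g :=
    ((orientationPreserving_mob hdet).symm.trans of).trans (orientationPreserving_mob hdet')
  have fg : FareyBounded g := hg.mob_comp hdet'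
  have hφ : ∀ t : ℝ, g t = (nu (g t) : ℝ) := fun t => by
    have hne : g t ≠ ∞ := fun e => coe_ne_infty t (g.injective (e.trans hinf.symm))
    generalize g t = z at hne
    induction z using OnePoint.rec with
    | infty => exact absurd rfl hne
    | coe z => simp
  have h0 : nu (g ((0 : ℝ) : RHat)) = t := by rw [show g ((0 : ℝ) : RHat) = t from ht]; rfl
  have key := separated_image og fg hinf hφ (φ := fun t => nu (g t)) (by rw [h0]; exact ht0)
    (by rw [h0]; exact ht1) hε hε1 hT h3 hu hN hNε
  have hsep' : SeparatedFrom ((1 / (12 * (4 ^ N) ^ 2)) ^ 2 * ε / 49 ^ 2) 0 T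
      (g (A a)) (g (A b)) (g (A c)) (g (A d)) :=
    ⟨key _ _ hsep.1, key _ _ hsep.2.1, key _ _ hsep.2.2.1, key _ _ hsep.2.2.2⟩
  have hfin := hsep'.balanced (by positivity) hT
  have e : ∀ x, g (A x) = B (f x) := fun x => by simp [hgdef]
  rw [e, e, e, e] at hfin
  exact (balanced_mob_iff hdet').1 hfin

/-! ### Combinatorics of ideal triangulations -/

/-- The points `x` and `y` are the endpoints of an edge of `T`. -/
def Joined {V : Type*} (T : Set (Sym2 V)) (x y : V) : Prop := s(x, y) ∈ T

lemma Joined.symm {V : Type*} {T : Set (Sym2 V)} {x y : V} (h : Joined T x y) : Joined T y x := by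
  unfold Joined at *; rwa [Sym2.eq_swap]

/-- No two edges of `T` cross. -/
def NonCrossing (T : Set (Sym2 RHat)) : Prop :=
  ∀ a b c d : RHat, Positive a b c → Positive a c d → Joined T a c → ¬ Joined T b d

/-- Every edge has a triangle on its left. -/
def HasApexes (T : Set (Sym2 RHat)) : Prop :=
  ∀ p q : RHat, Joined T p q → ∃ r, Positive p q r ∧ Joined T q r ∧ Joined T r p

/-- If two apexes lay in the order p, q, r, r', the edges pr and qr' would cross. -/
lemma NonCrossing.apex_unique {T : Set (Sym2 RHat)} (h : NonCrossing T) {p q r r' : RHat}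
    (h1 : Positive p q r) (h2 : Joined T q r) (h3 : Joined T r p)
    (h1' : Positive p q r') (h2' : Joined T q r') (h3' : Joined T r' p) : r = r' := by
  by_contra hne
  have key : ∀ r r' : RHat, Positive p q r → Positive p q r' → Positive p r r' →
      Joined T r p → ¬ Joined T q r' := fun r r' k1 _ k2 j1 =>
    h p q r r' k1 k2 j1.symm
  rcases positive_or_positive h1.ne'.symm hne h1'.ne' with h4 | h4
  · exact key r r' h1 h1' h4 h3 h2'
  · exact key r' r h1' h1 h4.rotate h3' h2

/-! ### The Farey triangulation -/

lemma incl_ratio (a b : ℤ) : incl (ratio a b) = ipt a b := by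
  by_cases hb : b = 0
  · subst hb; simp [ratio, ipt, incl]
  · have : (b : ℝ) ≠ 0 := by exact_mod_cast hb
    simp [ratio, ipt, pt, incl, hb, this]

lemma ipt_neg (a b : ℤ) : ipt (-a) (-b) = ipt a b := by
  unfold ipt; push_cast; exact pt_neg _ _

lemma joined_farey_iff {x y : RHat} : Joined farey x y ↔
    ∃ a b c d : ℤ, a * d - b * c = 1 ∧ x = ipt a b ∧ y = ipt c d := by
  constructor
  · rintro ⟨e, ⟨a, b, c, d, hdet, rfl⟩, he⟩
    rw [Sym2.map_mk, incl_ratio, incl_ratio, Sym2.eq_iff] at he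
    rcases (abs_eq one_pos.le).1 hdet with hdet | hdet <;>
      rcases he with ⟨rfl, rfl⟩ | ⟨rfl, rfl⟩
    · exact ⟨a, b, c, d, hdet, rfl, rfl⟩
    · exact ⟨c, d, -a, -b, by linarith, rfl, (ipt_neg _ _).symm⟩
    · exact ⟨a, b, -c, -d, by linarith, rfl, (ipt_neg _ _).symm⟩
    · exact ⟨c, d, a, b, by linarith, rfl, rfl⟩
  · rintro ⟨a, b, c, d, hdet, rfl, rfl⟩
    exact ⟨_, ⟨a, b, c, d, by rw [hdet, abs_one], rfl⟩, by
      rw [Sym2.map_mk, incl_ratio, incl_ratio]⟩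

lemma positive_ipt {a b c d e f : ℤ}
    (h : 0 < (a * d - b * c) * (c * f - d * e) * (e * b - f * a)) :
    Positive (ipt a b) (ipt c d) (ipt e f) := positive_pt (by exact_mod_cast h)

lemma positive_ipt_iff {a b c d e f : ℤ} (h1 : IsCoprime a b) (h2 : IsCoprime c d)
    (h3 : IsCoprime e f) : Positive (ipt a b) (ipt c d) (ipt e f) ↔
    0 < (a * d - b * c) * (c * f - d * e) * (e * b - f * a) := by
  unfold ipt
  rw [positive_pt_iff (IsCoprime.cast_ne h1) (IsCoprime.cast_ne h2) (IsCoprime.cast_ne h3)]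
  exact_mod_cast Iff.rfl

lemma abs_det_of_joined_farey {a b c d : ℤ} (h1 : IsCoprime a b) (h2 : IsCoprime c d)
    (h : Joined farey (ipt a b) (ipt c d)) : |a * d - b * c| = 1 := by
  obtain ⟨a', b', c', d', hdet, e1, e2⟩ := joined_farey_iff.1 h
  rcases eq_or_neg_of_ipt_eq h1 (isCoprime_of_det hdet) e1 with ⟨rfl, rfl⟩ | ⟨rfl, rfl⟩ <;>
  rcases eq_or_neg_of_ipt_eq h2 (isCoprime_of_det' hdet) e2 with ⟨rfl, rfl⟩ | ⟨rfl, rfl⟩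
  · rw [hdet, abs_one]
  · rw [← abs_neg, ← abs_one (α := ℤ), ← hdet]; congr 1; ring
  · rw [← abs_neg, ← abs_one (α := ℤ), ← hdet]; congr 1; ring
  · rw [← abs_one (α := ℤ), ← hdet]; congr 1; ring

/-- For crossing edges the Plücker relation writes ±1, here 1, as a sum of two nonzero integers of
the same sign, which is impossible. -/
lemma nonCrossing_farey : NonCrossing farey := by
  intro x y z w h1 h2 h3 h4
  obtain ⟨a1, a2, c1, c2, hac, rfl, rfl⟩ := joined_farey_iff.1 h3
  obtain ⟨b1, b2, d1, d2, hbd, rfl, rfl⟩ := joined_farey_iff.1 h4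
  have ca := isCoprime_of_det hac
  have cc := isCoprime_of_det' hac
  have cb := isCoprime_of_det hbd
  have cd := isCoprime_of_det' hbd
  rw [positive_ipt_iff ca cb cc] at h1
  rw [positive_ipt_iff ca cc cd] at h2
  have hpl : (a1 * c2 - a2 * c1) * (b1 * d2 - b2 * d1) =
      (a1 * b2 - a2 * b1) * (c1 * d2 - c2 * d1) + (b1 * c2 - b2 * c1) * (a1 * d2 - a2 * d1) := by
    ring
  rw [show c1 * a2 - c2 * a1 = -1 by linarith] at h1
  rw [hac, show d1 * a2 - d2 * a1 = -(a1 * d2 - a2 * d1) by ring] at h2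
  rw [hac, hbd] at hpl
  generalize a1 * b2 - a2 * b1 = p at *
  generalize b1 * c2 - b2 * c1 = q at *
  generalize c1 * d2 - c2 * d1 = r at *
  generalize a1 * d2 - a2 * d1 = s at *
  have h5 : 0 < (p * r) * (q * s) := by
    have := mul_pos h1 h2
    calc 0 < _ := this
      _ = _ := by ring
  rcases pos_and_pos_or_neg_and_neg_of_mul_pos h5 with ⟨h6, h7⟩ | ⟨h6, h7⟩ <;> linarith

lemma hasApexes_farey : HasApexes farey := by
  intro p q h
  obtain ⟨a, b, c, d, hdet, rfl, rfl⟩ := joined_farey_iff.1 h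
  refine ⟨ipt (a + c) (b + d), positive_ipt ?_, joined_farey_iff.2 ?_, joined_farey_iff.2 ?_⟩
  · rw [hdet, show c * (b + d) - d * (a + c) = -1 by linarith,
      show (a + c) * b - (b + d) * a = -1 by linarith]; norm_num
  · exact ⟨c, d, -(a + c), -(b + d), by linarith, rfl, (ipt_neg _ _).symm⟩
  · exact ⟨a + c, b + d, -a, -b, by linarith, rfl, (ipt_neg _ _).symm⟩

/-- Nonnegative integral matrices of determinant one are products of elementary ones. -/
lemma nat_det_one_induction {motive : ℕ → ℕ → ℕ → ℕ → Prop} (one : motive 1 0 0 1)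
    (left : ∀ a b c d, motive a b c d → motive (a + b) b (c + d) d)
    (right : ∀ a b c d, motive a b c d → motive a (a + b) c (c + d)) :
    ∀ n a b c d : ℕ, a + b + c + d = n → a * d = b * c + 1 → motive a b c d := by
  intro n
  induction n using Nat.strong_induction_on with
  | _ n ih =>
    intro a b c d hn hdet
    have ha : 1 ≤ a := by
      rcases Nat.eq_zero_or_pos a with rfl | h
      · simp at hdet
      · exact h
    have hd : 1 ≤ d := by
      rcases Nat.eq_zero_or_pos d with rfl | h
      · simp at hdet
      · exact h
    by_cases h0 : b = 0 ∧ c = 0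
    · obtain ⟨rfl, rfl⟩ := h0
      simp at hdet
      obtain ⟨rfl, rfl⟩ := hdet
      exact one
    -- Determinant one forces one column to dominate the other, so it can be subtracted; this is the
    -- Euclidean algorithm.
    · have hcase : (a ≤ b ∧ c ≤ d) ∨ (b ≤ a ∧ d ≤ c) := by
        rcases le_or_gt a b with h1 | h1
        · left
          refine ⟨h1, ?_⟩
          by_contra h2
          push Not at h2
          have : a * (d + 1) ≤ b * c := Nat.mul_le_mul h1 h2
          nlinarith
        · right
          refine ⟨h1.le, ?_⟩
          by_contra h2
          push Not at h2
          have : (b + 1) * (c + 1) ≤ a * d := Nat.mul_le_mul h1 h2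
          have : b = 0 := by nlinarith
          have : c = 0 := by nlinarith
          omega
      rcases hcase with ⟨h1, h2⟩ | ⟨h1, h2⟩
      · obtain ⟨b, rfl⟩ := Nat.exists_eq_add_of_le h1
        obtain ⟨d, rfl⟩ := Nat.exists_eq_add_of_le h2
        exact right _ _ _ _ (ih (a + b + c + d) (by omega) a b c d rfl (by linarith))
      · obtain ⟨a, rfl⟩ := Nat.exists_eq_add_of_le h1
        obtain ⟨c, rfl⟩ := Nat.exists_eq_add_of_le h2
        rw [add_comm b, add_comm d]
        exact left _ _ _ _ (ih (a + b + c + d) (by omega) a b c d rfl (by linarith))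

/-- No Farey edge crosses the edge from ∞ to 0, so both ends lie on one side of it. The last case is
an edge from ∞ to a nonpositive integer, where the sign of the representative 1/0 does not match
that side. -/
lemma sign_cases_of_det {a b c d : ℤ} (hb : 0 ≤ b) (hd : 0 ≤ d) (ha : b = 0 → a = 1)
    (hc : d = 0 → c = 1) (hdet : a * d - b * c = 1) :
    (0 ≤ a ∧ 0 ≤ c) ∨ (a ≤ 0 ∧ c ≤ 0) ∨ (a = 1 ∧ b = 0 ∧ c ≤ 0 ∧ d = 1) := by
  rcases hb.eq_or_lt with rfl | hb
  · have := ha rfl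
    subst this
    have hd1 : d = 1 := by linarith
    rcases le_total 0 c with h | h
    · exact Or.inl ⟨by norm_num, h⟩
    · exact Or.inr (Or.inr ⟨rfl, rfl, h, hd1⟩)
  · have hd' : 0 < d := by
      rcases hd.eq_or_lt with rfl | hd
      · have := hc rfl
        subst this
        linarith
      · exact hd
    rcases le_or_gt a 0 with h | h
    · right; left
      refine ⟨h, ?_⟩
      by_contra hlt
      push Not at hlt
      nlinarith
    · left
      refine ⟨h.le, ?_⟩
      by_contra hlt
      push Not at hlt
      nlinarith

/-- The Farey triangulation is connected. -/
lemma farey_induction {P : RHat → RHat → Prop} (symm : ∀ x y, P x y → P y x)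
    (step : ∀ a b c, Positive a b c → Joined farey a b → Joined farey b c → Joined farey c a →
      P a b → P b c) (base : P (ipt 1 0) (ipt 0 1)) :
    ∀ x y, Joined farey x y → P x y := by
  have step' : ∀ u1 u2 v1 v2 : ℤ, u1 * v2 - u2 * v1 = 1 → P (ipt u1 u2) (ipt v1 v2) →
      P (ipt u1 u2) (ipt (u1 + v1) (u2 + v2)) ∧ P (ipt (u1 + v1) (u2 + v2)) (ipt v1 v2) := by
    intro u1 u2 v1 v2 hdet hP
    have hp : Positive (ipt u1 u2) (ipt v1 v2) (ipt (u1 + v1) (u2 + v2)) := by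
      refine positive_ipt ?_
      rw [hdet, show v1 * (u2 + v2) - v2 * (u1 + v1) = -1 by linarith,
        show (u1 + v1) * u2 - (u2 + v2) * u1 = -1 by linarith]; norm_num
    have j1 : Joined farey (ipt u1 u2) (ipt v1 v2) :=
      joined_farey_iff.2 ⟨_, _, _, _, hdet, rfl, rfl⟩
    have j2 : Joined farey (ipt v1 v2) (ipt (u1 + v1) (u2 + v2)) :=
      joined_farey_iff.2 ⟨v1, v2, -(u1 + v1), -(u2 + v2), by linarith, rfl, (ipt_neg _ _).symm⟩
    have j3 : Joined farey (ipt (u1 + v1) (u2 + v2)) (ipt u1 u2) :=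
      joined_farey_iff.2 ⟨u1 + v1, u2 + v2, -u1, -u2, by linarith, rfl, (ipt_neg _ _).symm⟩
    have k1 := step _ _ _ hp j1 j2 j3 hP
    exact ⟨symm _ _ (step _ _ _ hp.rotate j2 j3 j1 k1), symm _ _ k1⟩
  -- The starting edge uv is left arbitrary, so that an elementary matrix can be absorbed by
  -- replacing uv with an edge to its mediant.
  have main : ∀ n a b c d : ℕ, a + b + c + d = n → a * d = b * c + 1 →
      ∀ u1 u2 v1 v2 : ℤ, u1 * v2 - u2 * v1 = 1 → P (ipt u1 u2) (ipt v1 v2) →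
        P (ipt (a * u1 + b * v1) (a * u2 + b * v2)) (ipt (c * u1 + d * v1) (c * u2 + d * v2)) := by
    refine nat_det_one_induction ?_ ?_ ?_
    · intro u1 u2 v1 v2 _ h; simpa using h
    · intro a b c d ih u1 u2 v1 v2 hdet h
      have := ih u1 u2 (u1 + v1) (u2 + v2) (by linarith) (step' _ _ _ _ hdet h).1
      convert this using 2 <;> push_cast <;> ring
    · intro a b c d ih u1 u2 v1 v2 hdet h
      have := ih (u1 + v1) (u2 + v2) v1 v2 (by linarith) (step' _ _ _ _ hdet h).2
      convert this using 2 <;> push_cast <;> ring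
  -- The start (1/0, 0/1) reaches the nonnegative side, and its quarter turn (0/1, -1/0) the
  -- nonpositive one.
  have main2 : ∀ a b c d : ℤ, 0 ≤ a → 0 ≤ b → 0 ≤ c → 0 ≤ d → a * d - b * c = 1 →
      P (ipt a b) (ipt c d) ∧ P (ipt (-b) a) (ipt (-d) c) := by
    intro a b c d ha hb hc hd hdet
    lift a to ℕ using ha
    lift b to ℕ using hb
    lift c to ℕ using hc
    lift d to ℕ using hd
    have hdet' : a * d = b * c + 1 := by zify; linarith
    constructor
    · simpa using main _ a b c d rfl hdet' 1 0 0 1 (by norm_num) base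
    · have := main _ a b c d rfl hdet' 0 1 (-1) 0 (by norm_num)
        (by rw [← ipt_neg (-1) 0]; simpa using symm _ _ base)
      simpa using this
  have main3 : ∀ a b c d : ℤ, 0 ≤ b → 0 ≤ d → (b = 0 → a = 1) → (d = 0 → c = 1) →
      a * d - b * c = 1 → P (ipt a b) (ipt c d) := by
    intro a b c d hb hd ha hc hdet
    rcases sign_cases_of_det hb hd ha hc hdet with ⟨h1, h2⟩ | ⟨h1, h2⟩ | ⟨rfl, rfl, h2, rfl⟩
    · exact (main2 a b c d h1 hb h2 hd hdet).1
    · have := (main2 b (-a) d (-c) hb (by linarith) hd (by linarith) (by linarith)).2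
      simpa using this
    · have := (main2 1 (-c) 0 1 (by norm_num) (by linarith) le_rfl (by norm_num) (by norm_num)).2
      have := symm _ _ this
      rw [← ipt_neg] at this
      simpa using this
  have norm : ∀ a b : ℤ, IsCoprime a b → ∃ a' b' : ℤ, 0 ≤ b' ∧ (b' = 0 → a' = 1) ∧
      ((a' = a ∧ b' = b) ∨ (a' = -a ∧ b' = -b)) := by
    intro a b h
    rcases lt_trichotomy b 0 with hb | rfl | hb
    · exact ⟨-a, -b, by linarith, fun h => by omega, Or.inr ⟨rfl, rfl⟩⟩
    · rcases Int.isUnit_iff.1 (isCoprime_zero_right.1 h) with rfl | rfl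
      · exact ⟨1, 0, le_rfl, fun _ => rfl, Or.inl ⟨rfl, rfl⟩⟩
      · exact ⟨1, 0, le_rfl, fun _ => rfl, Or.inr ⟨rfl, rfl⟩⟩
    · exact ⟨a, b, hb.le, fun h => by omega, Or.inl ⟨rfl, rfl⟩⟩
  intro x y hxy
  obtain ⟨a, b, c, d, hdet, rfl, rfl⟩ := joined_farey_iff.1 hxy
  obtain ⟨a', b', hb, ha, e1⟩ := norm a b (isCoprime_of_det hdet)
  obtain ⟨c', d', hd, hc, e2⟩ := norm c d (isCoprime_of_det' hdet)
  have i1 : ipt a b = ipt a' b' := by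
    rcases e1 with ⟨rfl, rfl⟩ | ⟨rfl, rfl⟩
    · rfl
    · exact (ipt_neg _ _).symm
  have i2 : ipt c d = ipt c' d' := by
    rcases e2 with ⟨rfl, rfl⟩ | ⟨rfl, rfl⟩
    · rfl
    · exact (ipt_neg _ _).symm
  rw [i1, i2]
  have hdet' : a' * d' - b' * c' = 1 ∨ c' * b' - d' * a' = 1 := by
    rcases e1 with ⟨rfl, rfl⟩ | ⟨rfl, rfl⟩ <;> rcases e2 with ⟨rfl, rfl⟩ | ⟨rfl, rfl⟩
    · left; linarith
    · right; linarith
    · right; linarith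
    · left; linarith
  rcases hdet' with h | h
  · exact main3 _ _ _ _ hb hd ha hc h
  · exact symm _ _ (main3 _ _ _ _ hd hb hc ha h)

/-! ### A single flip of the Farey triangulation -/

/-- The set `D` of Farey edges can be flipped simultaneously. -/
structure Flippable (D : Set (Sym2 RHat)) : Prop where
  switches : ∀ e ∈ D, ∃ e', SwitchesDiagonal farey e e'
  disjoint : ∀ a b c : RHat, a ≠ b → b ≠ c → c ≠ a → IsTriangle farey a b c →
    ¬ (s(a, b) ∈ D ∧ s(b, c) ∈ D)

/-- The result of flipping the edges `D` of the Farey triangulation. -/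
def flipped (D : Set (Sym2 RHat)) : Set (Sym2 RHat) :=
  (farey \ D) ∪ {e' | ∃ e ∈ D, SwitchesDiagonal farey e e'}

section Flip

variable {D : Set (Sym2 RHat)}

lemma Flippable.joined_farey (hD : Flippable D) {a c : RHat} (h : Joined D a c) :
    Joined farey a c := by
  obtain ⟨e', x, y, z, w, -, -, h1, -, he, -⟩ := hD.switches _ h
  unfold Joined
  rw [he]
  exact Joined.symm h1.2.2

lemma Flippable.not_joined (hD : Flippable D) {a b c : RHat} (hp : Positive a b c)
    (h1 : Joined farey a b) (h2 : Joined farey b c) (h3 : Joined farey c a) (h : Joined D a b) :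
    ¬ Joined D b c ∧ ¬ Joined D c a :=
  ⟨fun h' => hD.disjoint a b c hp.ne hp.rotate.ne hp.ne' ⟨h1, h2, h3⟩ ⟨h, h'⟩,
    fun h' => hD.disjoint c a b hp.ne' hp.ne hp.rotate.ne ⟨h3, h1, h2⟩ ⟨h', h⟩⟩

lemma joined_flipped_of_not {a b : RHat} (h : Joined farey a b) (h' : ¬ Joined D a b) :
    Joined (flipped D) a b := Or.inl ⟨h, h'⟩

lemma joined_flipped_diagonal {a b c d : RHat} (h : Joined D a c) (h1 : Positive a b c)
    (h2 : Positive a c d) (h3 : Joined farey a c) (h4 : Joined farey a b) (h5 : Joined farey b c)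
    (h6 : Joined farey c d) (h7 : Joined farey d a) : Joined (flipped D) b d :=
  Or.inr ⟨_, h, a, b, c, d, h1, h2, ⟨h4, h5, h3.symm⟩, ⟨h3, h6, h7⟩, rfl, rfl⟩

lemma Flippable.quad_sides (hD : Flippable D) {a b c d : RHat} (h : Joined D a c)
    (hp : Positive a b c) (hp' : Positive a c d) (h1 : Joined farey a b) (h2 : Joined farey b c)
    (h3 : Joined farey c d) (h4 : Joined farey d a) :
    Joined (flipped D) b d ∧ Joined (flipped D) a b ∧ Joined (flipped D) b c ∧
      Joined (flipped D) c d ∧ Joined (flipped D) d a := by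
  have hac := hD.joined_farey h
  have k1 := hD.not_joined hp.rotate.rotate hac.symm h1 h2 h.symm
  have k2 := hD.not_joined hp' hac h3 h4 h
  exact ⟨joined_flipped_diagonal h hp hp' hac h1 h2 h3 h4, joined_flipped_of_not h1 k1.1,
    joined_flipped_of_not h2 k1.2, joined_flipped_of_not h3 k2.1, joined_flipped_of_not h4 k2.2⟩

/-- The quadrilateral around an edge that is flipped. -/
lemma Flippable.exists_quad (hD : Flippable D) {a b c : RHat} (h : Joined D a c)
    (hp : Positive a b c) (h1 : Joined farey a b) (h2 : Joined farey b c) :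
    ∃ d, Positive a c d ∧ Joined farey c d ∧ Joined farey d a ∧ Joined (flipped D) b d ∧
      Joined (flipped D) a b ∧ Joined (flipped D) b c ∧ Joined (flipped D) c d ∧
      Joined (flipped D) d a := by
  obtain ⟨d, hd, h3, h4⟩ := hasApexes_farey a c (hD.joined_farey h)
  exact ⟨d, hd, h3, h4, hD.quad_sides h hp hd h1 h2 h3 h4⟩

lemma joined_flipped_cases {p q : RHat} (h : Joined (flipped D) p q) :
    (Joined farey p q ∧ ¬ Joined D p q) ∨ ∃ a c, Joined D a c ∧ Positive a p c ∧ Positive a c q ∧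
      Joined farey a p ∧ Joined farey p c ∧ Joined farey c q ∧ Joined farey q a := by
  rcases h with h | ⟨e, he, a, b, c, d, hp, hp', ⟨h1, h2, h3⟩, ⟨-, h4, h5⟩, rfl, h6⟩
  · exact Or.inl h
  · rw [Sym2.eq_iff] at h6
    rcases h6 with ⟨rfl, rfl⟩ | ⟨rfl, rfl⟩
    · exact Or.inr ⟨a, c, he, hp, hp', h1, h2, h4, h5⟩
    · exact Or.inr ⟨c, a, Joined.symm he, hp'.rotate, hp.rotate.rotate, h4, h5, h1, h2⟩

/-- For a kept edge, at most one other side of its Farey triangle is flipped; if one is, the far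
vertex of that quadrilateral becomes the apex. For a new diagonal the apex is an end of the old one.
-/
lemma Flippable.hasApexes (hD : Flippable D) : HasApexes (flipped D) := by
  intro p q h
  rcases joined_flipped_cases h with ⟨h, hn⟩ | ⟨a, c, hac, hp, hp', h1, h2, h3, h4⟩
  · obtain ⟨r, hr, h1, h2⟩ := hasApexes_farey p q h
    by_cases hqr : Joined D q r
    · obtain ⟨t, ht, -, -, e1, e2, e3, e4, e5⟩ :=
        hD.exists_quad hqr.symm hr.rotate.rotate h2 h
      exact ⟨t, (hr.rotate.rotate.trans ht).2, e4, e1.symm⟩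
    · by_cases hrp : Joined D r p
      · obtain ⟨t, ht, -, -, e1, e2, e3, e4, e5⟩ := hD.exists_quad hrp.symm hr h h1
        exact ⟨t, (hr.trans ht).1, e1, e5⟩
      · exact ⟨r, hr, joined_flipped_of_not h1 hqr, joined_flipped_of_not h2 hrp⟩
  · obtain ⟨-, e2, -, -, e5⟩ := hD.quad_sides hac hp hp' h1 h2 h3 h4
    exact ⟨a, (hp.trans hp').1.rotate, e5, e2⟩

/-- A Farey edge that crosses the new diagonal of a quadrilateral is the old diagonal. -/
lemma eq_of_cross {a p c q u v : RHat} (hp : Positive a p c) (hp' : Positive a c q)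
    (h1 : Joined farey a p) (h2 : Joined farey p c) (h3 : Joined farey c q)
    (h4 : Joined farey q a) (hu : Positive u p v) (hu' : Positive u v q)
    (huv : Joined farey u v) : u = a ∧ v = c := by
  have n1 := nonCrossing_farey a u p v
  have n2 := nonCrossing_farey q u a v
  have n3 := nonCrossing_farey p v c u
  have n4 := nonCrossing_farey c v q u
  constructor
  · by_contra hne
    have hne' := angle_injective.ne hne
    -- Both u and a lie on the arc from q to p; if they differ, uv crosses one of the two sides at
    -- a.
    have : (Positive a u p ∧ Positive a p v) ∨ (Positive q u a ∧ Positive q a v) := by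
      clear n1 n2 n3 n4
      unfold Positive at *; grind
    rcases this with ⟨k1, k2⟩ | ⟨k1, k2⟩
    · exact n1 k1 k2 h1 huv
    · exact n2 k1 k2 h4 huv
  · by_contra hne
    have hne' := angle_injective.ne hne
    have : (Positive p v c ∧ Positive p c u) ∨ (Positive c v q ∧ Positive c q u) := by
      clear n1 n2 n3 n4
      unfold Positive at *; grind
    rcases this with ⟨k1, k2⟩ | ⟨k1, k2⟩
    · exact n3 k1 k2 h2 huv.symm
    · exact n4 k1 k2 h3 huv.symm

/-- A kept Farey edge across pq would be the removed diagonal ac. If p'q' is itself a new diagonal,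
no side of the first quadrilateral crosses it, since such a side would be the old diagonal a'c'
although sides are not in D. Hence p' = c and q' = a, and the Farey edges ac and a'c' cross. -/
lemma Flippable.not_cross_diagonal (hD : Flippable D) {a p c q p' q' : RHat} (hac : Joined D a c)
    (hp : Positive a p c) (hp' : Positive a c q)
    (h1 : Joined farey a p) (h2 : Joined farey p c) (h3 : Joined farey c q)
    (h4 : Joined farey q a) (k1 : Positive p p' q) (k2 : Positive p q q')
    (h : Joined (flipped D) p' q') : False := by
  rcases joined_flipped_cases h with ⟨h, hn⟩ | ⟨a', c', hac', hq, hq', h1', h2', h3', h4'⟩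
  · have g : Positive q' p p' ∧ Positive q' p' q := by
      unfold Positive at *; grind
    obtain ⟨rfl, rfl⟩ := eq_of_cross hp hp' h1 h2 h3 h4 g.1 g.2 h.symm
    exact hn hac.symm
  · have fac := hD.joined_farey hac
    have fac' := hD.joined_farey hac'
    have notside : ∀ x y, Joined farey x y → ¬ Joined D x y → Positive x p' y → Positive x y q' →
        False := fun x y hxy hn g1 g2 => by
      obtain ⟨rfl, rfl⟩ := eq_of_cross hq hq' h1' h2' h3' h4' g1 g2 hxy
      exact hn hac'
    have s1 := hD.not_joined hp.rotate.rotate fac.symm h1 h2 hac.symm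
    have s2 := hD.not_joined hp' fac h3 h4 hac
    have e1 : p' = c := by
      by_contra hne
      have hne' := angle_injective.ne hne
      have : (Positive p p' c ∧ Positive p c q') ∨ (Positive c p' q ∧ Positive c q q') := by
        clear notside
        unfold Positive at *; grind
      rcases this with ⟨g1, g2⟩ | ⟨g1, g2⟩
      · exact notside _ _ h2 s1.2 g1 g2
      · exact notside _ _ h3 s2.1 g1 g2
    have notside' : ∀ x y, Joined farey x y → ¬ Joined D x y → Positive x q' y → Positive x y p' →
        False := fun x y hxy hn g1 g2 => by
      refine notside y x hxy.symm (fun h => hn h.symm) ?_ ?_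
      · exact g2.rotate
      · exact g1.rotate.rotate
    have e2 : q' = a := by
      by_contra hne
      have hne' := angle_injective.ne hne
      have : (Positive q q' a ∧ Positive q a p') ∨ (Positive a q' p ∧ Positive a p p') := by
        clear notside notside'
        unfold Positive at *; grind
      rcases this with ⟨g1, g2⟩ | ⟨g1, g2⟩
      · exact notside' _ _ h4 s2.2 g1 g2
      · exact notside' _ _ h1 s1.1 g1 g2
    subst e1 e2
    exact nonCrossing_farey _ _ _ _ hq hq' fac' fac.symm

lemma Flippable.nonCrossing (hD : Flippable D) : NonCrossing (flipped D) := by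
  intro x y z w h1 h2 h3 h4
  rcases joined_flipped_cases h3 with ⟨h, hn⟩ | ⟨a, c, hac, hp, hp', k1, k2, k3, k4⟩
  · rcases joined_flipped_cases h4 with ⟨h', -⟩ | ⟨a, c, hac, hp, hp', k1, k2, k3, k4⟩
    · exact nonCrossing_farey _ _ _ _ h1 h2 h h'
    · exact hD.not_cross_diagonal hac hp hp' k1 k2 k3 k4 (p' := z) (q' := x) (h1.trans h2).2
        (h1.trans h2).1.rotate h3.symm
  · exact hD.not_cross_diagonal hac hp hp' k1 k2 k3 k4 h1 h2 h4

/-- The endpoints of an edge of a flip have determinant at most two in modulus. -/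
lemma Flippable.exists_reps (hD : Flippable D) {p q : RHat} (h : Joined (flipped D) p q) :
    ∃ a b c d : ℤ, IsCoprime a b ∧ IsCoprime c d ∧ p = ipt a b ∧ q = ipt c d ∧
      |a * d - b * c| ≤ 2 := by
  rcases joined_flipped_cases h with ⟨h, -⟩ | ⟨x, y, hxy, hp, hp', h1, h2, h3, h4⟩
  · obtain ⟨a, b, c, d, hdet, rfl, rfl⟩ := joined_farey_iff.1 h
    exact ⟨a, b, c, d, isCoprime_of_det hdet, isCoprime_of_det' hdet, rfl, rfl, by
      rw [hdet]; norm_num⟩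
  · have fxy := hD.joined_farey hxy
    obtain ⟨x1, x2, p1, p2, e1, rfl, rfl⟩ := joined_farey_iff.1 h1
    obtain ⟨y1, y2, q1, q2, e2, rfl, rfl⟩ := joined_farey_iff.1 h3
    have cx := isCoprime_of_det e1
    have cp := isCoprime_of_det' e1
    have cy := isCoprime_of_det e2
    have cq := isCoprime_of_det' e2
    have d1 := abs_det_of_joined_farey cx cy fxy
    have d2 := abs_det_of_joined_farey cq cx h4
    have d3 := abs_det_of_joined_farey cp cy h2
    refine ⟨p1, p2, q1, q2, cp, cq, rfl, rfl, ?_⟩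
    -- The Plücker relation again: five of the six determinants are ±1, so the new diagonal has
    -- determinant at most 2.
    have e : (x1 * y2 - x2 * y1) * (p1 * q2 - p2 * q1) =
        (x1 * p2 - x2 * p1) * (y1 * q2 - y2 * q1) -
          (q1 * x2 - q2 * x1) * (p1 * y2 - p2 * y1) := by ring
    calc |p1 * q2 - p2 * q1| = |(x1 * y2 - x2 * y1) * (p1 * q2 - p2 * q1)| := by
          rw [abs_mul, d1, one_mul]
      _ ≤ |(x1 * p2 - x2 * p1) * (y1 * q2 - y2 * q1)| +
          |(q1 * x2 - q2 * x1) * (p1 * y2 - p2 * y1)| := by rw [e]; exact abs_sub _ _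
      _ = 2 := by rw [e1, e2, abs_mul, abs_mul, d2, d3]; norm_num

/-- Any property of edges that propagates through the triangles of a flip and holds for
one edge holds for all edges. -/
lemma Flippable.exists_base (hD : Flippable D) : ∃ p q, Joined (flipped D) p q ∧
    ∀ S : RHat → RHat → Prop, (∀ x y, S x y → S y x) →
      (∀ x y z, Positive x y z → Joined (flipped D) x y → Joined (flipped D) y z →
        Joined (flipped D) z x → S x y → S y z) →
      S p q → ∀ x y, Joined (flipped D) x y → S x y := by
  have main : ∀ S : RHat → RHat → Prop, (∀ x y, S x y → S y x) →
      (∀ x y z, Positive x y z → Joined (flipped D) x y → Joined (flipped D) y z →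
        Joined (flipped D) z x → S x y → S y z) →
      ∀ p q, Joined farey p q → ¬ Joined D p q → S p q →
      (∀ P : RHat → RHat → Prop, (∀ x y, P x y → P y x) → (∀ a b c, Positive a b c →
        Joined farey a b → Joined farey b c → Joined farey c a → P a b → P b c) →
        P p q → ∀ x y, Joined farey x y → P x y) →
      ∀ x y, Joined (flipped D) x y → S x y := by
    intro S symm step p q hpq hn hS ind
    -- Connectedness is transferred from farey: P states S for the edge itself if it is kept, and
    -- for the diagonal replacing it if it is flipped.
    let P : RHat → RHat → Prop := fun a c => (Joined farey a c → ¬ Joined D a c → S a c) ∧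
      (Joined D a c → ∀ b d, Positive a b c → Positive a c d → Joined farey a b →
        Joined farey b c → Joined farey c d → Joined farey d a → S b d)
    have hP : ∀ x y, Joined farey x y → P x y := by
      refine ind P ?_ ?_ ⟨fun _ _ => hS, fun h => absurd h hn⟩
      · rintro x y ⟨h1, h2⟩
        refine ⟨fun h h' => symm _ _ (h1 h.symm fun k => h' k.symm), ?_⟩
        intro h b d k1 k2 k3 k4 k5 k6
        exact symm _ _ (h2 h.symm d b k2.rotate k1.rotate.rotate k5 k6 k3 k4)
      · rintro a b c hp hab hbc hca ⟨h1, h2⟩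
        by_cases dab : Joined D a b
        · obtain ⟨t, ht, f1, f2, e1, e2, e3, e4, e5⟩ :=
            hD.exists_quad dab.symm hp.rotate hbc hca
          have s1 := symm _ _ (h2 dab t c ht.rotate hp f1 f2 hbc hca)
          have hbct := (hp.rotate.trans ht).1
          have s2 := step _ _ _ hbct.rotate e1 e5 e2 s1
          refine ⟨fun _ _ => step _ _ _ hbct.rotate.rotate e5 e2 e1 s2, fun dbc => ?_⟩
          exact absurd dbc (hD.not_joined hp hab hbc hca dab).1
        · have hSab := h1 hab dab
          have jab := joined_flipped_of_not hab dab
          refine ⟨fun _ dbc => ?_, ?_⟩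
          · by_cases dca : Joined D c a
            · obtain ⟨t, ht, f1, f2, e1, e2, e3, e4, e5⟩ := hD.exists_quad dca.symm hp hab hbc
              have s1 := step _ _ _ (hp.trans ht).1 jab e1 e5 hSab
              exact step _ _ _ (hp.trans ht).2.rotate.rotate e1.symm e3 e4 (symm _ _ s1)
            · exact step _ _ _ hp jab (joined_flipped_of_not hbc dbc)
                (joined_flipped_of_not hca dca) hSab
          · intro dbc u v k1 k2 k3 k4 k5 k6
            obtain rfl : v = a := nonCrossing_farey.apex_unique k2 k5 k6 hp.rotate hca hab
            obtain ⟨e1, e2, e3, e4, e5⟩ := hD.quad_sides dbc k1 k2 k3 k4 k5 k6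
            have k3' := (k1.trans k2).1.rotate.rotate
            exact step _ _ _ k3'.rotate e2 e1 jab (step _ _ _ k3' jab e2 e1 hSab)
    intro x y hxy
    rcases joined_flipped_cases hxy with ⟨h, h'⟩ | ⟨a, c, hac, k1, k2, k3, k4, k5, k6⟩
    · exact (hP x y h).1 h h'
    · exact (hP a c (hD.joined_farey hac)).2 hac x y k1 k2 k3 k4 k5 k6
  have hp : Positive (ipt 1 0) (ipt 0 1) (ipt 1 1) := positive_ipt (by norm_num)
  have j1 : Joined farey (ipt 1 0) (ipt 0 1) := joined_farey_iff.2 ⟨1, 0, 0, 1, by norm_num, rfl, rfl⟩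
  have j2 : Joined farey (ipt 0 1) (ipt 1 1) :=
    joined_farey_iff.2 ⟨0, 1, -1, -1, by norm_num, rfl, (ipt_neg 1 1).symm⟩
  have j3 : Joined farey (ipt 1 1) (ipt 1 0) :=
    joined_farey_iff.2 ⟨1, 1, -1, 0, by norm_num, rfl, by
      simpa using (ipt_neg 1 0).symm⟩
  -- The starting edge must be kept; if the edge from ∞ to 0 is flipped, the adjacent edge from 0 to
  -- 1 is not.
  by_cases h : Joined D (ipt 1 0) (ipt 0 1)
  · have hn := (hD.not_joined hp j1 j2 j3 h).1
    refine ⟨_, _, joined_flipped_of_not j2 hn, fun S symm step hS => ?_⟩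
    refine main S symm step _ _ j2 hn hS fun P psymm pstep hP => ?_
    exact farey_induction psymm pstep
      (pstep _ _ _ hp.rotate.rotate j3 j1 j2 (pstep _ _ _ hp.rotate j2 j3 j1 hP))
  · refine ⟨_, _, joined_flipped_of_not j1 h, fun S symm step hS => ?_⟩
    exact main S symm step _ _ j1 h hS fun P psymm pstep hP => farey_induction psymm pstep hP

end Flip

/-! ### Reduced fractions -/

/-- The numerator of an extended rational number in lowest terms. -/
def qn (x : QHat) : ℤ := x.elim 1 Rat.num

/-- The denominator of an extended rational number in lowest terms. -/
def qd (x : QHat) : ℕ := x.elim 0 Rat.den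

@[simp] lemma qn_infty : qn ∞ = 1 := rfl
@[simp] lemma qn_coe (t : ℚ) : qn (t : QHat) = t.num := rfl
@[simp] lemma qd_infty : qd ∞ = 0 := rfl
@[simp] lemma qd_coe (t : ℚ) : qd (t : QHat) = t.den := rfl

lemma ratio_qn_qd (x : QHat) : ratio (qn x) (qd x) = x := by
  induction x using OnePoint.rec with
  | infty => simp [ratio]
  | coe t => simp [ratio, Rat.num_div_den]

lemma incl_eq_ipt (x : QHat) : incl x = ipt (qn x) (qd x) := by
  conv_lhs => rw [← ratio_qn_qd x, incl_ratio]

lemma isCoprime_qn_qd (x : QHat) : IsCoprime (qn x) (qd x : ℤ) := by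
  induction x using OnePoint.rec with
  | infty => exact isCoprime_one_left
  | coe t => exact t.isCoprime_num_den

lemma qn_eq_one {x : QHat} (h : (qd x : ℤ) = 0) : qn x = 1 := by
  induction x using OnePoint.rec with
  | infty => rfl
  | coe t => simp at h

lemma joined_fareyEdges_iff {x y : QHat} :
    Joined fareyEdges x y ↔ |qn x * qd y - qd x * qn y| = 1 := by
  constructor
  · rintro h
    have : Joined farey (incl x) (incl y) := ⟨_, h, rfl⟩
    rw [incl_eq_ipt, incl_eq_ipt] at this
    exact abs_det_of_joined_farey (isCoprime_qn_qd x) (isCoprime_qn_qd y) this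
  · intro h
    exact ⟨qn x, qd x, qn y, qd y, h, by rw [ratio_qn_qd, ratio_qn_qd]⟩

lemma joined_farey_incl_iff {x y : QHat} :
    Joined farey (incl x) (incl y) ↔ Joined fareyEdges x y := by
  refine ⟨fun h => ?_, fun h => ⟨_, h, rfl⟩⟩
  rw [joined_fareyEdges_iff]
  rw [incl_eq_ipt, incl_eq_ipt] at h
  exact abs_det_of_joined_farey (isCoprime_qn_qd x) (isCoprime_qn_qd y) h

lemma exists_incl_of_joined_farey {x y : RHat} (h : Joined farey x y) : ∃ w, x = incl w := by
  obtain ⟨a, b, c, d, -, rfl, -⟩ := joined_farey_iff.1 h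
  exact ⟨ratio a b, (incl_ratio a b).symm⟩

lemma exists_farey_apex {u v : QHat} (h : Joined fareyEdges u v) :
    ∃ w, Positive (incl u) (incl v) (incl w) ∧ Joined fareyEdges v w ∧ Joined fareyEdges w u := by
  obtain ⟨r, hr, h1, h2⟩ := hasApexes_farey _ _ (joined_farey_incl_iff.2 h)
  obtain ⟨w, rfl⟩ := exists_incl_of_joined_farey h2
  exact ⟨w, hr, joined_farey_incl_iff.1 h1, joined_farey_incl_iff.1 h2⟩

/-- Up to rotation, in a positive Farey triangle the third vertex is the mediant of the others. -/
lemma triangle_cases {x y z : QHat} (h : IsTriangle fareyEdges x y z)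
    (hp : Positive (incl x) (incl y) (incl z)) {C : QHat → QHat → QHat → Prop}
    (rot : ∀ x y z, C x y z → C y z x)
    (mediant : ∀ x y z : QHat, qn x * qd y - qd x * qn y = 1 → qn z = qn x + qn y →
      qd z = qd x + qd y → C x y z) : C x y z := by
  obtain ⟨h1, h2, h3⟩ := h
  have h1 := joined_fareyEdges_iff.1 h1
  have h2 := joined_fareyEdges_iff.1 h2
  have h3 := joined_fareyEdges_iff.1 h3
  rw [incl_eq_ipt, incl_eq_ipt, incl_eq_ipt,
    positive_ipt_iff (isCoprime_qn_qd x) (isCoprime_qn_qd y) (isCoprime_qn_qd z)] at hp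
  have key : ∀ x y z : QHat, qn x * qd y - qd x * qn y = 1 → qn y * qd z - qd y * qn z = -1 →
      qn z * qd x - qd z * qn x = -1 → C x y z := fun x y z e1 e2 e3 => by
    refine mediant x y z e1 ?_ ?_
    · linear_combination (-qn z) * e1 - qn x * e2 - qn y * e3
    · zify
      linear_combination (-(qd z : ℤ)) * e1 - (qd x : ℤ) * e2 - (qd y : ℤ) * e3
  rcases (abs_eq one_pos.le).1 h1 with e1 | e1 <;> rcases (abs_eq one_pos.le).1 h2 with e2 | e2 <;>
    rcases (abs_eq one_pos.le).1 h3 with e3 | e3 <;> rw [e1, e2, e3] at hp <;> norm_num at hp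
  · exfalso
    -- The linear relation among three plane vectors would make the sum of the nonnegative
    -- denominators vanish if all three determinants were +1.
    have e4 : (qd x + qd y + qd z : ℤ) = 0 := by
      linear_combination -(qd z : ℤ) * e1 - (qd x : ℤ) * e2 - (qd y : ℤ) * e3
    have hx : (qd x : ℤ) = 0 := by omega
    have hy : (qd y : ℤ) = 0 := by omega
    rw [hx, hy] at e1
    norm_num at e1
  · exact key x y z e1 e2 e3
  · exact rot _ _ _ (rot _ _ _ (key y z x e2 e3 e1))
  · exact rot _ _ _ (key z x y e3 e1 e2)

/-! ### Developing -/

open Classical in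
/-- The apex of a triangle of `T` on the left of an edge. -/
def apex (T : Set (Sym2 RHat)) (p q : RHat) : RHat :=
  if h : ∃ r, Positive p q r ∧ Joined T q r ∧ Joined T r p then h.choose else p

lemma HasApexes.apex_spec {T : Set (Sym2 RHat)} (hT : HasApexes T) {p q : RHat}
    (h : Joined T p q) : Positive p q (apex T p q) ∧ Joined T q (apex T p q) ∧
      Joined T (apex T p q) p := by
  unfold apex
  rw [dif_pos (hT p q h)]
  exact (hT p q h).choose_spec

/-- The vertex of `T` that corresponds to `a P + b Q` in the Stern-Brocot tree below the
edge `P Q`. -/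
def descend (T : Set (Sym2 RHat)) : RHat → RHat → ℕ → ℕ → RHat
  | P, _, _, 0 => P
  | _, Q, 0, _ + 1 => Q
  | P, Q, a + 1, b + 1 =>
    if a ≤ b then descend T (apex T P Q) Q (a + 1) (b - a)
    else descend T P (apex T P Q) (a - b) (b + 1)
termination_by _ _ a b => a + b

variable {T : Set (Sym2 RHat)}

@[simp] lemma descend_zero_right (P Q : RHat) (a : ℕ) : descend T P Q a 0 = P := by
  rw [descend]

lemma descend_zero_left (P Q : RHat) {b : ℕ} (hb : b ≠ 0) : descend T P Q 0 b = Q := by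
  obtain ⟨b, rfl⟩ := Nat.exists_eq_succ_of_ne_zero hb
  rw [Nat.succ_eq_add_one, descend]

lemma descend_right (P Q : RHat) {a b : ℕ} (h : a ≠ 0 ∨ b ≠ 0) :
    descend T P Q a (a + b) = descend T (apex T P Q) Q a b := by
  rcases a with _ | a
  · have hb : b ≠ 0 := by simpa using h
    rw [descend_zero_left _ _ hb, zero_add, descend_zero_left _ _ hb]
  · rw [show a + 1 + b = (a + b) + 1 by ring, descend, if_pos (by omega)]
    congr 1
    omega

/-- On the diagonal the definition takes only the right branch, but either branch ends at the apex,
so the left rule holds there as well. -/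
lemma descend_left (P Q : RHat) (a b : ℕ) :
    descend T P Q (a + b) b = descend T P (apex T P Q) a b := by
  rcases b with _ | b
  · simp
  · rcases a with _ | a
    · rw [descend_zero_left _ _ (by omega), zero_add]
      have := descend_right (T := T) P Q (a := b + 1) (b := 0) (by simp)
      rw [add_zero] at this
      rw [this, descend_zero_right]
    · rw [show a + 1 + (b + 1) = (a + b + 1) + 1 by ring, descend, if_neg (by omega)]
      congr 1
      omega

lemma HasApexes.descend_spec (hT : HasApexes T) {a b c d : ℕ} (hdet : a * d = b * c + 1)
    {P Q : RHat} (hPQ : Joined T P Q) :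
    Joined T (descend T P Q a b) (descend T P Q c d) ∧
      descend T P Q (a + c) (b + d) = apex T (descend T P Q a b) (descend T P Q c d) := by
  -- Nonzero rows are carried along because `descend_right` needs them: at 0, 0 the recursion
  -- returns its first argument.
  have main := nat_det_one_induction (motive := fun a b c d => (a ≠ 0 ∨ b ≠ 0) ∧ (c ≠ 0 ∨ d ≠ 0) ∧
    ∀ P Q, Joined T P Q → Joined T (descend T P Q a b) (descend T P Q c d) ∧
      descend T P Q (a + c) (b + d) = apex T (descend T P Q a b) (descend T P Q c d))
    ?_ ?_ ?_ _ a b c d rfl hdet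
  · exact main.2.2 P Q hPQ
  · refine ⟨by simp, by simp, fun P Q h => ?_⟩
    have e := descend_left (T := T) P Q 0 1
    rw [descend_zero_left _ _ one_ne_zero] at e ⊢
    rw [descend_zero_right]
    exact ⟨h, by simpa using e⟩
  · rintro a b c d ⟨h1, h2, ih⟩
    refine ⟨by omega, by omega, fun P Q h => ?_⟩
    rw [show a + b + (c + d) = (a + c) + (b + d) by ring, descend_left, descend_left, descend_left]
    exact ih _ _ (hT.apex_spec h).2.2.symm
  · rintro a b c d ⟨h1, h2, ih⟩
    refine ⟨by omega, by omega, fun P Q h => ?_⟩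
    rw [show a + b + (c + d) = (a + c) + (b + d) by ring, descend_right _ _ h1,
      descend_right _ _ h2, descend_right _ _ (by omega)]
    exact ih _ _ (hT.apex_spec h).2.1.symm

/-- The developing map that sends `∞` to `P` and `0` to `Q`. -/
def develop (T : Set (Sym2 RHat)) (P Q : RHat) (x : QHat) : RHat :=
  if 0 ≤ qn x then descend T P Q (qn x).natAbs (qd x) else descend T Q P (qd x) (qn x).natAbs

lemma develop_of_nonneg (P Q : RHat) {x : QHat} (h : 0 ≤ qn x) :
    develop T P Q x = descend T P Q (qn x).natAbs (qd x) := if_pos h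

lemma develop_of_nonpos (P Q : RHat) {x : QHat} (h : qn x ≤ 0) :
    develop T P Q x = descend T Q P (qd x) (qn x).natAbs := by
  rcases h.eq_or_lt with h | h
  · rw [develop_of_nonneg _ _ h.ge, h]
    have : qd x ≠ 0 := fun h0 => by
      have := qn_eq_one (x := x) (by exact_mod_cast h0)
      omega
    simp [descend_zero_left _ _ this]
  · exact if_neg (not_le.2 h)

lemma develop_infty (P Q : RHat) : develop T P Q ∞ = P := by
  rw [develop_of_nonneg _ _ (by simp)]; simp

lemma HasApexes.develop_spec (hT : HasApexes T) {P Q : RHat} (hPQ : Joined T P Q) {x y z : QHat}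
    (h : qn x * qd y - qd x * qn y = 1) (hn : qn z = qn x + qn y) (hd : qd z = qd x + qd y) :
    IsTriangle T (develop T P Q x) (develop T P Q y) (develop T P Q z) ∧
      Positive (develop T P Q x) (develop T P Q y) (develop T P Q z) := by
  have tri : ∀ {p q : RHat}, Joined T p q →
      IsTriangle T p q (apex T p q) ∧ Positive p q (apex T p q) := fun h =>
    ⟨⟨h, (hT.apex_spec h).2⟩, (hT.apex_spec h).1⟩
  rcases sign_cases_of_det (Int.natCast_nonneg _) (Int.natCast_nonneg _) qn_eq_one qn_eq_one h with
    ⟨h1, h2⟩ | ⟨h1, h2⟩ | ⟨h1, h2, h3, h4⟩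
  · rw [develop_of_nonneg _ _ h1, develop_of_nonneg _ _ h2,
      develop_of_nonneg _ _ (show 0 ≤ qn z by omega)]
    have hdet : (qn x).natAbs * qd y = qd x * (qn y).natAbs + 1 := by
      zify
      rw [abs_of_nonneg h1, abs_of_nonneg h2]
      linarith
    have := hT.descend_spec hdet hPQ
    rw [show (qn z).natAbs = (qn x).natAbs + (qn y).natAbs by omega, hd, this.2]
    exact tri this.1
  · rw [develop_of_nonpos _ _ h1, develop_of_nonpos _ _ h2,
      develop_of_nonpos _ _ (show qn z ≤ 0 by omega)]
    have hdet : qd x * (qn y).natAbs = (qn x).natAbs * qd y + 1 := by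
      zify
      rw [abs_of_nonpos h1, abs_of_nonpos h2]
      linarith
    have := hT.descend_spec hdet hPQ.symm
    rw [show (qn z).natAbs = (qn x).natAbs + (qn y).natAbs by omega, hd, this.2]
    exact tri this.1
  · rcases h3.eq_or_lt with h3 | h3
    · rw [develop_of_nonneg _ _ (by omega), develop_of_nonneg _ _ (by omega),
        develop_of_nonneg _ _ (show 0 ≤ qn z by omega)]
      have hdet : (qn x).natAbs * qd y = qd x * (qn y).natAbs + 1 := by
        zify
        rw [h1, h2, h3, h4]; simp
      have := hT.descend_spec hdet hPQ
      rw [show (qn z).natAbs = (qn x).natAbs + (qn y).natAbs by omega, hd, this.2]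
      exact tri this.1
    -- Here x = ∞ and y is a negative integer. On this side y is the mediant of z and -1/0, so the
    -- triangle is built from the edge zx with apex y and then rotated.
    · have hx : develop T P Q x = descend T Q P 0 1 := by
        rw [develop_of_nonneg _ _ (by omega), descend_zero_left _ _ one_ne_zero,
          show qd x = 0 by omega, descend_zero_right]
      rw [hx, develop_of_nonpos _ _ h3.le, develop_of_nonpos _ _ (show qn z ≤ 0 by omega),
        show qd z = 1 by omega, show qd y = 1 by omega]
      have hdet : 1 * 1 = (qn z).natAbs * 0 + 1 := by simp
      have := hT.descend_spec hdet hPQ.symm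
      have h5 := tri this.1
      rw [← this.2, show (qn z).natAbs + 1 = (qn y).natAbs by omega] at h5
      exact ⟨⟨h5.1.2.1, h5.1.2.2, h5.1.1⟩, h5.2.rotate⟩

lemma IsDevelopingMap.joined {h : QHat → RHat} (hh : IsDevelopingMap T h) {x y : QHat}
    (hxy : Joined fareyEdges x y) : Joined T (h x) (h y) := by
  unfold Joined
  rw [← hh.1]
  exact ⟨_, hxy, rfl⟩

/-- A connected ideal triangulation has a developing map. -/
theorem exists_isDevelopingMap (hT : HasApexes T) (hN : NonCrossing T) {P Q : RHat}
    (hPQ : Joined T P Q)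
    (hconn : ∀ S : RHat → RHat → Prop, (∀ x y, S x y → S y x) →
      (∀ x y z, Positive x y z → Joined T x y → Joined T y z → Joined T z x → S x y → S y z) →
      S P Q → ∀ x y, Joined T x y → S x y) :
    ∃ h : QHat → RHat, IsDevelopingMap T h := by
  have hspec : ∀ x y z : QHat, IsTriangle fareyEdges x y z →
      Positive (incl x) (incl y) (incl z) →
      IsTriangle T (develop T P Q x) (develop T P Q y) (develop T P Q z) ∧
      Positive (develop T P Q x) (develop T P Q y) (develop T P Q z) := fun x y z h hp =>
    triangle_cases h hp (fun _ _ _ h => ⟨⟨h.1.2.1, h.1.2.2, h.1.1⟩, h.2.rotate⟩)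
      fun x y z e1 e2 e3 => hT.develop_spec hPQ e1 e2 e3
  have htri := fun x y z h hp => (hspec x y z h hp).2
  have hedge : ∀ x y : QHat, Joined fareyEdges x y →
      Joined T (develop T P Q x) (develop T P Q y) := fun x y hxy => by
    obtain ⟨z, hp, h1, h2⟩ := exists_farey_apex hxy
    exact (hspec x y z ⟨hxy, h1, h2⟩ hp).1.1
  refine ⟨develop T P Q, ?_, htri⟩
  apply Set.Subset.antisymm
  · rintro _ ⟨e, he, rfl⟩
    induction e using Sym2.ind with
    | _ x y => exact hedge x y he
  -- Every edge is reached: being an image edge passes through a triangle, because the developed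
  -- apex must be the unique apex.
  · have := hconn (fun x y => ∃ u v, Joined fareyEdges u v ∧ develop T P Q u = x ∧
      develop T P Q v = y) ?_ ?_ ?_
    · intro e he
      induction e using Sym2.ind with
      | _ x y =>
        obtain ⟨u, v, h, rfl, rfl⟩ := this x y he
        exact ⟨_, h, rfl⟩
    · rintro x y ⟨u, v, h, h1, h2⟩
      exact ⟨v, u, h.symm, h2, h1⟩
    · rintro _ _ z hp h1 h2 h3 ⟨u, v, huv, rfl, rfl⟩
      obtain ⟨w, hw, k1, k2⟩ := exists_farey_apex huv
      exact ⟨v, w, k1, rfl, hN.apex_unique (htri u v w ⟨huv, k1, k2⟩ hw) (hedge _ _ k1)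
        (hedge _ _ k2) hp h2 h3⟩
    · refine ⟨∞, ((0 : ℚ) : QHat), joined_fareyEdges_iff.2 (by simp), develop_infty P Q, ?_⟩
      rw [develop_of_nonneg _ _ (by simp)]
      simp [descend_zero_left]

/-! ### Extension of strictly monotone bijections of the rationals -/

/-- A strictly monotone surjection of the rationals extends to the reals. -/
lemma exists_orderIso_extension {ψ : ℚ → ℚ} (hψ : StrictMono ψ) (hs : Function.Surjective ψ) :
    ∃ F : ℝ ≃o ℝ, ∀ q : ℚ, F q = ψ q := by
  let S : ℝ → Set ℝ := fun x => (fun q : ℚ => (ψ q : ℝ)) '' {q | (q : ℝ) < x}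
  let F : ℝ → ℝ := fun x => sSup (S x)
  have hne : ∀ x, (S x).Nonempty := fun x => by
    obtain ⟨q, hq⟩ := exists_rat_lt x
    exact ⟨_, q, hq, rfl⟩
  have hub : ∀ (x : ℝ) (q : ℚ), x ≤ q → ∀ y ∈ S x, y ≤ ψ q := by
    rintro x q hq _ ⟨r, hr, rfl⟩
    have : r < q := by exact_mod_cast (show (r : ℝ) < q from lt_of_lt_of_le hr hq)
    exact Rat.cast_le.2 (hψ this).le
  have hbdd : ∀ x, BddAbove (S x) := fun x => by
    obtain ⟨q, hq⟩ := exists_rat_gt x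
    exact ⟨_, hub x q hq.le⟩
  have hle : ∀ (x : ℝ) (q : ℚ), x ≤ q → F x ≤ ψ q := fun x q hq => csSup_le (hne x) (hub x q hq)
  have hge : ∀ (x : ℝ) (q : ℚ), (q : ℝ) < x → (ψ q : ℝ) ≤ F x := fun x q hq =>
    le_csSup (hbdd x) ⟨q, hq, rfl⟩
  have hF : ∀ q : ℚ, F q = ψ q := fun q => by
    refine le_antisymm (hle _ _ le_rfl) ?_
    by_contra hlt
    push Not at hlt
    -- Surjectivity excludes a jump: a rational in the gap would be ψ t with t < q, hence at most F
    -- q.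
    obtain ⟨r, h1, h2⟩ := exists_rat_btwn hlt
    obtain ⟨t, rfl⟩ := hs r
    have : t < q := hψ.lt_iff_lt.1 (by exact_mod_cast h2)
    exact absurd (hge q t (by exact_mod_cast this)) (not_le.2 h1)
  have hmono : StrictMono F := fun x y hxy => by
    obtain ⟨q, h1, h2⟩ := exists_rat_btwn hxy
    obtain ⟨r, h3, h4⟩ := exists_rat_btwn h2
    calc F x ≤ ψ q := hle _ _ h1.le
      _ < ψ r := by exact_mod_cast hψ (by exact_mod_cast h3)
      _ ≤ F y := hge _ _ h4
  have hval : ∀ r : ℚ, ∃ q : ℚ, F q = r := fun r => by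
    obtain ⟨q, rfl⟩ := hs r
    exact ⟨q, hF q⟩
  have hcont : Continuous F := by
    refine hmono.monotone.continuous_of_denseRange ?_
    refine Rat.denseRange_cast.mono ?_
    rintro _ ⟨r, rfl⟩
    obtain ⟨q, hq⟩ := hval r
    exact ⟨q, hq⟩
  have hsurj : Function.Surjective F := by
    refine hcont.surjective (tendsto_atTop_atTop_of_monotone hmono.monotone fun b => ?_)
      (tendsto_atBot_atBot_of_monotone hmono.monotone fun b => ?_)
    · obtain ⟨r, hr⟩ := exists_rat_gt b
      obtain ⟨q, hq⟩ := hval r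
      exact ⟨q, by rw [hq]; exact hr.le⟩
    · obtain ⟨r, hr⟩ := exists_rat_lt b
      obtain ⟨q, hq⟩ := hval r
      exact ⟨q, by rw [hq]; exact hr.le⟩
  exact ⟨hmono.orderIsoOfSurjective F hsurj, hF⟩

/-- The extension of an order automorphism of the reals to the circle. -/
lemma exists_homeomorph_of_orderIso (F : ℝ ≃o ℝ) : ∃ f : RHat ≃ₜ RHat, OrientationPreserving f ∧
    f ∞ = ∞ ∧ ∀ t : ℝ, f t = (F t : ℝ) := by
  refine ⟨F.toHomeomorph.onePointCongr, ?_, rfl, fun t => rfl⟩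
  have key : ∀ x y : RHat, angle x < angle y →
      angle (F.toHomeomorph.onePointCongr x) < angle (F.toHomeomorph.onePointCongr y) := by
    intro x y h
    induction x using OnePoint.rec with
    | infty => exact absurd h (not_lt.2 (angle_le_pi y))
    | coe s =>
      induction y using OnePoint.rec with
      | infty => exact angle_coe_lt_pi _
      | coe t => exact angle_coe_lt_coe.2 (F.strictMono (angle_coe_lt_coe.1 h))
  rintro x y z (⟨h1, h2⟩ | ⟨h1, h2⟩ | ⟨h1, h2⟩)
  · exact Or.inl ⟨key _ _ h1, key _ _ h2⟩
  · exact Or.inr (Or.inl ⟨key _ _ h1, key _ _ h2⟩)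
  · exact Or.inr (Or.inr ⟨key _ _ h1, key _ _ h2⟩)

/-! ### Developing maps are monotone -/

lemma incl_coe (q : ℚ) : incl (q : QHat) = ((q : ℝ) : RHat) := rfl

lemma incl_infty : incl ∞ = ∞ := rfl

lemma positive_incl_coe_coe_infty {x y : ℚ} (h : x < y) :
    Positive (incl (x : QHat)) (incl (y : QHat)) (incl ∞) :=
  positive_coe_coe_infty.2 (Rat.cast_lt.2 h)

lemma positive_incl_coe {x y z : ℚ} (h : x < y) (h' : y < z) :
    Positive (incl (x : QHat)) (incl (y : QHat)) (incl (z : QHat)) :=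
  positive_coe.2 (Or.inl ⟨Rat.cast_lt.2 h, Rat.cast_lt.2 h'⟩)

/-- `x < y` are neighbours in the Farey triangulation. -/
def Adjacent (x y : ℚ) : Prop := y.num * x.den - x.num * y.den = 1

lemma Adjacent.lt {x y : ℚ} (h : Adjacent x y) : x < y := by
  rw [Rat.lt_iff]; unfold Adjacent at h; linarith

lemma Adjacent.joined {x y : ℚ} (h : Adjacent x y) : Joined fareyEdges (x : QHat) y := by
  rw [joined_fareyEdges_iff]
  unfold Adjacent at h
  rw [abs_sub_comm, qn_coe, qd_coe, qn_coe, qd_coe, show (x.den : ℤ) * y.num - x.num * y.den = 1 by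
    linarith, abs_one]

lemma exists_rat_of_isCoprime {p q : ℤ} (hq : 0 < q) (h : IsCoprime p q) :
    ∃ w : ℚ, w.num = p ∧ (w.den : ℤ) = q := by
  lift q to ℕ using hq.le
  refine ⟨⟨p, q, by omega, ?_⟩, rfl, rfl⟩
  exact Int.isCoprime_iff_gcd_eq_one.1 h

lemma joined_infty_of_den_eq_one {x : ℚ} (h : x.den = 1) :
    Joined fareyEdges (x : QHat) ∞ := by
  rw [joined_fareyEdges_iff]; simp [h]

/-- Triangles of the Farey triangulation go to positive triples. -/
def MapsTriangles (g : QHat → RHat) : Prop :=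
  ∀ x y z : QHat, IsTriangle fareyEdges x y z →
    Positive (incl x) (incl y) (incl z) → Positive (g x) (g y) (g z)

variable {g : QHat → RHat}

/-- The difference of the two coordinate vectors gives the third vertex w of the triangle on the
side towards ∞, with smaller denominators. The positive image of this triangle is glued to the
induction hypothesis for w and one of x, y. Equal denominators mean consecutive integers, and then
the third vertex is ∞. -/
lemma MapsTriangles.positive_of_adjacent (hg : MapsTriangles g) (n : ℕ) :
    ∀ x y : ℚ, x.den + y.den = n → Adjacent x y → Positive (g x) (g y) (g ∞) := by
  induction n using Nat.strong_induction_on with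
  | _ n ih =>
    intro x y hn h
    have hx := x.den_pos
    have hy := y.den_pos
    have h' := h
    unfold Adjacent at h'
    rcases lt_trichotomy x.den y.den with hlt | heq | hlt
    · obtain ⟨w, hw1, hw2⟩ := exists_rat_of_isCoprime (p := y.num - x.num)
        (q := (y.den : ℤ) - x.den) (by omega) ⟨x.den, -x.num, by linarith⟩
      have a1 : Adjacent x w := by unfold Adjacent; rw [hw1, hw2]; linarith
      have a2 : Adjacent y w := by unfold Adjacent; rw [hw1, hw2]; linarith
      have t := hg x y w ⟨h.joined, a2.joined, a1.joined.symm⟩ (positive_incl_coe h.lt a2.lt)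
      exact (t.trans (ih _ (by omega) x w rfl a1)).1
    · have h1 : (x.den : ℤ) * (y.num - x.num) = 1 := by rw [← heq] at h'; linarith
      have h2 : x.den = 1 := by
        have := Int.eq_one_or_neg_one_of_mul_eq_one h1
        omega
      exact hg x y ∞ ⟨h.joined, joined_infty_of_den_eq_one (by omega),
        (joined_infty_of_den_eq_one h2).symm⟩ (positive_incl_coe_coe_infty h.lt)
    · obtain ⟨w, hw1, hw2⟩ := exists_rat_of_isCoprime (p := x.num - y.num)
        (q := (x.den : ℤ) - y.den) (by omega) ⟨-y.den, y.num, by linarith⟩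
      have a1 : Adjacent w y := by unfold Adjacent; rw [hw1, hw2]; linarith
      have a2 : Adjacent w x := by unfold Adjacent; rw [hw1, hw2]; linarith
      have t := hg w x y ⟨a2.joined, h.joined, a1.joined.symm⟩ (positive_incl_coe a2.lt h.lt)
      exact (t.trans (ih _ (by omega) w y rfl a1)).2

lemma positive_trans_right {a b c p : RHat} (h : Positive a b p) (h' : Positive b c p) :
    Positive a c p := by
  have := (h.rotate.rotate.trans h'.rotate.rotate).1
  exact this.rotate

lemma MapsTriangles.positive_of_int (hg : MapsTriangles g) (m : ℤ) (k : ℕ) :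
    Positive (g ((m : ℚ) : QHat)) (g ((m + k + 1 : ℚ) : QHat)) (g ∞) := by
  have hadj : ∀ n : ℤ, Positive (g ((n : ℚ) : QHat)) (g ((n + 1 : ℚ) : QHat)) (g ∞) := fun n => by
    have := hg.positive_of_adjacent _ (n : ℚ) ((n + 1 : ℤ) : ℚ) rfl
      (by simp only [Adjacent, Rat.num_intCast, Rat.den_intCast]; push_cast; ring)
    simpa using this
  induction k with
  | zero => simpa using hadj m
  | succ k ih =>
    refine positive_trans_right ih ?_
    have := hadj (m + k + 1)
    push_cast at this ⊢
    rwa [← add_assoc]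

/-- Developing maps are strictly monotone. -/
lemma MapsTriangles.positive_of_lt (hg : MapsTriangles g) (n : ℕ) :
    ∀ x y : ℚ, x.den + y.den = n → x < y → Positive (g x) (g y) (g ∞) := by
  induction n using Nat.strong_induction_on with
  | _ n ih =>
    intro x y hn h
    have hx := x.den_pos
    have hy := y.den_pos
    have h' := (Rat.lt_iff _ _).1 h
    -- The endpoint of larger denominator is replaced by a Farey neighbour of smaller denominator on
    -- the side of the other endpoint; two integers remain at the end.
    rcases lt_or_ge x.den y.den with hlt | hle
    · obtain ⟨r, s, hs1, hs2, hdet⟩ := exists_left_neighbor y.isCoprime_num_den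
        (show (2 : ℤ) ≤ y.den by omega)
      obtain ⟨w, rfl, rfl⟩ := exists_rat_of_isCoprime (by omega) (isCoprime_of_det' hdet)
      have adj : Adjacent w y := by unfold Adjacent; linarith
      have hxw : x ≤ w := by
        by_contra hlt'
        have h2 := (Rat.lt_iff _ _).1 (not_le.1 hlt')
        -- A fraction strictly between two Farey neighbours has denominator at least the sum of
        -- theirs, so w does not overshoot x.
        have : (w.den : ℤ) * 1 + y.den * 1 ≤ x.den := calc
          (w.den : ℤ) * 1 + y.den * 1 ≤ w.den * (y.num * x.den - x.num * y.den) +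
            y.den * (x.num * w.den - w.num * x.den) := by gcongr <;> linarith
          _ = x.den * (y.num * w.den - y.den * w.num) := by ring
          _ = x.den := by rw [hdet, mul_one]
        omega
      have k := hg.positive_of_adjacent _ _ _ rfl adj
      rcases hxw.eq_or_lt with rfl | hxw
      · exact k
      · exact positive_trans_right (ih _ (by omega) x w rfl hxw) k
    · rcases Nat.lt_or_ge 1 x.den with hx1 | hx1
      · obtain ⟨r, s, hs1, hs2, hdet⟩ := exists_left_neighbor x.isCoprime_num_den
          (show (2 : ℤ) ≤ x.den by omega)
        obtain ⟨w, hw1, hw2⟩ := exists_rat_of_isCoprime (p := x.num - r) (q := x.den - s)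
          (by omega) ⟨s, -r, by linarith⟩
        have adj : Adjacent x w := by unfold Adjacent; rw [hw1, hw2]; linarith
        have hwy : w ≤ y := by
          by_contra hlt'
          have h2 := (Rat.lt_iff _ _).1 (not_le.1 hlt')
          have adj' := adj
          unfold Adjacent at adj'
          have : (x.den : ℤ) * 1 + w.den * 1 ≤ y.den := calc
            (x.den : ℤ) * 1 + w.den * 1 ≤ x.den * (w.num * y.den - y.num * w.den) +
              w.den * (y.num * x.den - x.num * y.den) := by gcongr <;> linarith
            _ = y.den * (w.num * x.den - x.num * w.den) := by ring
            _ = y.den := by rw [adj', mul_one]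
          omega
        have k := hg.positive_of_adjacent _ _ _ rfl adj
        rcases hwy.eq_or_lt with rfl | hwy
        · exact k
        · exact positive_trans_right k (ih _ (by omega) w y rfl hwy)
      · have ex : x = (x.num : ℚ) := (Rat.coe_int_num_of_den_eq_one (by omega)).symm
        have ey : y = (y.num : ℚ) := (Rat.coe_int_num_of_den_eq_one (by omega)).symm
        rw [ex, ey] at h ⊢
        have h3 : x.num < y.num := by exact_mod_cast h
        obtain ⟨k, hk⟩ := Int.eq_ofNat_of_zero_le (show 0 ≤ y.num - x.num - 1 by omega)
        have := hg.positive_of_int x.num k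
        rwa [show (x.num + k + 1 : ℚ) = y.num by
          have : y.num = x.num + k + 1 := by omega
          rw [this]; push_cast; rfl] at this

/-! ### Extension of developing maps -/

variable {D : Set (Sym2 RHat)}

lemma exists_farey_neighbor (x : RHat) (hx : ∃ q, x = incl q) : ∃ y, Joined farey x y := by
  obtain ⟨q, rfl⟩ := hx
  rw [incl_eq_ipt]
  obtain ⟨u, v, h⟩ := isCoprime_qn_qd q
  exact ⟨_, joined_farey_iff.2 ⟨_, _, -v, u, by linarith, rfl, rfl⟩⟩

/-- Two sides of a Farey triangle that meet at q cannot both be flipped, so q remains a vertex. -/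
lemma Flippable.exists_joined_flipped (hD : Flippable D) (q : QHat) :
    ∃ y, Joined (flipped D) (incl q) y := by
  obtain ⟨y, hy⟩ := exists_farey_neighbor _ ⟨q, rfl⟩
  by_cases h : Joined D (incl q) y
  · obtain ⟨r, hr, h1, h2⟩ := hasApexes_farey _ _ hy
    exact ⟨r, (joined_flipped_of_not h2 (hD.not_joined hr hy h1 h2 h).2).symm⟩
  · exact ⟨y, joined_flipped_of_not hy h⟩

lemma Flippable.exists_eq_ipt (hD : Flippable D) (hg : IsDevelopingMap (flipped D) g) (q : QHat) :
    ∃ a b : ℤ, IsCoprime a b ∧ g q = ipt a b := by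
  obtain ⟨y, hy⟩ := exists_farey_neighbor _ ⟨q, rfl⟩
  obtain ⟨w, rfl⟩ := exists_incl_of_joined_farey hy.symm
  obtain ⟨a, b, c, d, h1, -, h2, -⟩ := hD.exists_reps (hg.joined (joined_farey_incl_iff.1 hy))
  exact ⟨a, b, h1, h2⟩

lemma Flippable.exists_apply_eq (hD : Flippable D) (hg : IsDevelopingMap (flipped D) g)
    (q : QHat) : ∃ x, g x = incl q := by
  obtain ⟨y, hy⟩ := hD.exists_joined_flipped q
  unfold Joined at hy
  rw [← hg.1] at hy
  obtain ⟨e, -, he⟩ := hy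
  induction e using Sym2.ind with
  | _ u v =>
    rw [Sym2.map_mk, Sym2.eq_iff] at he
    rcases he with ⟨h, -⟩ | ⟨-, h⟩
    · exact ⟨u, h⟩
    · exact ⟨v, h⟩

/-- A developing map of a flip of the Farey triangulation extends to a quasi-Möbius
homeomorphism of the circle. -/
theorem Flippable.exists_extension (hD : Flippable D) (hg : IsDevelopingMap (flipped D) g) :
    ∃ f : RHat ≃ₜ RHat, OrientationPreserving f ∧ QuasiMoebius f ∧ ∀ q, f (incl q) = g q := by
  obtain ⟨a, b, hab, hinf⟩ := hD.exists_eq_ipt hg ∞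
  obtain ⟨u, v, huv⟩ := id hab
  have hdet : (u : ℝ) * (a : ℤ) - (v : ℤ) * (-b : ℤ) = 1 := by
    push_cast; exact_mod_cast (show u * a - v * -b = 1 by linarith)
  have hdet' : u * a - v * -b = 1 := by linarith
  -- An integral matrix taking the rational point g(∞) to ∞; after it, g becomes a map ψ from ℚ to
  -- ℚ.
  set m := mob u v (-b : ℤ) a hdet with hm
  have om : OrientationPreserving m := orientationPreserving_mob hdet
  have minf : m (g ∞) = ∞ := by
    rw [hinf, hm, mob_ipt hdet hab, ← ipt_one_zero,
      ipt_eq_ipt_iff (isCoprime_mob hdet' hab) isCoprime_one_left]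
    ring
  have hmt : MapsTriangles fun x => m (g x) := fun x y z h hp => om _ _ _ (hg.2 x y z h hp)
  have hlt : ∀ x y : ℚ, x < y → Positive (m (g x)) (m (g y)) ∞ := fun x y h => by
    have := hmt.positive_of_lt _ x y rfl h
    rwa [minf] at this
  have hψ : ∀ x : ℚ, ∃ y : ℚ, m (g x) = ((y : ℝ) : RHat) := fun x => by
    obtain ⟨c, d, hcd, e⟩ := hD.exists_eq_ipt hg x
    have hne : m (g x) ≠ ∞ := (hlt x (x + 1) (by linarith)).ne'.symm
    rw [e, hm, mob_ipt hdet hcd, ← incl_ratio] at hne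
    rw [e, hm, mob_ipt hdet hcd, ← incl_ratio]
    generalize ratio (u * c + v * d) (-b * c + a * d) = w at *
    induction w using OnePoint.rec with
    | infty => exact absurd rfl hne
    | coe y => exact ⟨y, rfl⟩
  choose ψ hψ using hψ
  have mono : StrictMono ψ := fun x y h => by
    have := hlt x y h
    rw [hψ, hψ, positive_coe_coe_infty] at this
    exact_mod_cast this
  -- The preimage of y under m is a rational point, hence a vertex of the flip and a value of g.
  have surj : Function.Surjective ψ := fun y => by
    have e : m.symm (incl (y : QHat)) = incl (ratio (a * y.num + -v * y.den)
        (-(-b) * y.num + u * y.den)) := by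
      rw [incl_ratio, incl_eq_ipt, hm, mob_symm_ipt hdet (isCoprime_qn_qd _)]; rfl
    obtain ⟨x, hx⟩ := hD.exists_apply_eq hg (ratio (a * y.num + -v * y.den)
        (-(-b) * y.num + u * y.den))
    rw [← e] at hx
    have hx' : m (g x) = ((y : ℝ) : RHat) := by rw [hx, Homeomorph.apply_symm_apply]; rfl
    induction x using OnePoint.rec with
    | infty => rw [minf] at hx'; exact absurd hx' (infty_ne_coe _)
    | coe x =>
      rw [hψ, OnePoint.coe_eq_coe] at hx'
      exact ⟨x, by exact_mod_cast hx'⟩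
  obtain ⟨F, hF⟩ := exists_orderIso_extension mono surj
  obtain ⟨f, of, finf, hf⟩ := exists_homeomorph_of_orderIso F
  have hfg : ∀ q, (f.trans m.symm) (incl q) = g q := fun q => by
    rw [Homeomorph.trans_apply, Homeomorph.symm_apply_eq]
    induction q using OnePoint.rec with
    | infty => rw [incl_infty, finf, minf]
    | coe x => rw [incl_coe, hf, hF, hψ]
  have ofm := of.trans om.symm
  refine ⟨f.trans m.symm, ofm, FareyBounded.quasiMoebius ofm ?_, hfg⟩
  intro p q r s h
  rw [← incl_ratio, ← incl_ratio, hfg, hfg]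
  exact hD.exists_reps (hg.joined ⟨p, q, r, s, by rw [h, abs_one], rfl⟩)

/-! ### Transport of flips by homeomorphisms -/

lemma sym2_map_injective (f : RHat ≃ₜ RHat) : Function.Injective (Sym2.map f) :=
  Sym2.map.injective f.injective

lemma isTriangle_image_iff (f : RHat ≃ₜ RHat) {T : Set (Sym2 RHat)} {a b c : RHat} :
    IsTriangle (Sym2.map f '' T) (f a) (f b) (f c) ↔ IsTriangle T a b c := by
  unfold IsTriangle
  simp only [← Sym2.map_mk, (sym2_map_injective f).mem_set_image]

lemma switchesDiagonal_image_iff {f : RHat ≃ₜ RHat} (of : OrientationPreserving f)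
    {T : Set (Sym2 RHat)} {e e' : Sym2 RHat} :
    SwitchesDiagonal (Sym2.map f '' T) (Sym2.map f e) (Sym2.map f e') ↔
      SwitchesDiagonal T e e' := by
  unfold SwitchesDiagonal
  constructor
  · rintro ⟨a, b, c, d, h1, h2, h3, h4, h5, h6⟩
    obtain ⟨a, rfl⟩ := f.surjective a
    obtain ⟨b, rfl⟩ := f.surjective b
    obtain ⟨c, rfl⟩ := f.surjective c
    obtain ⟨d, rfl⟩ := f.surjective d
    rw [← Sym2.map_mk] at h5 h6
    exact ⟨a, b, c, d, of.iff.1 h1, of.iff.1 h2, (isTriangle_image_iff f).1 h3,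
      (isTriangle_image_iff f).1 h4, sym2_map_injective f h5, sym2_map_injective f h6⟩
  · rintro ⟨a, b, c, d, h1, h2, h3, h4, rfl, rfl⟩
    exact ⟨f a, f b, f c, f d, of _ _ _ h1, of _ _ _ h2, (isTriangle_image_iff f).2 h3,
      (isTriangle_image_iff f).2 h4, rfl, rfl⟩

lemma sym2_map_surjective (f : RHat ≃ₜ RHat) : Function.Surjective (Sym2.map f) := fun e =>
  ⟨Sym2.map f.symm e, by rw [Sym2.map_map]; simp⟩

/-- A flip of the image of the Farey triangulation is the image of a flip. -/
lemma exists_flippable_of_isFlip {f : RHat ≃ₜ RHat} (of : OrientationPreserving f)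
    {T' : Set (Sym2 RHat)} (h : IsFlip (Sym2.map f '' farey) T') :
    ∃ D, Flippable D ∧ T' = Sym2.map f '' flipped D := by
  obtain ⟨D, h1, h2, rfl⟩ := h
  refine ⟨Sym2.map f ⁻¹' D, ⟨?_, ?_⟩, ?_⟩
  · intro e he
    obtain ⟨e', he'⟩ := h1 _ he
    obtain ⟨e', rfl⟩ := sym2_map_surjective f e'
    exact ⟨e', (switchesDiagonal_image_iff of).1 he'⟩
  · rintro a b c hab hbc hca ht ⟨k1, k2⟩
    exact h2 (f a) (f b) (f c) (f.injective.ne hab) (f.injective.ne hbc) (f.injective.ne hca)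
      ((isTriangle_image_iff f).2 ht) ⟨k1, k2⟩
  · ext e
    obtain ⟨e, rfl⟩ := sym2_map_surjective f e
    rw [(sym2_map_injective f).mem_set_image]
    simp only [flipped, Set.mem_union, Set.mem_sdiff, (sym2_map_injective f).mem_set_image,
      Set.mem_preimage, Set.mem_ofPred_eq]
    refine or_congr Iff.rfl ⟨?_, ?_⟩
    · rintro ⟨e', he', hs⟩
      obtain ⟨e', rfl⟩ := sym2_map_surjective f e'
      exact ⟨e', he', (switchesDiagonal_image_iff of).1 hs⟩
    · rintro ⟨e', he', hs⟩
      exact ⟨_, he', (switchesDiagonal_image_iff of).2 hs⟩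

/-- This treats farey as a flip of itself, so that `Flippable.exists_extension` also covers its own
developing maps. -/
lemma flippable_empty : Flippable ∅ := ⟨by simp, by simp⟩

lemma flipped_empty : flipped ∅ = farey := by simp [flipped]

lemma Flippable.exists_isDevelopingMap {D : Set (Sym2 RHat)} (hD : Flippable D) :
    ∃ h, IsDevelopingMap (flipped D) h := by
  obtain ⟨p, q, hpq, hconn⟩ := hD.exists_base
  exact FareyFlips.exists_isDevelopingMap hD.hasApexes hD.nonCrossing hpq hconn

/-- A triangulation obtained by flips is the image of the Farey triangulation by a quasi-Möbius
homeomorphism. -/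
theorem FlipReachable.exists_homeomorph {T : Set (Sym2 RHat)} (hT : FlipReachable T) :
    ∃ f : RHat ≃ₜ RHat, OrientationPreserving f ∧ QuasiMoebius f ∧ T = Sym2.map f '' farey := by
  unfold FlipReachable at hT
  induction hT with
  | refl =>
    refine ⟨Homeomorph.refl _, fun _ _ _ h => h, quasiMoebius_refl, ?_⟩
    rw [show ⇑(Homeomorph.refl RHat) = id from rfl, Sym2.map_id, Set.image_id]
  | tail _ hflip ih =>
    obtain ⟨f, of, qf, rfl⟩ := ih
    obtain ⟨D, hD, rfl⟩ := exists_flippable_of_isFlip of hflip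
    obtain ⟨h, hh⟩ := hD.exists_isDevelopingMap
    obtain ⟨g, og, qg, hg⟩ := hD.exists_extension hh
    -- The flip of farey is g(farey), because its developing map is the restriction of g; applying f
    -- gives the new triangulation.
    refine ⟨g.trans f, og.trans of, qg.trans og qf, ?_⟩
    have e : h = g ∘ incl := funext fun q => (hg q).symm
    rw [← hh.1, e, farey, Set.image_image, Set.image_image]
    simp only [Sym2.map_map]
    rfl

lemma IsDevelopingMap.comp_symm {f : RHat ≃ₜ RHat} (of : OrientationPreserving f)
    {h : QHat → RHat} (hh : IsDevelopingMap (Sym2.map f '' farey) h) :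
    IsDevelopingMap farey (fun q => f.symm (h q)) := by
  refine ⟨?_, fun x y z ht hp => of.symm _ _ _ (hh.2 x y z ht hp)⟩
  have e : Sym2.map (fun q => f.symm (h q)) '' fareyEdges =
      Sym2.map f.symm '' (Sym2.map h '' fareyEdges) := by
    rw [Set.image_image]
    simp only [Sym2.map_map]
    rfl
  rw [e, hh.1, Set.image_image]
  simp [Sym2.map_map]

end FareyFlips

end

theorem corollary4p2 (T : Set (Sym2 FareyFlips.RHat)) (hT : FareyFlips.FlipReachable T) :
    (∃ h : FareyFlips.QHat → FareyFlips.RHat, FareyFlips.IsDevelopingMap T h) ∧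
    ∀ h : FareyFlips.QHat → FareyFlips.RHat, FareyFlips.IsDevelopingMap T h →
      ∃ f : FareyFlips.RHat ≃ₜ FareyFlips.RHat,
        FareyFlips.Quasisymmetric f ∧ ∀ q : FareyFlips.QHat, f (FareyFlips.incl q) = h q := by
  obtain ⟨f, of, qf, rfl⟩ := hT.exists_homeomorph
  constructor
  · refine ⟨fun q => f (FareyFlips.incl q), ?_, fun x y z _ hp => of _ _ _ hp⟩
    rw [FareyFlips.farey, Set.image_image]
    simp only [Sym2.map_map]
    rfl
  · intro h hh
    -- The map f⁻¹ ∘ h develops farey, so it extends to a quasi-Möbius g, and h is the restriction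
    -- of f ∘ g.
    have hh' := hh.comp_symm of
    rw [← FareyFlips.flipped_empty] at hh'
    obtain ⟨g, og, qg, hg⟩ := FareyFlips.flippable_empty.exists_extension hh'
    refine ⟨g.trans f, (qg.trans og qf).quasisymmetric (og.trans of), fun q => ?_⟩
    rw [Homeomorph.trans_apply, hg, Homeomorph.apply_symm_apply]
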